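/- Let $\Bbbk$ be a field of characteristic $0$ and $n\ge 2$. For every pair $i<j$ in $\{1,\dots,n\}$ take two arrows $x,y\colon i\to j$ and two opposite arrows $x^*,y^*\colon j\to i$ (with $x^{**}=x$, $y^{**}=y$), and for every vertex $i$ a loop $z$. Let $\widehat A$ be the path algebra of this quiver modulo the two-sided ideal generated by all paths of length two with distinct end points and by the elements $e_i(c^*d-\delta_{c,d}z)e_i$ for $c,d\in\{x,y,x^*,y^*\}$, where $e_i$ denotes the length-zero path at $i$ and paths are written from left to right. Grade $\widehat A$ by $\deg e_i=0$, $\deg z=1$, $\deg x=\deg y^*=1$, $\deg x^*=\deg y=0$ (the $\widetilde o$-grading). Let $\mathcal D$ be the homotopy category of bounded complexes of finitely generated projective graded left $\widehat A$-modules (with degree-preserving maps), let $\langle 1\rangle$ be the grading shift $M\langle 1\rangle_d=M_{d+1}$, and let $P_i=\widehat Ae_i$ with $e_i$ in degree $0$. For integers $a\le b$ let $\mathcal D_{[a,b]}\subset\mathcal D$ be the full subcategory of objects whose minimal complex (the homotopy equivalent bounded complex without nonzero contractible direct summands) has all its chain groups isomorphic to finite direct sums of modules $P_i\langle l\rangle$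 with $a\le l\le b$; put $\mathcal D_0=\mathcal D_{[0,0]}$. Let $\Sigma_i$ and $\Sigma_i^{-1}$ be the endofunctors of $\mathcal D$ given by tensoring over $\widehat A$ with the complexes of graded bimodules $$\widehat A\xrightarrow{g_i}(\widehat Ae_i\otimes_\Bbbk e_i\widehat A)\langle 1\rangle,\qquad \widehat Ae_i\otimes_\Bbbk e_i\widehat A\xrightarrow{f_i}\widehat A,$$ with $\widehat A$ in homological degree $0$, where $f_i(e_i\otimes e_i)=e_i$ and $g_i(1)=z\otimes e_i+e_i\otimes z+\sum_c c\otimes c^*$ ($z$ the loop at $i$), the sum being over all arrows $c$ other than loops ending at $i$. Let $F_n$ be the free group on $\sigma_1,\dots,\sigma_n$. For $\beta\in F_n$ let $\Psi_\beta$ be the composite of the functors $\Sigma_i^{\pm1}$ determined by an expression of $\beta$ as a word in the $\sigma_i^{\pm1}$ (the leftmost letter applied last). Then for every $\beta\in F_n$ there is a unique smallest interval $[\phi_-(\beta),\phi_+(\beta)]$ of integers such that $\Psi_\beta(\mathcal D_0)\subset\mathcal D_{[\phi_-(\beta),\phi_+(\beta)]}$; it does not depend on the chosen word expressing $\beta$,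 and $\phi_-(\beta)\le 0\le\phi_+(\beta)$. Moreover, if $\beta=\sigma_{i_1}^{\epsilon_1}\cdots\sigma_{i_r}^{\epsilon_r}$ ($\epsilon_s=\pm1$) is the reduced expression of $\beta$, then 1. $\phi_+(\beta)$ is the number of $s$ with $\epsilon_s=+1$; 2. $-\phi_-(\beta)$ is the number of $s$ with $\epsilon_s=-1$; 3. the baric spread $\phi_+(\beta)-\phi_-(\beta)$ equals the word length of $\beta$ in the generators $\sigma_1^{\pm1},\dots,\sigma_n^{\pm1}$. -/

import Mathlib

universe u

open CategoryTheory CategoryTheory.Limits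
open scoped TensorProduct

namespace Zigzag

/-- The two colours of edges of the doubled complete graph. -/
inductive Label
  | x
  | y
  deriving DecidableEq

instance : Fintype Label := ⟨{Label.x, Label.y}, by intro a; cases a <;> simp⟩

/-- The arrows of the Ginzburg double other than the loops: one arrow `i ⟶ j` of each colour for
every ordered pair `i ≠ j`. For `i < j` the arrow `i ⟶ j` of colour `x` is written `x` and the
arrow `j ⟶ i` of colour `x` is written `x*`; likewise for `y`. -/
abbrev Arrow (n : ℕ) : Type := Label × {p : Fin n × Fin n // p.1 ≠ p.2}

namespace Arrow

variable {n : ℕ}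

def label (a : Arrow n) : Label := a.1

def src (a : Arrow n) : Fin n := a.2.1.1

def tgt (a : Arrow n) : Fin n := a.2.1.2

/-- The opposite arrow `a*` of the same colour. -/
def star (a : Arrow n) : Arrow n := (a.1, ⟨(a.2.1.2, a.2.1.1), fun h => a.2.2 h.symm⟩)

/-- The degree of an arrow for the symmetric orientation: for `i < j` the `x`-edge is oriented
`i ⟶ j` and the `y`-edge is oriented `j ⟶ i`, so that `x` and `y*` have degree `1`, while `x*` and
`y` have degree `0`. -/
def deg (a : Arrow n) : ℤ :=
  match a.label with
  | Label.x => if a.src < a.tgt then 1 else 0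
  | Label.y => if a.src < a.tgt then 0 else 1

@[simp] lemma star_src (a : Arrow n) : a.star.src = a.tgt := rfl
@[simp] lemma star_tgt (a : Arrow n) : a.star.tgt = a.src := rfl
@[simp] lemma star_star (a : Arrow n) : a.star.star = a := rfl
lemma src_ne_tgt (a : Arrow n) : a.src ≠ a.tgt := a.2.2
lemma star_eq_iff (a b : Arrow n) : a.star = b ↔ a = b.star :=
  ⟨fun h => by rw [← h, star_star], fun h => by rw [h, star_star]⟩

lemma deg_add_deg_star (a : Arrow n) : a.deg + a.star.deg = 1 := by
  have h := a.src_ne_tgt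
  have h2 : a.star.label = a.label := rfl
  unfold deg
  rw [h2, star_src, star_tgt]
  rcases lt_or_gt_of_ne h with h1 | h1 <;> cases a.label <;> simp [h1, not_lt.mpr h1.le]

lemma deg_eq (a : Arrow n) : a.deg = 0 ∨ a.deg = 1 := by
  unfold deg
  split <;> split_ifs <;> simp

end Arrow

/-- The zigzag algebra of the doubled complete graph on `n` vertices, with its standard basis:
the idempotents `e i`, the arrows, and the loops `z i`. That this is the path algebra of the
Ginzburg double modulo the zigzag relations (for `n ≥ 2`) is proved in `fromPresentation_bijective`;
for `n = 1` it is `k[z]/z²`. -/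
def ZigzagAlgebra (k : Type u) (n : ℕ) : Type u := (Fin n → k) × (Arrow n → k) × (Fin n → k)

namespace ZigzagAlgebra

variable {k : Type u} [Field k] {n : ℕ}

instance : AddCommGroup (ZigzagAlgebra k n) :=
  inferInstanceAs (AddCommGroup ((Fin n → k) × (Arrow n → k) × (Fin n → k)))

instance : Module k (ZigzagAlgebra k n) :=
  inferInstanceAs (Module k ((Fin n → k) × (Arrow n → k) × (Fin n → k)))

instance : Module.Finite k (ZigzagAlgebra k n) :=
  inferInstanceAs (Module.Finite k ((Fin n → k) × (Arrow n → k) × (Fin n → k)))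

/-- Coefficient of the idempotent at `i`. -/
def idem (a : ZigzagAlgebra k n) (i : Fin n) : k := a.1 i

/-- Coefficient of an arrow. -/
def arr (a : ZigzagAlgebra k n) (c : Arrow n) : k := a.2.1 c

/-- Coefficient of the loop at `i`. -/
def loop (a : ZigzagAlgebra k n) (i : Fin n) : k := a.2.2 i

@[ext] lemma ext {a b : ZigzagAlgebra k n} (h1 : ∀ i, a.idem i = b.idem i)
    (h2 : ∀ c, a.arr c = b.arr c) (h3 : ∀ i, a.loop i = b.loop i) : a = b :=
  Prod.ext (funext h1) (Prod.ext (funext h2) (funext h3))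

instance : One (ZigzagAlgebra k n) := ⟨(1, 0, 0)⟩

/-- The product: paths are composed from left to right, `a a* = z` at the source of every arrow `a`,
and all other products of two arrows, and all products of a loop with an arrow or a loop,
vanish. -/
instance : Mul (ZigzagAlgebra k n) :=
  ⟨fun a b =>
    (fun i => a.idem i * b.idem i,
     fun c => a.idem c.src * b.arr c + a.arr c * b.idem c.tgt,
     fun i => a.idem i * b.loop i + a.loop i * b.idem i +
       ∑ c : Arrow n, if c.src = i then a.arr c * b.arr c.star else 0)⟩

section
variable (a b : ZigzagAlgebra k n) (r : k) (i : Fin n) (c : Arrow n)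
@[simp] lemma add_idem : (a + b).idem i = a.idem i + b.idem i := rfl
@[simp] lemma add_arr : (a + b).arr c = a.arr c + b.arr c := rfl
@[simp] lemma add_loop : (a + b).loop i = a.loop i + b.loop i := rfl
@[simp] lemma smul_idem : (r • a).idem i = r * a.idem i := rfl
@[simp] lemma smul_arr : (r • a).arr c = r * a.arr c := rfl
@[simp] lemma smul_loop : (r • a).loop i = r * a.loop i := rfl
@[simp] lemma zero_idem : (0 : ZigzagAlgebra k n).idem i = 0 := rfl
@[simp] lemma zero_arr : (0 : ZigzagAlgebra k n).arr c = 0 := rfl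
@[simp] lemma zero_loop : (0 : ZigzagAlgebra k n).loop i = 0 := rfl
@[simp] lemma one_idem : (1 : ZigzagAlgebra k n).idem i = 1 := rfl
@[simp] lemma one_arr : (1 : ZigzagAlgebra k n).arr c = 0 := rfl
@[simp] lemma one_loop : (1 : ZigzagAlgebra k n).loop i = 0 := rfl
@[simp] lemma mul_idem : (a * b).idem i = a.idem i * b.idem i := rfl
@[simp] lemma mul_arr : (a * b).arr c = a.idem c.src * b.arr c + a.arr c * b.idem c.tgt := rfl
@[simp] lemma mul_loop : (a * b).loop i = a.idem i * b.loop i + a.loop i * b.idem i +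
    ∑ c : Arrow n, if c.src = i then a.arr c * b.arr c.star else 0 := rfl
end

instance : Ring (ZigzagAlgebra k n) :=
  { (inferInstance : AddCommGroup (ZigzagAlgebra k n)),
    (inferInstance : One (ZigzagAlgebra k n)),
    (inferInstance : Mul (ZigzagAlgebra k n)) with
    left_distrib := by
      intro a b c
      ext i
      · simp [mul_add]
      · simp; ring
      · have : ∀ d : Arrow n, (if d.src = i then a.arr d * (b.arr d.star + c.arr d.star) else 0)
            = (if d.src = i then a.arr d * b.arr d.star else 0) +
              (if d.src = i then a.arr d * c.arr d.star else 0) := by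
          intro d; split_ifs <;> ring
        simp only [mul_loop, add_idem, add_loop, add_arr, this, Finset.sum_add_distrib]; ring
    right_distrib := by
      intro a b c
      ext i
      · simp [add_mul]
      · simp; ring
      · have : ∀ d : Arrow n, (if d.src = i then (a.arr d + b.arr d) * c.arr d.star else 0)
            = (if d.src = i then a.arr d * c.arr d.star else 0) +
              (if d.src = i then b.arr d * c.arr d.star else 0) := by
          intro d; split_ifs <;> ring
        simp only [mul_loop, add_idem, add_loop, add_arr, this, Finset.sum_add_distrib]; ring
    zero_mul := by intro a; ext i <;> simp
    mul_zero := by intro a; ext i <;> simp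
    one_mul := by intro a; ext i <;> simp
    mul_one := by intro a; ext i <;> simp
    mul_assoc := by
      intro a b c
      ext i
      · simp [mul_assoc]
      · simp; ring
      · simp only [mul_loop, mul_idem, mul_arr, Arrow.star_src, Arrow.star_tgt]
        have h1 : ∀ d : Arrow n, (if d.src = i then
            (a.idem d.src * b.arr d + a.arr d * b.idem d.tgt) * c.arr d.star else 0)
            = a.idem i * (if d.src = i then b.arr d * c.arr d.star else 0) +
              (if d.src = i then a.arr d * b.idem d.tgt * c.arr d.star else 0) := by
          intro d; split_ifs with h
          · rw [h]; ring
          · ring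
        have h2 : ∀ d : Arrow n, (if d.src = i then
            a.arr d * (b.idem d.tgt * c.arr d.star + b.arr d.star * c.idem d.src) else 0)
            = (if d.src = i then a.arr d * b.arr d.star else 0) * c.idem i +
              (if d.src = i then a.arr d * b.idem d.tgt * c.arr d.star else 0) := by
          intro d; split_ifs with h
          · rw [h]; ring
          · ring
        simp only [h1, h2, Finset.sum_add_distrib, ← Finset.mul_sum, ← Finset.sum_mul]
        ring }

instance : Algebra k (ZigzagAlgebra k n) :=
  Algebra.ofModule
    (by
      intro r a b
      ext i
      · simp [mul_assoc]
      · simp; ring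
      · simp only [mul_loop, smul_idem, smul_loop, smul_arr, mul_add, Finset.mul_sum, mul_ite,
          mul_zero, mul_assoc])
    (by
      intro r a b
      ext i
      · simp; ring
      · simp; ring
      · simp only [mul_loop, smul_idem, smul_loop, smul_arr, mul_add, Finset.mul_sum, mul_ite,
          mul_zero, mul_left_comm])

/-- The length zero path at `i`. -/
def e (i : Fin n) : ZigzagAlgebra k n := (Pi.single i 1, 0, 0)

/-- An arrow as an element of the algebra. -/
def ofArrow (c : Arrow n) : ZigzagAlgebra k n := (0, Pi.single c 1, 0)

/-- The loop at `i`. -/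
def z (i : Fin n) : ZigzagAlgebra k n := (0, 0, Pi.single i 1)

section
variable (i j : Fin n) (c d : Arrow n)
lemma e_idem : (e i : ZigzagAlgebra k n).idem j = if j = i then 1 else 0 := by
  simp [e, idem, Pi.single_apply]
@[simp] lemma e_arr : (e i : ZigzagAlgebra k n).arr c = 0 := rfl
@[simp] lemma e_loop : (e i : ZigzagAlgebra k n).loop j = 0 := rfl
@[simp] lemma ofArrow_idem : (ofArrow c : ZigzagAlgebra k n).idem j = 0 := rfl
lemma ofArrow_arr : (ofArrow c : ZigzagAlgebra k n).arr d = if d = c then 1 else 0 := by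
  simp [ofArrow, arr, Pi.single_apply]
@[simp] lemma ofArrow_loop : (ofArrow c : ZigzagAlgebra k n).loop j = 0 := rfl
@[simp] lemma z_idem : (z i : ZigzagAlgebra k n).idem j = 0 := rfl
@[simp] lemma z_arr : (z i : ZigzagAlgebra k n).arr c = 0 := rfl
lemma z_loop : (z i : ZigzagAlgebra k n).loop j = if j = i then 1 else 0 := by
  simp [z, loop, Pi.single_apply]

lemma e_mul_e : (e i * e j : ZigzagAlgebra k n) = if i = j then e i else 0 := by
  ext l
  · by_cases h : i = j <;> simp [e_idem, h]
    intro h1 h2; exact h (h2.symm.trans h1)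
  · by_cases h : i = j <;> simp [h]
  · by_cases h : i = j <;> simp [h]

lemma e_mul_ofArrow : (e i * ofArrow c : ZigzagAlgebra k n) = if c.src = i then ofArrow c else 0 := by
  ext l
  · by_cases h : c.src = i <;> simp [h]
  · by_cases h : c.src = i <;> by_cases h1 : l = c <;> simp [e_idem, ofArrow_arr, h, h1]
  · by_cases h : c.src = i <;> simp [h]

lemma ofArrow_mul_e : (ofArrow c * e i : ZigzagAlgebra k n) = if c.tgt = i then ofArrow c else 0 := by
  ext l
  · by_cases h : c.tgt = i <;> simp [h]
  · by_cases h : c.tgt = i <;> by_cases h1 : l = c <;> simp [e_idem, ofArrow_arr, h, h1]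
  · by_cases h : c.tgt = i <;> simp [h]

lemma e_mul_z : (e i * z j : ZigzagAlgebra k n) = if i = j then z i else 0 := by
  ext l
  · by_cases h : i = j <;> simp [h]
  · by_cases h : i = j <;> simp [h]
  · by_cases h : i = j <;> simp [e_idem, z_loop, h]
    intro h1 h2; exact h (h2.symm.trans h1)

lemma z_mul_e : (z i * e j : ZigzagAlgebra k n) = if i = j then z i else 0 := by
  ext l
  · by_cases h : i = j <;> simp [h]
  · by_cases h : i = j <;> simp [h]
  · by_cases h : i = j <;> simp [e_idem, z_loop, h]
    intro h1 h2; exact h (h2.symm.trans h1)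

lemma ofArrow_mul_ofArrow :
    (ofArrow c * ofArrow d : ZigzagAlgebra k n) = if d = c.star then z c.src else 0 := by
  ext l
  · by_cases h : d = c.star <;> simp [h]
  · by_cases h : d = c.star <;> simp [h]
  · simp only [mul_loop, ofArrow_idem, ofArrow_loop, ofArrow_arr]
    rw [Finset.sum_eq_single c]
    · by_cases h : d = c.star
      · simp [h, z_loop, eq_comm]
      · simp [h, Ne.symm h]
    · intro b _ hb; simp [hb]
    · simp

@[simp] lemma z_mul_ofArrow : (z i * ofArrow c : ZigzagAlgebra k n) = 0 := by ext l <;> simp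
@[simp] lemma ofArrow_mul_z : (ofArrow c * z i : ZigzagAlgebra k n) = 0 := by ext l <;> simp
@[simp] lemma z_mul_z : (z i * z j : ZigzagAlgebra k n) = 0 := by ext l <;> simp
end

lemma eq_sum (a : ZigzagAlgebra k n) : a = ∑ i, a.idem i • (e i : ZigzagAlgebra k n) +
    ∑ c, a.arr c • (ofArrow c : ZigzagAlgebra k n) + ∑ i, a.loop i • (z i : ZigzagAlgebra k n) := by
  have h1 : ∀ (ι : Type) (s : Finset ι) (f : ι → ZigzagAlgebra k n) (j : Fin n),
      (∑ i ∈ s, f i).idem j = ∑ i ∈ s, (f i).idem j := fun ι s f j => by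
    classical
    induction s using Finset.induction_on <;> simp_all
  have h2 : ∀ (ι : Type) (s : Finset ι) (f : ι → ZigzagAlgebra k n) (j : Arrow n),
      (∑ i ∈ s, f i).arr j = ∑ i ∈ s, (f i).arr j := fun ι s f j => by
    classical
    induction s using Finset.induction_on <;> simp_all
  have h3 : ∀ (ι : Type) (s : Finset ι) (f : ι → ZigzagAlgebra k n) (j : Fin n),
      (∑ i ∈ s, f i).loop j = ∑ i ∈ s, (f i).loop j := fun ι s f j => by
    classical
    induction s using Finset.induction_on <;> simp_all
  ext j
  · simp [h1, e_idem]
  · simp [h2, ofArrow_arr]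
  · simp [h3, z_loop]

lemma induction {p : ZigzagAlgebra k n → Prop} (h0 : p 0) (he : ∀ i, p (e i))
    (ha : ∀ c, p (ofArrow c)) (hz : ∀ i, p (z i)) (hadd : ∀ a b, p a → p b → p (a + b))
    (hsmul : ∀ (r : k) a, p a → p (r • a)) (a : ZigzagAlgebra k n) : p a := by
  rw [eq_sum a]
  have hs : ∀ {ι : Type} (s : Finset ι) (f : ι → ZigzagAlgebra k n), (∀ i, p (f i)) →
      p (∑ i ∈ s, f i) := fun s f hf => Finset.sum_induction f p hadd h0 (fun i _ => hf i)
  exact hadd _ _ (hadd _ _ (hs _ _ fun i => hsmul _ _ (he i)) (hs _ _ fun i => hsmul _ _ (ha i)))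
    (hs _ _ fun i => hsmul _ _ (hz i))

/-- The homogeneous part of degree `d` for the grading of the symmetric orientation:
idempotents have degree `0`, loops have degree `1`, and the arrow `c` has degree `c.deg`. -/
def homogeneous (k : Type u) [Field k] (n : ℕ) (d : ℤ) : Submodule k (ZigzagAlgebra k n) where
  carrier := {a | (d ≠ 0 → ∀ i, a.idem i = 0) ∧ (∀ c : Arrow n, c.deg ≠ d → a.arr c = 0) ∧
    (d ≠ 1 → ∀ i, a.loop i = 0)}
  zero_mem' := by simp
  add_mem' := by
    rintro a b ⟨h1, h2, h3⟩ ⟨h1', h2', h3'⟩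
    exact ⟨fun h i => by simp [h1 h i, h1' h i], fun c h => by simp [h2 c h, h2' c h],
      fun h i => by simp [h3 h i, h3' h i]⟩
  smul_mem' := by
    rintro r a ⟨h1, h2, h3⟩
    exact ⟨fun h i => by simp [h1 h i], fun c h => by simp [h2 c h], fun h i => by simp [h3 h i]⟩

lemma e_mem (i : Fin n) : (e i : ZigzagAlgebra k n) ∈ homogeneous k n 0 :=
  ⟨fun h => absurd rfl h, fun _ _ => rfl, fun _ _ => rfl⟩

lemma z_mem (i : Fin n) : (z i : ZigzagAlgebra k n) ∈ homogeneous k n 1 :=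
  ⟨fun _ _ => rfl, fun _ _ => rfl, fun h => absurd rfl h⟩

lemma ofArrow_mem (c : Arrow n) : (ofArrow c : ZigzagAlgebra k n) ∈ homogeneous k n c.deg :=
  ⟨fun _ _ => rfl, fun d h => by
    rw [ofArrow_arr, if_neg]; rintro rfl; exact h rfl, fun _ _ => rfl⟩

lemma mul_mem_homogeneous {p q : ℤ} {a b : ZigzagAlgebra k n} (ha : a ∈ homogeneous k n p)
    (hb : b ∈ homogeneous k n q) : a * b ∈ homogeneous k n (p + q) := by
  obtain ⟨h1, h2, h3⟩ := ha
  obtain ⟨h1', h2', h3'⟩ := hb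
  refine ⟨fun h i => ?_, fun c h => ?_, fun h i => ?_⟩
  · by_cases hp : p = 0
    · rw [mul_idem, h1' (by omega) i, mul_zero]
    · rw [mul_idem, h1 hp i, zero_mul]
  · have e1 : a.idem c.src * b.arr c = 0 := by
      by_cases hp : p = 0
      · rw [h2' c (by omega), mul_zero]
      · rw [h1 hp, zero_mul]
    have e2 : a.arr c * b.idem c.tgt = 0 := by
      by_cases hp : q = 0
      · rw [h2 c (by omega), zero_mul]
      · rw [h1' hp, mul_zero]
    rw [mul_arr, e1, e2, add_zero]
  · have e1 : a.idem i * b.loop i = 0 := by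
      by_cases hp : p = 0
      · rw [h3' (by omega), mul_zero]
      · rw [h1 hp, zero_mul]
    have e2 : a.loop i * b.idem i = 0 := by
      by_cases hp : q = 0
      · rw [h3 (by omega), zero_mul]
      · rw [h1' hp, mul_zero]
    rw [mul_loop, e1, e2, Finset.sum_eq_zero]
    · simp
    · intro c _
      have := c.deg_add_deg_star
      split_ifs
      · by_cases hp : c.deg = p
        · rw [h2' c.star (by omega), mul_zero]
        · rw [h2 c hp, zero_mul]
      · rfl

/-- The generators of the path algebra of the Ginzburg double. -/
inductive Gen (n : ℕ)
  | e (i : Fin n)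
  | arrow (c : Arrow n)
  | z (i : Fin n)

/-- The relations of the path algebra of the Ginzburg double (the first seven) together with the
zigzag relations (the last four): paths of length two with distinct ends vanish, and
for composable arrows `c`, `d` such that `c d` is a closed path, `c d` is the loop if `d = c*` and
zero otherwise. -/
inductive Rel (k : Type u) [Field k] (n : ℕ) : FreeAlgebra k (Gen n) → FreeAlgebra k (Gen n) → Prop
  | idem (i : Fin n) : Rel k n (FreeAlgebra.ι k (Gen.e i) * FreeAlgebra.ι k (Gen.e i)) (FreeAlgebra.ι k (Gen.e i))
  | orth (i j : Fin n) (h : i ≠ j) : Rel k n (FreeAlgebra.ι k (Gen.e i) * FreeAlgebra.ι k (Gen.e j)) 0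
  | one : Rel k n (∑ i, FreeAlgebra.ι k (Gen.e i)) 1
  | src (c : Arrow n) : Rel k n (FreeAlgebra.ι k (Gen.e c.src) * FreeAlgebra.ι k (Gen.arrow c)) (FreeAlgebra.ι k (Gen.arrow c))
  | tgt (c : Arrow n) : Rel k n (FreeAlgebra.ι k (Gen.arrow c) * FreeAlgebra.ι k (Gen.e c.tgt)) (FreeAlgebra.ι k (Gen.arrow c))
  | loop_src (i : Fin n) : Rel k n (FreeAlgebra.ι k (Gen.e i) * FreeAlgebra.ι k (Gen.z i)) (FreeAlgebra.ι k (Gen.z i))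
  | loop_tgt (i : Fin n) : Rel k n (FreeAlgebra.ι k (Gen.z i) * FreeAlgebra.ι k (Gen.e i)) (FreeAlgebra.ι k (Gen.z i))
  | distinct (c d : Arrow n) (h : c.tgt = d.src) (h' : c.src ≠ d.tgt) :
      Rel k n (FreeAlgebra.ι k (Gen.arrow c) * FreeAlgebra.ι k (Gen.arrow d)) 0
  | loop_arrow (c : Arrow n) : Rel k n (FreeAlgebra.ι k (Gen.z c.src) * FreeAlgebra.ι k (Gen.arrow c)) 0
  | arrow_loop (c : Arrow n) : Rel k n (FreeAlgebra.ι k (Gen.arrow c) * FreeAlgebra.ι k (Gen.z c.tgt)) 0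
  | closed (c d : Arrow n) (h : c.tgt = d.src) (h' : c.src = d.tgt) :
      Rel k n (FreeAlgebra.ι k (Gen.arrow c) * FreeAlgebra.ι k (Gen.arrow d))
        (if d = c.star then FreeAlgebra.ι k (Gen.z c.src) else 0)

/-- The value of a generator. -/
def ofGen : Gen n → ZigzagAlgebra k n
  | Gen.e i => e i
  | Gen.arrow c => ofArrow c
  | Gen.z i => z i

/-- The map from the path algebra modulo the zigzag relations to `ZigzagAlgebra k n`. -/
def fromPresentation (k : Type u) [Field k] (n : ℕ) : RingQuot (Rel k n) →ₐ[k] ZigzagAlgebra k n :=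
  RingQuot.liftAlgHom k ⟨FreeAlgebra.lift k ofGen, by
    intro a b h
    induction h with
    | idem i => simp [ofGen, e_mul_e]
    | orth i j h => simp [ofGen, e_mul_e, h]
    | one =>
      simp only [map_sum, FreeAlgebra.lift_ι_apply, ofGen, map_one]
      rw [eq_sum (1 : ZigzagAlgebra k n)]; simp
    | src c => simp [ofGen, e_mul_ofArrow]
    | tgt c => simp [ofGen, ofArrow_mul_e]
    | loop_src i => simp [ofGen, e_mul_z]
    | loop_tgt i => simp [ofGen, z_mul_e]
    | distinct c d h h' =>
      have : d ≠ c.star := by rintro rfl; exact h' rfl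
      simp [ofGen, ofArrow_mul_ofArrow, this]
    | loop_arrow c => simp [ofGen]
    | arrow_loop c => simp [ofGen]
    | closed c d h h' => by_cases hd : d = c.star <;> simp [ofGen, ofArrow_mul_ofArrow, hd]⟩

@[simp] lemma fromPresentation_gen (g : Gen n) :
    fromPresentation k n (RingQuot.mkAlgHom k (Rel k n) (FreeAlgebra.ι k g)) = ofGen g := by
  simp [fromPresentation]

/-- For `n ≥ 2`, `ZigzagAlgebra k n` is the path algebra of the Ginzburg double modulo the zigzag
relations. -/
theorem fromPresentation_bijective (hn : 2 ≤ n) : Function.Bijective (fromPresentation k n) := by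
  let m : FreeAlgebra k (Gen n) →ₐ[k] RingQuot (Rel k n) := RingQuot.mkAlgHom k (Rel k n)
  let E : Fin n → RingQuot (Rel k n) := fun i => m (FreeAlgebra.ι k (Gen.e i))
  let C : Arrow n → RingQuot (Rel k n) := fun i => m (FreeAlgebra.ι k (Gen.arrow i))
  let Z : Fin n → RingQuot (Rel k n) := fun i => m (FreeAlgebra.ι k (Gen.z i))
  have rel : ∀ {a b}, Rel k n a b → m a = m b := fun h => RingQuot.mkAlgHom_rel k h
  have hEE : ∀ i j, E i * E j = if i = j then E i else 0 := by
    intro i j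
    split_ifs with h
    · subst h; simpa [E] using rel (Rel.idem i)
    · simpa [E] using rel (Rel.orth i j h)
  have hEC : ∀ i c, E i * C c = if c.src = i then C c else 0 := by
    intro i c
    have h1 : E c.src * C c = C c := by simpa [E, C] using rel (Rel.src c)
    split_ifs with h
    · rw [← h, h1]
    · rw [← h1, ← mul_assoc, hEE, if_neg (Ne.symm h), zero_mul]
  have hCE : ∀ i c, C c * E i = if c.tgt = i then C c else 0 := by
    intro i c
    have h1 : C c * E c.tgt = C c := by simpa [E, C] using rel (Rel.tgt c)
    split_ifs with h
    · rw [← h, h1]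
    · rw [← h1, mul_assoc, hEE, if_neg h, mul_zero]
  have hEZ : ∀ i j, E i * Z j = if i = j then Z j else 0 := by
    intro i j
    have h1 : E j * Z j = Z j := by simpa [E, Z] using rel (Rel.loop_src j)
    split_ifs with h
    · rw [h, h1]
    · rw [← h1, ← mul_assoc, hEE, if_neg h, zero_mul]
  have hZE : ∀ i j, Z i * E j = if i = j then Z i else 0 := by
    intro i j
    have h1 : Z i * E i = Z i := by simpa [E, Z] using rel (Rel.loop_tgt i)
    split_ifs with h
    · rw [← h, h1]
    · rw [← h1, mul_assoc, hEE, if_neg h, mul_zero]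
  have hCC : ∀ c d, C c * C d = if d = c.star then Z c.src else 0 := by
    intro c d
    by_cases h : c.tgt = d.src
    · by_cases h' : c.src = d.tgt
      · have := rel (Rel.closed c d h h')
        split_ifs at this ⊢ <;> simpa [C, Z] using this
      · have : d ≠ c.star := by rintro rfl; exact h' rfl
        rw [if_neg this]
        simpa [C] using rel (Rel.distinct c d h h')
    · have : d ≠ c.star := by rintro rfl; exact h rfl
      have h1 : C c * E c.tgt = C c := by rw [hCE, if_pos rfl]
      rw [if_neg this, ← h1, mul_assoc, hEC, if_neg (Ne.symm h), mul_zero]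
  have hZC : ∀ i c, Z i * C c = 0 := by
    intro i c
    by_cases h : c.src = i
    · subst h; simpa [C, Z] using rel (Rel.loop_arrow c)
    · have h1 : Z i * E i = Z i := by rw [hZE, if_pos rfl]
      rw [← h1, mul_assoc, hEC, if_neg h, mul_zero]
  have hCZ : ∀ i c, C c * Z i = 0 := by
    intro i c
    by_cases h : c.tgt = i
    · subst h; simpa [C, Z] using rel (Rel.arrow_loop c)
    · have h1 : C c * E c.tgt = C c := by rw [hCE, if_pos rfl]
      rw [← h1, mul_assoc, hEZ, if_neg h, mul_zero]
  have hZZ : ∀ i j, Z i * Z j = 0 := by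
    intro i j
    have : Nontrivial (Fin n) := Fin.nontrivial_iff_two_le.mpr hn
    obtain ⟨l, hl⟩ := exists_ne i
    let c : Arrow n := (Label.x, ⟨(i, l), Ne.symm hl⟩)
    have : Z i = C c * C c.star := by rw [hCC, if_pos rfl]; rfl
    rw [this, mul_assoc, hCZ, mul_zero]
  let W : Submodule k (RingQuot (Rel k n)) :=
    Submodule.span k (Set.range E ∪ Set.range C ∪ Set.range Z)
  have hE : ∀ i, E i ∈ W := fun i => Submodule.subset_span (Or.inl (Or.inl ⟨i, rfl⟩))
  have hC : ∀ i, C i ∈ W := fun i => Submodule.subset_span (Or.inl (Or.inr ⟨i, rfl⟩))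
  have hZ : ∀ i, Z i ∈ W := fun i => Submodule.subset_span (Or.inr ⟨i, rfl⟩)
  have hgen : ∀ (g : Gen n) (w : RingQuot (Rel k n)), w ∈ W →
      m (FreeAlgebra.ι k g) * w ∈ W := by
    intro g w hw
    induction hw using Submodule.span_induction with
    | zero => rw [mul_zero]; exact W.zero_mem
    | add a b _ _ ha hb => rw [mul_add]; exact W.add_mem ha hb
    | smul r a _ ha => rw [mul_smul_comm]; exact W.smul_mem r ha
    | mem w hw =>
      rcases hw with (⟨j, rfl⟩ | ⟨j, rfl⟩) | ⟨j, rfl⟩ <;> cases g with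
      | e i =>
        change E i * _ ∈ W
        first | rw [hEE] | rw [hEC] | rw [hEZ]
        split_ifs <;> first | exact hE _ | exact hC _ | exact hZ _ | exact W.zero_mem
      | arrow c =>
        change C c * _ ∈ W
        first | (rw [hCE]; split_ifs) | (rw [hCC]; split_ifs) | rw [hCZ]
        all_goals first | exact hE _ | exact hC _ | exact hZ _ | exact W.zero_mem
      | z i =>
        change Z i * _ ∈ W
        first | (rw [hZE]; split_ifs) | rw [hZC] | rw [hZZ]
        all_goals first | exact hE _ | exact hC _ | exact hZ _ | exact W.zero_mem
  have hone : (1 : RingQuot (Rel k n)) ∈ W := by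
    have : (1 : RingQuot (Rel k n)) = ∑ i, E i := by
      have := rel (Rel.one (k := k) (n := n))
      rw [map_one, map_sum] at this
      exact this.symm
    rw [this]; exact W.sum_mem fun i _ => hE i
  have hW : ∀ (a : FreeAlgebra k (Gen n)) (w : RingQuot (Rel k n)), w ∈ W → m a * w ∈ W := by
    intro a
    induction a using FreeAlgebra.induction with
    | grade0 r =>
      intro w hw
      rw [AlgHom.commutes, ← Algebra.smul_def]; exact W.smul_mem r hw
    | grade1 g => exact hgen g
    | mul a b ha hb => intro w hw; rw [map_mul, mul_assoc]; exact ha _ (hb _ hw)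
    | add a b ha hb => intro w hw; rw [map_add, add_mul]; exact W.add_mem (ha _ hw) (hb _ hw)
  have htop : ∀ q : RingQuot (Rel k n), q ∈ W := by
    intro q
    obtain ⟨a, rfl⟩ := RingQuot.mkAlgHom_surjective k (Rel k n) q
    have := hW a 1 hone
    rwa [mul_one] at this
  let ψ : ZigzagAlgebra k n → RingQuot (Rel k n) := fun a =>
    ∑ i, a.idem i • E i + ∑ c, a.arr c • C c + ∑ i, a.loop i • Z i
  have hψ : ∀ q, ψ (fromPresentation k n q) = q := by
    intro q
    have hq := htop q
    have hadd : ∀ a b, ψ (a + b) = ψ a + ψ b := by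
      intro a b
      simp only [ψ, add_idem, add_arr, add_loop, add_smul, Finset.sum_add_distrib]
      abel
    have hsmul : ∀ (r : k) a, ψ (r • a) = r • ψ a := by
      intro r a
      simp only [ψ, smul_idem, smul_arr, smul_loop, mul_smul, ← Finset.smul_sum, smul_add]
    induction hq using Submodule.span_induction with
    | zero => rw [map_zero]; simp [ψ]
    | add a b _ _ ha hb => rw [map_add, hadd, ha, hb]
    | smul r a _ ha => rw [map_smul, hsmul, ha]
    | mem w hw =>
      rcases hw with (⟨j, rfl⟩ | ⟨j, rfl⟩) | ⟨j, rfl⟩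
      · simp [E, m, ψ, ofGen, e_idem]
      · simp [C, m, ψ, ofGen, ofArrow_arr]
      · simp [Z, m, ψ, ofGen, z_loop]
  refine ⟨Function.LeftInverse.injective hψ, fun a => ⟨ψ a, ?_⟩⟩
  simp only [ψ, map_add, map_sum, map_smul, E, C, Z, m, fromPresentation_gen, ofGen]
  exact (eq_sum a).symm

end ZigzagAlgebra
section Modules

variable {k : Type u} [Field k] {n : ℕ}

section Internal

variable {V : Type*} [AddCommGroup V] [Module k V]

/-- A criterion for a family of subspaces to form an internal direct sum decomposition. -/
lemma isInternal_of_proj (Z : ℤ → Submodule k V) (π : ℤ → V →ₗ[k] V)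
    (h1 : ∀ d, ∀ v ∈ Z d, π d v = v) (h2 : ∀ d e, d ≠ e → ∀ v ∈ Z e, π d v = 0)
    (h3 : ∀ v, v ∈ ⨆ d, Z d) : DirectSum.IsInternal Z := by
  rw [DirectSum.isInternal_submodule_iff_iSupIndep_and_iSup_eq_top]
  refine ⟨fun d => ?_, eq_top_iff.mpr fun v _ => h3 v⟩
  rw [Submodule.disjoint_def]
  intro v hv hv'
  have : (⨆ e, ⨆ (_ : e ≠ d), Z e) ≤ LinearMap.ker (π d) :=
    iSup_le fun e => iSup_le fun he w hw => h2 d e (Ne.symm he) w hw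
  rw [← h1 d v hv]
  exact this hv'

/-- The projections onto the pieces of an internal direct sum decomposition. -/
lemma exists_proj (Z : ℤ → Submodule k V) (h : DirectSum.IsInternal Z) :
    ∃ π : ℤ → V →ₗ[k] V, (∀ d v, π d v ∈ Z d) ∧ (∀ d, ∀ v ∈ Z d, π d v = v) ∧
      (∀ d e, d ≠ e → ∀ v ∈ Z e, π d v = 0) ∧
      (∀ v, ∃ s : Finset ℤ, v = ∑ d ∈ s, π d v) := by
  classical
  let _ := h.chooseDecomposition
  refine ⟨fun d => (Z d).subtype ∘ₗ DirectSum.component k ℤ (fun i => Z i) d ∘ₗ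
    (DirectSum.decomposeLinearEquiv Z).toLinearMap, fun d v => ?_, fun d v hv => ?_,
    fun d e hde v hv => ?_, fun v => ⟨(DirectSum.decompose Z v).support, ?_⟩⟩
  · exact Subtype.prop _
  · exact DirectSum.decompose_of_mem_same Z hv
  · exact DirectSum.decompose_of_mem_ne Z hv (Ne.symm hde)
  · exact (DirectSum.sum_support_decompose Z v).symm

end Internal

/-- A finitely generated projective graded left module over the zigzag algebra, which is graded by
the symmetric orientation: a left module with a decomposition `⨁_{d ∈ ℤ} deg d` into vector spaces,
compatible with the grading of the algebra. -/
structure GrProj (k : Type u) [Field k] (n : ℕ) where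
  carrier : Type u
  [addCommGroup : AddCommGroup carrier]
  [moduleField : Module k carrier]
  [module : Module (ZigzagAlgebra k n) carrier]
  [tower : IsScalarTower k (ZigzagAlgebra k n) carrier]
  deg : ℤ → Submodule k carrier
  isInternal : DirectSum.IsInternal deg
  smul_mem : ∀ {i j : ℤ} {a : ZigzagAlgebra k n} {m : carrier},
    a ∈ ZigzagAlgebra.homogeneous k n i → m ∈ deg j → a • m ∈ deg (i + j)
  finite : Module.Finite (ZigzagAlgebra k n) carrier
  projective : Module.Projective (ZigzagAlgebra k n) carrier

namespace GrProj

attribute [instance] addCommGroup moduleField module tower finite projective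

instance : CoeSort (GrProj k n) (Type u) := ⟨carrier⟩

instance (M : GrProj k n) : Module.Finite k M := Module.Finite.trans (ZigzagAlgebra k n) M

/-- Morphisms are the module homomorphisms that preserve degrees. -/
def homs (M N : GrProj k n) : AddSubgroup (M →ₗ[ZigzagAlgebra k n] N) where
  carrier := {f | ∀ d, ∀ m ∈ M.deg d, f m ∈ N.deg d}
  zero_mem' := fun d _ _ => (N.deg d).zero_mem
  add_mem' := fun hf hg d m hm => (N.deg d).add_mem (hf d m hm) (hg d m hm)
  neg_mem' := fun hf d m hm => (N.deg d).neg_mem (hf d m hm)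

instance : Category (GrProj k n) where
  Hom M N := homs M N
  id M := ⟨LinearMap.id, fun _ _ hm => hm⟩
  comp f g := ⟨g.1.comp f.1, fun d m hm => g.2 d _ (f.2 d m hm)⟩

/-- The underlying linear map of a morphism. -/
def Hom.lin {M N : GrProj k n} (f : M ⟶ N) : M →ₗ[ZigzagAlgebra k n] N := f.1

/-- A morphism from a degree preserving linear map. -/
def ofLin {M N : GrProj k n} (f : M →ₗ[ZigzagAlgebra k n] N)
    (hf : ∀ d, ∀ m ∈ M.deg d, f m ∈ N.deg d) : M ⟶ N := ⟨f, hf⟩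

lemma Hom.lin_mem {M N : GrProj k n} (f : M ⟶ N) {d : ℤ} {m : M} (hm : m ∈ M.deg d) :
    Hom.lin f m ∈ N.deg d := f.2 d m hm

@[ext] lemma hom_ext {M N : GrProj k n} {f g : M ⟶ N} (h : ∀ m, Hom.lin f m = Hom.lin g m) :
    f = g := Subtype.ext (LinearMap.ext h)

@[simp] lemma lin_ofLin {M N : GrProj k n} (f : M →ₗ[ZigzagAlgebra k n] N)
    (hf : ∀ d, ∀ m ∈ M.deg d, f m ∈ N.deg d) : Hom.lin (ofLin f hf) = f := rfl
@[simp] lemma lin_id (M : GrProj k n) : Hom.lin (𝟙 M) = LinearMap.id := rfl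
@[simp] lemma lin_comp {M N L : GrProj k n} (f : M ⟶ N) (g : N ⟶ L) :
    Hom.lin (f ≫ g) = (Hom.lin g).comp (Hom.lin f) := rfl

instance (M N : GrProj k n) : AddCommGroup (M ⟶ N) :=
  inferInstanceAs (AddCommGroup (homs M N))

@[simp] lemma lin_add {M N : GrProj k n} (f g : M ⟶ N) :
    Hom.lin (f + g) = Hom.lin f + Hom.lin g := rfl
@[simp] lemma lin_zero {M N : GrProj k n} : Hom.lin (0 : M ⟶ N) = 0 := rfl

instance : Preadditive (GrProj k n) where
  add_comp := by intros; ext; simp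
  comp_add := by intros; ext; simp

/-- The zero module. -/
def zero (k : Type u) [Field k] (n : ℕ) : GrProj k n where
  carrier := PUnit
  deg := fun _ => ⊥
  isInternal := isInternal_of_proj _ 0 (fun _ _ _ => Subsingleton.elim _ _)
    (fun _ _ _ _ _ => Subsingleton.elim _ _) (fun v => by
      rw [Subsingleton.elim v 0]; exact Submodule.zero_mem _)
  smul_mem := fun _ _ => Subsingleton.elim _ _
  finite := inferInstance
  projective := inferInstance

lemma isZero_zero : IsZero (zero k n) := by
  rw [IsZero.iff_id_eq_zero]
  ext m
  exact Subsingleton.elim (α := PUnit) _ _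

instance : HasZeroObject (GrProj k n) := ⟨⟨_, isZero_zero⟩⟩

/-- The direct sum of two graded modules. -/
def prod (M N : GrProj k n) : GrProj k n where
  carrier := M × N
  deg := fun d => (M.deg d).prod (N.deg d)
  isInternal := by
    obtain ⟨π, h0, h1, h2, h3⟩ := exists_proj _ M.isInternal
    obtain ⟨ρ, g0, g1, g2, g3⟩ := exists_proj _ N.isInternal
    refine isInternal_of_proj _ (fun d => (π d).prodMap (ρ d)) ?_ ?_ ?_
    · rintro d ⟨v, w⟩ ⟨hv, hw⟩
      exact Prod.ext (h1 d v hv) (g1 d w hw)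
    · rintro d e hde ⟨v, w⟩ ⟨hv, hw⟩
      exact Prod.ext (h2 d e hde v hv) (g2 d e hde w hw)
    · rintro ⟨v, w⟩
      have e1 : (v, w) = (v, 0) + (0, w) := by simp
      obtain ⟨s, hs⟩ := h3 v
      obtain ⟨t, ht⟩ := g3 w
      have e2 : ((v, 0) : M × N) = ∑ d ∈ s, (π d v, 0) := by
        rw [← LinearMap.inl_apply (R := k), hs, map_sum]
        simp only [LinearMap.inl_apply, ← hs]
      have e3 : ((0, w) : M × N) = ∑ d ∈ t, (0, ρ d w) := by
        rw [← LinearMap.inr_apply (R := k), ht, map_sum]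
        simp only [LinearMap.inr_apply, ← ht]
      rw [e1, e2, e3]
      refine Submodule.add_mem _ (Submodule.sum_mem _ fun d _ => ?_)
        (Submodule.sum_mem _ fun d _ => ?_)
      · exact Submodule.mem_iSup_of_mem d ⟨h0 d v, Submodule.zero_mem _⟩
      · exact Submodule.mem_iSup_of_mem d ⟨Submodule.zero_mem _, g0 d w⟩
  smul_mem := fun ha hm => ⟨M.smul_mem ha hm.1, N.smul_mem ha hm.2⟩
  finite := inferInstance
  projective := inferInstance

/-- The direct sum is a biproduct. -/
def bicone (M N : GrProj k n) : BinaryBicone M N where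
  pt := prod M N
  fst := ofLin (LinearMap.fst _ M N) fun _ _ hm => hm.1
  snd := ofLin (LinearMap.snd _ M N) fun _ _ hm => hm.2
  inl := ofLin (LinearMap.inl _ M N) fun _ _ hm => ⟨hm, Submodule.zero_mem _⟩
  inr := ofLin (LinearMap.inr _ M N) fun _ _ hm => ⟨Submodule.zero_mem _, hm⟩
  inl_fst := rfl
  inl_snd := rfl
  inr_fst := rfl
  inr_snd := rfl

instance : HasBinaryBiproducts (GrProj k n) where
  has_binary_biproduct M N := ⟨⟨⟨bicone M N, isBinaryBilimitOfTotal _ (by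
    ext m
    exact Prod.ext (add_zero _) (zero_add _))⟩⟩⟩

instance : HasFiniteBiproducts (GrProj k n) :=
  have : HasFiniteProducts (GrProj k n) := hasFiniteProducts_of_has_binary_and_terminal
  HasFiniteBiproducts.of_hasFiniteProducts

/-- The grading shift `M⟨l⟩`, with `M⟨l⟩_d = M_{d + l}`. -/
def shift (M : GrProj k n) (l : ℤ) : GrProj k n where
  carrier := M
  deg := fun d => M.deg (d + l)
  isInternal := by
    obtain ⟨π, h0, h1, h2, h3⟩ := exists_proj _ M.isInternal
    refine isInternal_of_proj _ (fun d => π (d + l)) (fun d => h1 _)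
      (fun d e hde => h2 _ _ (by omega)) fun v => ?_
    obtain ⟨s, hs⟩ := h3 v
    rw [hs]
    refine Submodule.sum_mem _ fun d _ => Submodule.mem_iSup_of_mem (d - l) ?_
    rw [sub_add_cancel]
    exact h0 d v
  smul_mem := fun ha hm => by rw [add_assoc]; exact M.smul_mem ha hm
  finite := M.finite
  projective := M.projective

/-- The grading shift as a functor. -/
def shiftFunctor (k : Type u) [Field k] (n : ℕ) (l : ℤ) : GrProj k n ⥤ GrProj k n where
  obj M := M.shift l
  map f := ofLin (M := shift _ l) (N := shift _ l) f.1 fun _ _ hm => f.2 _ _ hm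

instance (l : ℤ) : (shiftFunctor k n l).Additive where
  map_add := rfl

end GrProj

namespace ZigzagAlgebra

/-- The left ideal `A eᵢ`. -/
def leftIdeal (k : Type u) [Field k] {n : ℕ} (i : Fin n) :
    Submodule (ZigzagAlgebra k n) (ZigzagAlgebra k n) where
  carrier := {a | a * e i = a}
  zero_mem' := zero_mul _
  add_mem' := fun {a b} ha hb => by
    change (a + b) * e i = a + b
    rw [add_mul, show a * e i = a from ha, show b * e i = b from hb]
  smul_mem' := fun c a ha => by
    change (c * a) * e i = c * a
    rw [mul_assoc, show a * e i = a from ha]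

/-- The element `a eᵢ` of the left ideal `A eᵢ`. -/
def toLeftIdeal (i : Fin n) : ZigzagAlgebra k n →ₗ[ZigzagAlgebra k n] leftIdeal k i where
  toFun a := ⟨a * e i, by change a * e i * e i = a * e i; rw [mul_assoc, e_mul_e, if_pos rfl]⟩
  map_add' a b := Subtype.ext (add_mul _ _ _)
  map_smul' a b := Subtype.ext (mul_assoc _ _ _)

lemma toLeftIdeal_coe (i : Fin n) (a : leftIdeal k i) : toLeftIdeal i (a : ZigzagAlgebra k n) = a :=
  Subtype.ext a.2

lemma exists_proj (k : Type u) [Field k] (n : ℕ) : ∃ π : ℤ → ZigzagAlgebra k n →ₗ[k] ZigzagAlgebra k n,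
    (∀ d a, π d a ∈ homogeneous k n d) ∧ (∀ d, ∀ a ∈ homogeneous k n d, π d a = a) ∧
    (∀ d d', d ≠ d' → ∀ a ∈ homogeneous k n d', π d a = 0) ∧ (∀ a, a = π 0 a + π 1 a) ∧
    (∀ d a i, π d (a * e i) = π d a * e i) ∧ (∀ d a, d ≠ 0 → d ≠ 1 → π d a = 0) := by
  let π : ℤ → ZigzagAlgebra k n → ZigzagAlgebra k n := fun d a =>
    (fun i => if d = 0 then a.idem i else 0, fun c => if c.deg = d then a.arr c else 0,
      fun i => if d = 1 then a.loop i else 0)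
  have e1 : ∀ d a i, (π d a).idem i = if d = 0 then a.idem i else 0 := fun _ _ _ => rfl
  have e2 : ∀ d a c, (π d a).arr c = if c.deg = d then a.arr c else 0 := fun _ _ _ => rfl
  have e3 : ∀ d a i, (π d a).loop i = if d = 1 then a.loop i else 0 := fun _ _ _ => rfl
  refine ⟨fun d => ⟨⟨π d, fun a b => ?_⟩, fun r a => ?_⟩, fun d a => ?_, fun d a ha => ?_,
    fun d d' h a ha => ?_, fun a => ?_, fun d a i => ?_, fun d a h h' => ?_⟩
  · ext i
    · simp only [e1, add_idem]; split_ifs <;> simp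
    · simp only [e2, add_arr]; split_ifs <;> simp
    · simp only [e3, add_loop]; split_ifs <;> simp
  · ext i
    · simp [e1]
    · simp [e2]
    · simp [e3]
  · exact ⟨fun h i => by simp [e1, h], fun c h => by simp [e2, h], fun h i => by simp [e3, h]⟩
  · change π d a = a
    obtain ⟨h1, h2, h3⟩ := ha
    ext i
    · rw [e1]; split_ifs with h
      · rfl
      · exact (h1 h i).symm
    · rw [e2]; split_ifs with h
      · rfl
      · exact (h2 i h).symm
    · rw [e3]; split_ifs with h
      · rfl
      · exact (h3 h i).symm
  · change π d a = 0
    obtain ⟨h1, h2, h3⟩ := ha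
    ext i
    · rw [e1]; split_ifs with h'
      · exact h1 (by omega) i
      · rfl
    · rw [e2]; split_ifs with h'
      · exact h2 i (by omega)
      · rfl
    · rw [e3]; split_ifs with h'
      · exact h3 (by omega) i
      · rfl
  · change a = π 0 a + π 1 a
    ext i
    · simp [e1]
    · rw [add_arr, e2, e2]; rcases i.deg_eq with h | h <;> simp [h]
    · simp [e3]
  · change π d (a * e i) = π d a * e i
    ext j
    · simp [e1]
    · simp [e2]
    · simp [e3]
  · change π d a = 0
    ext j
    · simp [e1, h]
    · rw [e2, if_neg]
      · rfl
      · rcases j.deg_eq with h1 | h1 <;> omega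
    · simp [e3, h']

end ZigzagAlgebra

namespace GrProj
open ZigzagAlgebra

/-- The indecomposable graded projective `Pᵢ = A eᵢ`, with `eᵢ` in degree `0`. -/
def P (k : Type u) [Field k] {n : ℕ} (i : Fin n) : GrProj k n where
  carrier := leftIdeal k i
  deg := fun d => (homogeneous k n d).comap ((leftIdeal k i).subtype.restrictScalars k)
  isInternal := by
    obtain ⟨π, h0, h1, h2, h3, h4, h5⟩ := ZigzagAlgebra.exists_proj k n
    have key : ∀ d (a : leftIdeal k i), π d (a : ZigzagAlgebra k n) ∈ leftIdeal k i := fun d a => by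
      change _ * _ = _
      rw [← h4]; congr 1; exact a.2
    refine isInternal_of_proj _ (fun d => ⟨⟨fun a => ⟨π d (a : ZigzagAlgebra k n), key d a⟩,
      fun a b => Subtype.ext (map_add (π d) _ _)⟩, fun r a => Subtype.ext (map_smul (π d) _ _)⟩)
      (fun d a ha => Subtype.ext (h1 d _ ha)) (fun d d' h a ha => Subtype.ext (h2 d d' h _ ha))
      fun a => ?_
    have : a = ⟨π 0 (a : ZigzagAlgebra k n), key 0 a⟩ + ⟨π 1 (a : ZigzagAlgebra k n), key 1 a⟩ :=
      Subtype.ext (h3 _)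
    rw [this]
    exact Submodule.add_mem _ (Submodule.mem_iSup_of_mem 0 (h0 _ _))
      (Submodule.mem_iSup_of_mem 1 (h0 _ _))
  smul_mem := fun ha hm => mul_mem_homogeneous ha hm
  finite := Module.Finite.of_surjective (toLeftIdeal i) fun a => ⟨a, toLeftIdeal_coe i a⟩
  projective := Module.Projective.of_split (leftIdeal k i).subtype (toLeftIdeal i)
    (LinearMap.ext fun a => toLeftIdeal_coe i a)

/-- The subspace `eᵢ M`. -/
def idemPart (i : Fin n) (M : GrProj k n) : Submodule k M where
  carrier := {m | (e i : ZigzagAlgebra k n) • m = m}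
  zero_mem' := smul_zero _
  add_mem' := fun {a b} ha hb => by
    change (e i : ZigzagAlgebra k n) • (a + b) = a + b
    rw [smul_add, show (e i : ZigzagAlgebra k n) • a = a from ha,
      show (e i : ZigzagAlgebra k n) • b = b from hb]
  smul_mem' := fun c a ha => by
    change (e i : ZigzagAlgebra k n) • (c • a) = c • a
    rw [smul_comm, show (e i : ZigzagAlgebra k n) • a = a from ha]

/-- The element `eᵢ m` of `eᵢ M`. -/
def toIdemPart (i : Fin n) (M : GrProj k n) : M →ₗ[k] idemPart i M where
  toFun m := ⟨(e i : ZigzagAlgebra k n) • m, by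
    change (e i : ZigzagAlgebra k n) • (e i : ZigzagAlgebra k n) • m = _
    rw [smul_smul, e_mul_e, if_pos rfl]⟩
  map_add' a b := Subtype.ext (smul_add _ _ _)
  map_smul' r b := Subtype.ext (smul_comm _ _ _)

lemma toIdemPart_coe (i : Fin n) (M : GrProj k n) (m : idemPart i M) :
    toIdemPart i M (m : M) = m := Subtype.ext m.2

/-- The degree `d` part of `A eᵢ ⊗ eᵢ M`. -/
def tensorDeg (i : Fin n) (M : GrProj k n) (d : ℤ) :
    Submodule k (leftIdeal k i ⊗[k] idemPart i M) :=
  Submodule.span k {t | ∃ (p q : ℤ) (a : leftIdeal k i) (m : idemPart i M), p + q = d ∧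
    (a : ZigzagAlgebra k n) ∈ homogeneous k n p ∧ (m : M) ∈ M.deg q ∧ t = a ⊗ₜ m}

lemma tmul_mem_tensorDeg {i : Fin n} {M : GrProj k n} {p q d : ℤ} {a : leftIdeal k i}
    {m : idemPart i M} (hd : p + q = d) (ha : (a : ZigzagAlgebra k n) ∈ homogeneous k n p)
    (hm : (m : M) ∈ M.deg q) : a ⊗ₜ m ∈ tensorDeg i M d :=
  Submodule.subset_span ⟨p, q, a, m, hd, ha, hm, rfl⟩

lemma toIdemPart_mem {i : Fin n} {M : GrProj k n} {q : ℤ} {m : M} (hm : m ∈ M.deg q) :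
    ((toIdemPart i M m : idemPart i M) : M) ∈ M.deg q := by
  have := M.smul_mem (e_mem (k := k) i) hm
  rwa [zero_add] at this

lemma toLeftIdeal_mem {i : Fin n} {p : ℤ} {a : ZigzagAlgebra k n} (ha : a ∈ homogeneous k n p) :
    ((toLeftIdeal i a : leftIdeal k i) : ZigzagAlgebra k n) ∈ homogeneous k n p := by
  have := mul_mem_homogeneous ha (e_mem (k := k) i)
  rwa [add_zero] at this

lemma isInternal_tensorDeg (i : Fin n) (M : GrProj k n) :
    DirectSum.IsInternal (tensorDeg i M) := by
  obtain ⟨π, h0, h1, h2, h3, h4, h5⟩ := ZigzagAlgebra.exists_proj k n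
  obtain ⟨ρ, g0, g1, g2, g3⟩ := Zigzag.exists_proj _ M.isInternal
  let π' : ℤ → leftIdeal k i →ₗ[k] leftIdeal k i := fun d =>
    (toLeftIdeal i).restrictScalars k ∘ₗ π d ∘ₗ (leftIdeal k i).subtype.restrictScalars k
  let ρ' : ℤ → idemPart i M →ₗ[k] idemPart i M := fun d =>
    toIdemPart i M ∘ₗ ρ d ∘ₗ (idemPart i M).subtype
  have a1 : ∀ d (a : leftIdeal k i), (a : ZigzagAlgebra k n) ∈ homogeneous k n d → π' d a = a := by
    intro d a ha
    change toLeftIdeal i (π d a) = a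
    rw [h1 d _ ha, toLeftIdeal_coe]
  have a2 : ∀ d d' (a : leftIdeal k i), d ≠ d' → (a : ZigzagAlgebra k n) ∈ homogeneous k n d' →
      π' d a = 0 := by
    intro d d' a h ha
    change toLeftIdeal i (π d a) = 0
    rw [h2 d d' h _ ha, map_zero]
  have b1 : ∀ d (m : idemPart i M), (m : M) ∈ M.deg d → ρ' d m = m := by
    intro d a ha
    change toIdemPart i M (ρ d a) = a
    rw [g1 d _ ha, toIdemPart_coe]
  have b2 : ∀ d d' (m : idemPart i M), d ≠ d' → (m : M) ∈ M.deg d' → ρ' d m = 0 := by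
    intro d d' a h ha
    change toIdemPart i M (ρ d a) = 0
    rw [g2 d d' h _ ha, map_zero]
  refine isInternal_of_proj _ (fun d => TensorProduct.map (π' 0) (ρ' d) +
    TensorProduct.map (π' 1) (ρ' (d - 1))) ?_ ?_ ?_
  · intro d v hv
    induction hv using Submodule.span_induction with
    | zero => simp
    | add x y _ _ hx hy => rw [map_add, hx, hy]
    | smul r x _ hx => rw [map_smul, hx]
    | mem t ht =>
      obtain ⟨p, q, a, m, hd, ha, hm, rfl⟩ := ht
      rw [LinearMap.add_apply, TensorProduct.map_tmul, TensorProduct.map_tmul]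
      by_cases hp : p = 0
      · subst hp
        rw [zero_add] at hd; subst hd
        rw [a1 _ _ ha, b1 _ _ hm, a2 1 0 _ one_ne_zero ha, TensorProduct.zero_tmul, add_zero]
      · by_cases hp' : p = 1
        · subst hp'
          rw [a1 _ _ ha, b1 (d - 1) m (by rwa [← hd, add_sub_cancel_left]),
            a2 0 1 _ zero_ne_one ha, TensorProduct.zero_tmul, zero_add]
        · have : a = 0 := by
            rw [← a1 p a ha]
            change toLeftIdeal i (π p a) = 0
            rw [h5 p _ hp hp', map_zero]
          simp [this]
  · intro d d' hdd v hv
    induction hv using Submodule.span_induction with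
    | zero => simp
    | add x y _ _ hx hy => rw [map_add, hx, hy, add_zero]
    | smul r x _ hx => rw [map_smul, hx, smul_zero]
    | mem t ht =>
      obtain ⟨p, q, a, m, hd, ha, hm, rfl⟩ := ht
      rw [LinearMap.add_apply, TensorProduct.map_tmul, TensorProduct.map_tmul]
      have t1 : π' 0 a ⊗ₜ[k] ρ' d m = 0 := by
        by_cases hp : p = 0
        · rw [b2 d q m (by omega) hm, TensorProduct.tmul_zero]
        · rw [a2 0 p a (Ne.symm hp) ha, TensorProduct.zero_tmul]
      have t2 : π' 1 a ⊗ₜ[k] ρ' (d - 1) m = 0 := by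
        by_cases hp : p = 1
        · rw [b2 (d - 1) q m (by omega) hm, TensorProduct.tmul_zero]
        · rw [a2 1 p a (Ne.symm hp) ha, TensorProduct.zero_tmul]
      rw [t1, t2, add_zero]
  · intro v
    induction v using TensorProduct.induction_on with
    | zero => exact Submodule.zero_mem _
    | add x y hx hy => exact Submodule.add_mem _ hx hy
    | tmul a m =>
      have ha : a = π' 0 a + π' 1 a := by
        change a = toLeftIdeal i (π 0 a) + toLeftIdeal i (π 1 a)
        rw [← map_add, ← h3, toLeftIdeal_coe]
      obtain ⟨s, hs⟩ := g3 m
      have hm : m = ∑ d ∈ s, ρ' d m := by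
        change m = ∑ d ∈ s, toIdemPart i M (ρ d m)
        rw [← map_sum, ← hs, toIdemPart_coe]
      have mem : ∀ p q, π' p a ⊗ₜ[k] ρ' q m ∈ ⨆ d, tensorDeg i M d := fun p q =>
        Submodule.mem_iSup_of_mem (p + q) (tmul_mem_tensorDeg rfl (toLeftIdeal_mem (h0 _ _))
          (toIdemPart_mem (g0 _ _)))
      have hL : a ⊗ₜ[k] m = ∑ d ∈ s, π' 0 a ⊗ₜ[k] ρ' d m + ∑ d ∈ s, π' 1 a ⊗ₜ[k] ρ' d m := by
        rw [← TensorProduct.tmul_sum, ← TensorProduct.tmul_sum, ← TensorProduct.add_tmul, ← hm, ← ha]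
      rw [hL]
      exact Submodule.add_mem _ (Submodule.sum_mem _ fun d _ => mem 0 d)
        (Submodule.sum_mem _ fun d _ => mem 1 d)

instance (i : Fin n) : Module.Finite (ZigzagAlgebra k n) (leftIdeal k i) := (P k i).finite
instance (i : Fin n) : Module.Projective (ZigzagAlgebra k n) (leftIdeal k i) := (P k i).projective
instance (i : Fin n) : Module.Finite k (leftIdeal k i) :=
  inferInstanceAs (Module.Finite k (P k i))

/-- The graded module `(A eᵢ ⊗ₖ eᵢ A) ⊗_A M = A eᵢ ⊗ₖ eᵢ M`. -/
def tensor (i : Fin n) (M : GrProj k n) : GrProj k n where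
  carrier := leftIdeal k i ⊗[k] idemPart i M
  deg := tensorDeg i M
  isInternal := isInternal_tensorDeg i M
  smul_mem := by
    intro p d b t hb ht
    induction ht using Submodule.span_induction with
    | zero => rw [smul_zero]; exact Submodule.zero_mem _
    | add x y _ _ hx hy => rw [smul_add]; exact Submodule.add_mem _ hx hy
    | smul r x _ hx => rw [smul_comm]; exact Submodule.smul_mem _ r hx
    | mem t ht =>
      obtain ⟨p', q, a, m, hd, ha, hm, rfl⟩ := ht
      rw [TensorProduct.smul_tmul']
      exact tmul_mem_tensorDeg (p := p + p') (by omega) (mul_mem_homogeneous hb ha) hm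
  finite := by
    have : Module.Finite k (leftIdeal k i ⊗[k] idemPart i M) := inferInstance
    exact Module.Finite.of_restrictScalars_finite k _ _
  projective := inferInstance

/-- The map `eᵢ M ⟶ eᵢ N` induced by a morphism. -/
def idemPartMap (i : Fin n) {M N : GrProj k n} (f : M ⟶ N) : idemPart i M →ₗ[k] idemPart i N :=
  ((Hom.lin f).restrictScalars k).restrict fun m hm => by
    change (e i : ZigzagAlgebra k n) • (Hom.lin f) m = Hom.lin f m
    rw [← map_smul, show (e i : ZigzagAlgebra k n) • m = m from hm]

/-- The map `A eᵢ ⊗ eᵢ M ⟶ A eᵢ ⊗ eᵢ N` induced by a morphism. -/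
def tensorMapLin (i : Fin n) {M N : GrProj k n} (f : M ⟶ N) :
    leftIdeal k i ⊗[k] idemPart i M →ₗ[ZigzagAlgebra k n] leftIdeal k i ⊗[k] idemPart i N :=
  TensorProduct.AlgebraTensorModule.map LinearMap.id (idemPartMap i f)

lemma tensorMapLin_tmul (i : Fin n) {M N : GrProj k n} (f : M ⟶ N) (a : leftIdeal k i)
    (m : idemPart i M) : tensorMapLin i f (a ⊗ₜ m) = a ⊗ₜ idemPartMap i f m := rfl

lemma tensorMapLin_mem (i : Fin n) {M N : GrProj k n} (f : M ⟶ N) (d : ℤ)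
    (t : leftIdeal k i ⊗[k] idemPart i M) (ht : t ∈ tensorDeg i M d) :
    tensorMapLin i f t ∈ tensorDeg i N d := by
  induction ht using Submodule.span_induction with
  | zero => rw [map_zero]; exact Submodule.zero_mem _
  | add x y _ _ hx hy => rw [map_add]; exact Submodule.add_mem _ hx hy
  | smul r x _ hx => rw [LinearMap.map_smul_of_tower]; exact Submodule.smul_mem _ r hx
  | mem t ht =>
    obtain ⟨p', q, a, m, hd, ha, hm, rfl⟩ := ht
    exact tmul_mem_tensorDeg hd ha (Hom.lin_mem f hm)

/-- Tensoring with the bimodule `A eᵢ ⊗ₖ eᵢ A`, as a functor. -/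
def tensorFunctor (k : Type u) [Field k] {n : ℕ} (i : Fin n) : GrProj k n ⥤ GrProj k n where
  obj M := tensor i M
  map {M N} f := ofLin (M := tensor i M) (N := tensor i N) (tensorMapLin i f) (tensorMapLin_mem i f)
  map_id M := by
    ext t
    change tensorMapLin i (𝟙 M) t = t
    induction t using TensorProduct.induction_on with
    | zero => rw [map_zero]
    | add x y hx hy => rw [map_add, hx, hy]
    | tmul a m => rfl
  map_comp {L M N} f g := by
    ext t
    change tensorMapLin i (f ≫ g) t = tensorMapLin i g (tensorMapLin i f t)
    induction t using TensorProduct.induction_on with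
    | zero => simp only [map_zero]
    | add x y hx hy => simp only [map_add, hx, hy]
    | tmul a m => rfl

instance (i : Fin n) : (tensorFunctor k i).Additive where
  map_add {M N} f g := by
    ext t
    change tensorMapLin i (f + g) t = tensorMapLin i f t + tensorMapLin i g t
    induction t using TensorProduct.induction_on with
    | zero => simp only [map_zero, add_zero]
    | add x y hx hy => simp only [map_add, hx, hy]; abel
    | tmul a m => exact TensorProduct.tmul_add a (idemPartMap i f m) (idemPartMap i g m)

/-- The map `a ⊗ m ↦ a m` from `A eᵢ ⊗ₖ eᵢ M` to `M`, induced by the bimodule map `fᵢ`. -/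
def counitLin (i : Fin n) (M : GrProj k n) :
    leftIdeal k i ⊗[k] idemPart i M →ₗ[ZigzagAlgebra k n] M where
  __ := TensorProduct.lift (LinearMap.mk₂ k
    (fun (a : leftIdeal k i) (m : idemPart i M) => (a : ZigzagAlgebra k n) • (m : M))
    (fun _ _ _ => add_smul _ _ _) (fun r a m => smul_assoc r (a : ZigzagAlgebra k n) (m : M))
    (fun _ _ _ => smul_add _ _ _) (fun r a m => smul_comm (a : ZigzagAlgebra k n) r (m : M)))
  map_smul' := fun b t => by
    induction t using TensorProduct.induction_on with
    | zero => simp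
    | add x y hx hy => simp_all
    | tmul a m => exact mul_smul b (a : ZigzagAlgebra k n) (m : M)

lemma counitLin_tmul (i : Fin n) (M : GrProj k n) (a : leftIdeal k i) (m : idemPart i M) :
    counitLin i M (a ⊗ₜ m) = (a : ZigzagAlgebra k n) • (m : M) := rfl

lemma counitLin_mem (i : Fin n) (M : GrProj k n) (d : ℤ)
    (t : leftIdeal k i ⊗[k] idemPart i M) (ht : t ∈ tensorDeg i M d) :
    counitLin i M t ∈ M.deg d := by
  induction ht using Submodule.span_induction with
  | zero => rw [map_zero]; exact Submodule.zero_mem _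
  | add x y _ _ hx hy => rw [map_add]; exact Submodule.add_mem _ hx hy
  | smul r x _ hx => rw [LinearMap.map_smul_of_tower]; exact Submodule.smul_mem _ r hx
  | mem t ht =>
    obtain ⟨p', q, a, m, hd, ha, hm, rfl⟩ := ht
    rw [counitLin_tmul, ← hd]
    exact M.smul_mem ha hm

/-- The natural transformation induced by the bimodule map `fᵢ : A eᵢ ⊗ₖ eᵢ A ⟶ A`,
`fᵢ(eᵢ ⊗ eᵢ) = eᵢ`. -/
def counit (k : Type u) [Field k] {n : ℕ} (i : Fin n) : tensorFunctor k i ⟶ 𝟭 (GrProj k n) where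
  app M := ofLin (M := tensor i M) (N := M) (counitLin i M) (counitLin_mem i M)
  naturality M N f := by
    ext t
    change counitLin i N (tensorMapLin i f t) = Hom.lin f (counitLin i M t)
    induction t using TensorProduct.induction_on with
    | zero => simp only [map_zero]
    | add x y hx hy => simp only [map_add, hx, hy]
    | tmul a m => exact (map_smul (Hom.lin f) (a : ZigzagAlgebra k n) (m : M)).symm

/-- The formula `m ↦ z ⊗ m + eᵢ ⊗ z m + ∑ c ⊗ c* m`, the sum over all arrows `c` ending at `i`
(so that `c*` starts at `i`); this is induced by the bimodule map `gᵢ`. -/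
def unitFun (i : Fin n) (M : GrProj k n) (m : M) : leftIdeal k i ⊗[k] idemPart i M :=
  toLeftIdeal i (z i) ⊗ₜ toIdemPart i M m + toLeftIdeal i (e i) ⊗ₜ toIdemPart i M
      ((z i : ZigzagAlgebra k n) • m) +
    ∑ c : Arrow n, if c.tgt = i then
      toLeftIdeal i (ofArrow c) ⊗ₜ toIdemPart i M ((ofArrow c.star : ZigzagAlgebra k n) • m) else 0

lemma unitFun_add (i : Fin n) (M : GrProj k n) (m m' : M) :
    unitFun i M (m + m') = unitFun i M m + unitFun i M m' := by
  have : ∀ c : Arrow n, (if c.tgt = i then toLeftIdeal i (ofArrow c : ZigzagAlgebra k n) ⊗ₜ[k]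
      toIdemPart i M ((ofArrow c.star : ZigzagAlgebra k n) • (m + m')) else 0) =
      (if c.tgt = i then toLeftIdeal i (ofArrow c : ZigzagAlgebra k n) ⊗ₜ[k]
      toIdemPart i M ((ofArrow c.star : ZigzagAlgebra k n) • m) else 0) +
      (if c.tgt = i then toLeftIdeal i (ofArrow c : ZigzagAlgebra k n) ⊗ₜ[k]
      toIdemPart i M ((ofArrow c.star : ZigzagAlgebra k n) • m') else 0) := by
    intro c
    split_ifs
    · rw [smul_add, map_add, TensorProduct.tmul_add]
    · rw [add_zero]
  simp only [unitFun, smul_add, map_add, TensorProduct.tmul_add] at this ⊢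
  simp only [this, Finset.sum_add_distrib]
  abel

lemma unitFun_smul_field (i : Fin n) (M : GrProj k n) (r : k) (m : M) :
    unitFun i M (r • m) = r • unitFun i M m := by
  simp only [unitFun, smul_comm _ r m, map_smul, TensorProduct.tmul_smul, smul_add, Finset.smul_sum,
    smul_ite, smul_zero]

lemma toIdemPart_e_smul (i j : Fin n) (M : GrProj k n) (m : M) :
    toIdemPart i M ((e j : ZigzagAlgebra k n) • m) = if i = j then toIdemPart i M m else 0 := by
  apply Subtype.ext
  change (e i : ZigzagAlgebra k n) • (e j : ZigzagAlgebra k n) • m = _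
  rw [smul_smul, e_mul_e]
  split_ifs
  · rfl
  · rw [zero_smul]; rfl

lemma toIdemPart_arrow_smul (i : Fin n) (c : Arrow n) (M : GrProj k n) (m : M) (h : c.src ≠ i) :
    toIdemPart i M ((ofArrow c : ZigzagAlgebra k n) • m) = 0 := by
  apply Subtype.ext
  change (e i : ZigzagAlgebra k n) • (ofArrow c : ZigzagAlgebra k n) • m = _
  rw [smul_smul, e_mul_ofArrow, if_neg h, zero_smul]; rfl

lemma toIdemPart_z_smul (i j : Fin n) (M : GrProj k n) (m : M) (h : i ≠ j) :
    toIdemPart i M ((z j : ZigzagAlgebra k n) • m) = 0 := by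
  apply Subtype.ext
  change (e i : ZigzagAlgebra k n) • (z j : ZigzagAlgebra k n) • m = _
  rw [smul_smul, e_mul_z, if_neg h, zero_smul]; rfl

lemma toLeftIdeal_arrow (i : Fin n) (c : Arrow n) (h : c.tgt ≠ i) :
    toLeftIdeal i (ofArrow c : ZigzagAlgebra k n) = 0 := by
  apply Subtype.ext
  change (ofArrow c * e i : ZigzagAlgebra k n) = 0
  rw [ofArrow_mul_e, if_neg h]

lemma toLeftIdeal_z (i j : Fin n) (h : j ≠ i) :
    toLeftIdeal i (z j : ZigzagAlgebra k n) = 0 := by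
  apply Subtype.ext
  change (z j * e i : ZigzagAlgebra k n) = 0
  rw [z_mul_e, if_neg h]

lemma unitFun_smul (i : Fin n) (M : GrProj k n) (b : ZigzagAlgebra k n) (m : M) :
    unitFun i M (b • m) = b • unitFun i M m := by
  have lin : ∀ (b a : ZigzagAlgebra k n) (t : idemPart i M),
      b • (toLeftIdeal i a ⊗ₜ[k] t) = toLeftIdeal i (b * a) ⊗ₜ[k] t := by
    intro b a t
    rw [TensorProduct.smul_tmul', ← map_smul, smul_eq_mul]
  have ite_smul' : ∀ (b : ZigzagAlgebra k n) (p : Prop) [Decidable p]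
      (t : leftIdeal k i ⊗[k] idemPart i M),
      b • (if p then t else 0) = if p then b • t else 0 := by
    intro b p _ t; split_ifs <;> simp
  have zero0 : unitFun i M 0 = 0 := by
    simp [unitFun]
  induction b using ZigzagAlgebra.induction with
  | h0 => rw [zero_smul, zero_smul, zero0]
  | hadd a b ha hb => rw [add_smul, add_smul, unitFun_add, ha, hb]
  | hsmul r a ha => rw [smul_assoc, smul_assoc, unitFun_smul_field, ha]
  | he j =>
    simp only [unitFun, smul_add, lin, Finset.smul_sum, ite_smul', smul_smul, e_mul_z, e_mul_e,
      z_mul_e, e_mul_ofArrow, ofArrow_mul_e, toIdemPart_e_smul]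
    congr 1
    · congr 1
      · by_cases h : i = j
        · subst h; simp
        · simp [h, Ne.symm h]
      · by_cases h : i = j
        · subst h; simp
        · simp [h, Ne.symm h]
    · refine Finset.sum_congr rfl fun c _ => ?_
      by_cases h1 : c.tgt = i
      · by_cases h2 : c.src = j
        · rw [if_pos h1, if_pos h1, if_pos h2, if_pos (show c.star.tgt = j from h2)]
        · rw [if_pos h1, if_pos h1, if_neg h2, if_neg (show ¬ c.star.tgt = j from h2), map_zero, TensorProduct.zero_tmul,
            zero_smul, map_zero, TensorProduct.tmul_zero]
      · rw [if_neg h1, if_neg h1]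
  | hz j =>
    have r1 : toLeftIdeal i (z i : ZigzagAlgebra k n) ⊗ₜ[k]
        toIdemPart i M ((z j : ZigzagAlgebra k n) • m) =
        toLeftIdeal i (z j * e i : ZigzagAlgebra k n) ⊗ₜ[k]
          toIdemPart i M ((z i : ZigzagAlgebra k n) • m) := by
      rw [z_mul_e]
      by_cases h : j = i
      · subst h; rw [if_pos rfl]
      · rw [if_neg h, map_zero, TensorProduct.zero_tmul, toIdemPart_z_smul _ _ _ _ (Ne.symm h),
          TensorProduct.tmul_zero]
    simp only [unitFun, smul_add, lin, Finset.smul_sum, ite_smul', smul_smul, z_mul_z,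
      z_mul_ofArrow, ofArrow_mul_z, zero_smul, map_zero, TensorProduct.tmul_zero,
      TensorProduct.zero_tmul, ite_self, Finset.sum_const_zero, add_zero, zero_add]
    exact r1
  | ha d =>
    have l1 : ∑ c : Arrow n, (if c.tgt = i then
        toLeftIdeal i (ofArrow d * ofArrow c : ZigzagAlgebra k n) ⊗ₜ[k]
          toIdemPart i M ((ofArrow c.star : ZigzagAlgebra k n) • m) else 0) =
        toLeftIdeal i (z i : ZigzagAlgebra k n) ⊗ₜ[k]
          toIdemPart i M ((ofArrow d : ZigzagAlgebra k n) • m) := by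
      rw [Finset.sum_eq_single d.star]
      · rw [ofArrow_mul_ofArrow, if_pos rfl, Arrow.star_star]
        by_cases h : d.src = i
        · rw [if_pos (show d.star.tgt = i from h), h]
        · rw [if_neg (show ¬ d.star.tgt = i from h), toIdemPart_arrow_smul _ _ _ _ h,
            TensorProduct.tmul_zero]
      · intro c _ hc
        rw [ofArrow_mul_ofArrow, if_neg hc, map_zero, TensorProduct.zero_tmul, ite_self]
      · intro h; exact absurd (Finset.mem_univ _) h
    have l2 : ∑ c : Arrow n, (if c.tgt = i then
        toLeftIdeal i (ofArrow c : ZigzagAlgebra k n) ⊗ₜ[k]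
          toIdemPart i M ((ofArrow c.star * ofArrow d : ZigzagAlgebra k n) • m) else 0) =
        toLeftIdeal i (ofArrow d : ZigzagAlgebra k n) ⊗ₜ[k]
          toIdemPart i M ((z i : ZigzagAlgebra k n) • m) := by
      rw [Finset.sum_eq_single d]
      · rw [ofArrow_mul_ofArrow, if_pos (Arrow.star_star d).symm]
        by_cases h : d.tgt = i
        · rw [if_pos h, show d.star.src = i from h]
        · rw [if_neg h, toLeftIdeal_arrow _ _ h, TensorProduct.zero_tmul]
      · intro c _ hc
        rw [ofArrow_mul_ofArrow, Arrow.star_star, if_neg (Ne.symm hc), zero_smul, map_zero,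
          TensorProduct.tmul_zero, ite_self]
      · intro h; exact absurd (Finset.mem_univ _) h
    have l3 : toLeftIdeal i (ofArrow d * e i : ZigzagAlgebra k n) =
        toLeftIdeal i (ofArrow d : ZigzagAlgebra k n) := by
      rw [ofArrow_mul_e]
      by_cases h : d.tgt = i
      · rw [if_pos h]
      · rw [if_neg h, map_zero, toLeftIdeal_arrow _ _ h]
    simp only [unitFun, smul_add, lin, Finset.smul_sum, ite_smul', smul_smul]
    rw [l1, l2, l3, z_mul_ofArrow, ofArrow_mul_z, zero_smul, map_zero, map_zero,
      TensorProduct.tmul_zero, TensorProduct.zero_tmul, add_zero, zero_add, add_comm]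

lemma unitFun_mem (i : Fin n) (M : GrProj k n) (d : ℤ) (m : M) (hm : m ∈ M.deg d) :
    unitFun i M m ∈ tensorDeg i M (d + 1) := by
  refine Submodule.add_mem _ (Submodule.add_mem _ ?_ ?_) (Submodule.sum_mem _ fun c _ => ?_)
  · exact tmul_mem_tensorDeg (add_comm 1 d) (toLeftIdeal_mem (z_mem i)) (toIdemPart_mem hm)
  · exact tmul_mem_tensorDeg (p := 0) (q := 1 + d) (by omega) (toLeftIdeal_mem (e_mem i))
      (toIdemPart_mem (M.smul_mem (z_mem i) hm))
  · split_ifs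
    · have := c.deg_add_deg_star
      exact tmul_mem_tensorDeg (p := c.deg) (q := c.star.deg + d) (by omega)
        (toLeftIdeal_mem (ofArrow_mem c)) (toIdemPart_mem (M.smul_mem (ofArrow_mem _) hm))
    · exact Submodule.zero_mem _

lemma unitFun_naturality (i : Fin n) {M N : GrProj k n} (f : M ⟶ N) (m : M) :
    unitFun i N (Hom.lin f m) = tensorMapLin i f (unitFun i M m) := by
  have h : ∀ m, idemPartMap i f (toIdemPart i M m) = toIdemPart i N (Hom.lin f m) := fun m =>
    Subtype.ext (map_smul (Hom.lin f) (e i : ZigzagAlgebra k n) m)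
  simp only [unitFun, map_add, map_sum, apply_ite (tensorMapLin i f), map_zero, tensorMapLin_tmul,
    h, map_smul]

/-- The natural transformation induced by the bimodule map `gᵢ : A ⟶ (A eᵢ ⊗ₖ eᵢ A)⟨1⟩`. -/
def unit (k : Type u) [Field k] {n : ℕ} (i : Fin n) :
    𝟭 (GrProj k n) ⟶ tensorFunctor k i ⋙ shiftFunctor k n 1 where
  app M := ofLin (M := M) (N := (tensor i M).shift 1)
    { toFun := unitFun i M
      map_add' := unitFun_add i M
      map_smul' := unitFun_smul i M } (unitFun_mem i M)
  naturality M N f := by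
    ext m
    exact unitFun_naturality i f m

end GrProj
end Modules

section Cone

open CochainComplex CochainComplex.HomComplex

variable {C : Type*} [Category C] [Preadditive C] [HasBinaryBiproducts C]

/-- Compatible homotopies induce a homotopy between maps of mapping cones. -/
noncomputable def mapConeHomotopy {K₁ L₁ K₂ L₂ : CochainComplex C ℤ} (φ₁ : K₁ ⟶ L₁) (φ₂ : K₂ ⟶ L₂)
    {a a' : K₁ ⟶ K₂} {b b' : L₁ ⟶ L₂} (comm : φ₁ ≫ b = a ≫ φ₂) (comm' : φ₁ ≫ b' = a' ≫ φ₂)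
    (h : Homotopy a a') (g : Homotopy b b')
    (nat : ∀ p q, φ₁.f p ≫ g.hom p q = h.hom p q ≫ φ₂.f q) :
    Homotopy (mappingCone.map φ₁ φ₂ a b comm) (mappingCone.map φ₁ φ₂ a' b' comm') := by
  have nat' : (Cochain.ofHom φ₁).comp (Cochain.ofHomotopy g) (zero_add (-1)) =
      (Cochain.ofHomotopy h).comp (Cochain.ofHom φ₂) (add_zero (-1)) := by
    ext p q hpq
    simp only [Cochain.zero_cochain_comp_v, Cochain.comp_zero_cochain_v, Cochain.ofHom_v]
    exact nat p q
  refine mappingCone.descHomotopy φ₁ _ _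
    (-(Cochain.ofHomotopy h).comp (mappingCone.inl φ₂) (by norm_num))
    ((Cochain.ofHomotopy g).comp (Cochain.ofHom (mappingCone.inr φ₂)) (add_zero _)) ?_ ?_
  · rw [mappingCone.map, mappingCone.map, mappingCone.inl_desc, mappingCone.inl_desc, δ_neg,
      δ_comp _ _ (show (-1 : ℤ) + -1 = -2 by norm_num) 0 0 (-1) (by norm_num) (by norm_num)
        (by norm_num), mappingCone.δ_inl, δ_ofHomotopy,
      ← Cochain.comp_assoc_of_first_is_zero_cochain, nat',
      Cochain.comp_assoc_of_second_is_zero_cochain]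
    simp only [Cochain.ofHom_comp, Cochain.sub_comp]
    simp
  · rw [mappingCone.map, mappingCone.map, mappingCone.inr_desc, mappingCone.inr_desc,
      δ_comp_ofHom, δ_ofHomotopy, Cochain.sub_comp, ← Cochain.ofHom_comp, ← Cochain.ofHom_comp,
      sub_add_cancel]

variable {F G : C ⥤ C} [F.Additive] [G.Additive] (α : F ⟶ G)

/-- The functor on complexes sending `Y` to the mapping cone of `α_Y : F Y ⟶ G Y`. -/
noncomputable def coneFunctor : CochainComplex C ℤ ⥤ CochainComplex C ℤ where
  obj Y := mappingCone ((NatTrans.mapHomologicalComplex α (ComplexShape.up ℤ)).app Y)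
  map f := mappingCone.map _ _ ((F.mapHomologicalComplex _).map f)
    ((G.mapHomologicalComplex _).map f)
    ((NatTrans.mapHomologicalComplex α (ComplexShape.up ℤ)).naturality f).symm
  map_id Y := by
    refine Eq.trans ?_ (mappingCone.map_id _)
    congr 1 <;> exact CategoryTheory.Functor.map_id _ _
  map_comp f g := by
    refine Eq.trans ?_ (mappingCone.map_comp _ _ _ _ _ _ _ _ _)
    congr 1 <;> exact CategoryTheory.Functor.map_comp _ _ _

/-- The cone functor respects homotopies. -/
noncomputable def coneFunctorHomotopy {K L : CochainComplex C ℤ} {f f' : K ⟶ L}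
    (h : Homotopy f f') : Homotopy ((coneFunctor α).map f) ((coneFunctor α).map f') :=
  mapConeHomotopy _ _
    ((NatTrans.mapHomologicalComplex α (ComplexShape.up ℤ)).naturality f).symm
    ((NatTrans.mapHomologicalComplex α (ComplexShape.up ℤ)).naturality f').symm
    (F.mapHomotopy h) (G.mapHomotopy h) (fun p q => (α.naturality (h.hom p q)).symm)

/-- The functor on homotopy categories induced by a functor that respects homotopies. -/
def liftToHomotopy (Φ : CochainComplex C ℤ ⥤ CochainComplex C ℤ)
    (hΦ : ∀ {K L : CochainComplex C ℤ} {f f' : K ⟶ L}, Homotopy f f' →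
      Nonempty (Homotopy (Φ.map f) (Φ.map f'))) :
    HomotopyCategory C (ComplexShape.up ℤ) ⥤ HomotopyCategory C (ComplexShape.up ℤ) :=
  CategoryTheory.Quotient.lift _ (Φ ⋙ HomotopyCategory.quotient C (ComplexShape.up ℤ))
    (fun _ _ _ _ ⟨h⟩ => (hΦ h).elim (HomotopyCategory.eq_of_homotopy _ _))

/-- A complex is bounded if only finitely many degrees are nonzero. -/
def IsBounded (Y : CochainComplex C ℤ) : Prop :=
  ∃ a b : ℤ, ∀ m, m < a ∨ b < m → IsZero (Y.X m)

lemma isBounded_cone {Y : CochainComplex C ℤ} (hY : IsBounded Y) :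
    IsBounded ((coneFunctor α).obj Y) := by
  obtain ⟨a, b, h⟩ := hY
  refine ⟨a - 1, b, fun j hj => ?_⟩
  refine (mappingCone.isZero_X_iff
    ((NatTrans.mapHomologicalComplex α (ComplexShape.up ℤ)).app Y) j).mpr ⟨?_, ?_⟩
  · exact F.map_isZero (h _ (by omega))
  · exact G.map_isZero (h _ (by omega))

lemma isBounded_shift {Y : CochainComplex C ℤ} (hY : IsBounded Y) (m : ℤ) :
    IsBounded ((CategoryTheory.shiftFunctor (CochainComplex C ℤ) m).obj Y) := by
  obtain ⟨a, b, h⟩ := hY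
  exact ⟨a - m, b - m, fun j hj => h (j + m) (by omega)⟩

end Cone

/-- The homotopy category `𝒟` of bounded complexes of finitely generated projective graded modules
over the zigzag algebra. -/
abbrev D (k : Type u) [Field k] (n : ℕ) :=
  ObjectProperty.FullSubcategory
    (fun Y : HomotopyCategory (GrProj k n) (ComplexShape.up ℤ) => IsBounded Y.as)

section Functors

variable (k : Type u) [Field k] {n : ℕ} (i : Fin n)

/-- Tensoring with the complex of bimodules `A ⟶ (A eᵢ ⊗ₖ eᵢ A)⟨1⟩`, with `A` in
homological degree `0`: the cone of `Y ⟶ (A eᵢ ⊗ₖ eᵢ Y)⟨1⟩` shifted by `[-1]`. -/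
noncomputable def sigmaComplex : CochainComplex (GrProj k n) ℤ ⥤ CochainComplex (GrProj k n) ℤ :=
  coneFunctor (GrProj.unit k i) ⋙ shiftFunctor (CochainComplex (GrProj k n) ℤ) (-1 : ℤ)

/-- Tensoring with the complex of bimodules `A eᵢ ⊗ₖ eᵢ A ⟶ A`, with `A` in
homological degree `0`: the cone of `A eᵢ ⊗ₖ eᵢ Y ⟶ Y`. -/
noncomputable def sigmaInvComplex :
    CochainComplex (GrProj k n) ℤ ⥤ CochainComplex (GrProj k n) ℤ :=
  coneFunctor (GrProj.counit k i)

/-- The endofunctor `Σᵢ` of `𝒟`. -/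
noncomputable def sigma : D k n ⥤ D k n :=
  ObjectProperty.lift _ (ObjectProperty.ι _ ⋙ liftToHomotopy (sigmaComplex k i)
      fun h => ⟨(coneFunctorHomotopy (GrProj.unit k i) h).shift (-1)⟩)
    fun Y => isBounded_shift (isBounded_cone (GrProj.unit k i) Y.property) (-1)

/-- The endofunctor `Σᵢ⁻¹` of `𝒟`. -/
noncomputable def sigmaInv : D k n ⥤ D k n :=
  ObjectProperty.lift _ (ObjectProperty.ι _ ⋙ liftToHomotopy (sigmaInvComplex k i)
      fun h => ⟨coneFunctorHomotopy (GrProj.counit k i) h⟩)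
    fun Y => isBounded_cone (GrProj.counit k i) Y.property

/-- The endofunctor `Ψ_w` of `𝒟` given by a word `w` in the letters `σᵢ` (encoded by `(i, true)`)
and `σᵢ⁻¹` (encoded by `(i, false)`): the composite of the functors `Σᵢ` and `Σᵢ⁻¹` given by the
letters, where the leftmost letter is applied last. -/
noncomputable def Psi (k : Type u) [Field k] {n : ℕ} : List (Fin n × Bool) → (D k n ⥤ D k n)
  | [] => 𝟭 _
  | (i, true) :: w => Psi k w ⋙ sigma k i
  | (i, false) :: w => Psi k w ⋙ sigmaInv k i

end Functors

section Baric

variable {k : Type u} [Field k] {n : ℕ}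

/-- A complex is minimal if it has no nonzero contractible direct summand. -/
def IsMinimal (Y : CochainComplex (GrProj k n) ℤ) : Prop :=
  ∀ (Z : CochainComplex (GrProj k n) ℤ) (i : Z ⟶ Y) (p : Y ⟶ Z), i ≫ p = 𝟙 Z →
    Nonempty (Homotopy (𝟙 Z) 0) → IsZero Z

/-- `M` is a finite direct sum of modules `Pᵢ⟨l⟩` with `a ≤ l ≤ b`. -/
def IsSumOfShifts (a b : ℤ) (M : GrProj k n) : Prop :=
  ∃ (r : ℕ) (i : Fin r → Fin n) (l : Fin r → ℤ), (∀ s, a ≤ l s ∧ l s ≤ b) ∧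
    Nonempty (M ≅ ⨁ fun s => (GrProj.P k (i s)).shift (l s))

/-- The full subcategory `𝒟_{[a, b]}`: the objects whose minimal complex has only chain
groups that are direct sums of modules `Pᵢ⟨l⟩` with `a ≤ l ≤ b`, that is, the
objects whose baric slices outside `[a, b]` vanish. -/
def baric (a b : ℤ) : ObjectProperty (D k n) := fun Y =>
  ∃ Z : CochainComplex (GrProj k n) ℤ, IsBounded Z ∧ IsMinimal Z ∧
    Nonempty ((HomotopyCategory.quotient _ _).obj Z ≅ Y.obj) ∧ ∀ m, IsSumOfShifts a b (Z.X m)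

/-- The heart `𝒟_0` of the baric structure. -/
def heart : ObjectProperty (D k n) := baric 0 0

/-- The functor `Φ` maps `𝒟_0` into `𝒟_{[a, b]}`. -/
def MapsHeart (Φ : D k n ⥤ D k n) (a b : ℤ) : Prop :=
  ∀ Y : D k n, heart Y → baric a b (Φ.obj Y)

/-- `[a, b]` is the smallest interval of integers such that `Φ` maps `𝒟_0` into `𝒟_{[a, b]}`. -/
def IsSmallestInterval (Φ : D k n ⥤ D k n) (a b : ℤ) : Prop :=
  a ≤ b ∧ MapsHeart Φ a b ∧ ∀ a' b', MapsHeart Φ a' b' → Set.Icc a b ⊆ Set.Icc a' b'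

end Baric

/-- The word length of an element of the free group in the generators `σᵢ` and their inverses: the
least length of a word that represents it. -/
noncomputable def wordLength {n : ℕ} (β : FreeGroup (Fin n)) : ℕ :=
  sInf {r | ∃ w : List (Fin n × Bool), FreeGroup.mk w = β ∧ w.length = r}

end Zigzag

/-! Write T for the functor M ↦ A eⱼ ⊗ eⱼ M. The module Pᵢ⟨l⟩ lives in internal degrees -l and 1 - l
and is nonzero in both, and every object of `GrProj` is a finite sum of such modules. Hence an
object lies in 𝒟_{[a,b]} exactly when it is homotopy equivalent to a bounded complex whose internal
degrees all lie in [-b, 1 - a] (`baric_iff`). The baric condition thus becomes a condition on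
degrees.

Upper bound. Both Σⱼ and Σⱼ⁻¹ are cones built from Y and T Y, and T Y occupies the degrees of Y and
one more. So Σⱼ⁻¹ lowers a by at most one, and Σⱼ, where T Y is shifted by ⟨1⟩, raises b by at most
one. This holds for arbitrary words (`mapsHeart_Psi`).

Lower bound. For a reduced word w choose a vertex i₀ different from the index of its last letter and
apply Ψ_w to P_{i₀}. It suffices that the resulting complex has nonzero cohomology in internal
degrees -(number of positive letters) and 1 + (number of negative letters): a nonzero class of
degree D survives in every homotopy equivalent complex, so D must be among its degrees
(`bounds_of_not_isBdry`).

The classes are followed through the word by two invariants that remember only the letter applied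
last. In the lowest degree D (`TopState`), Σⱼ replaces the cohomology H by A₀ eⱼ ⊗ eⱼ H in degree D
- 1, which is nonzero as long as eⱼ H is; Σⱼ⁻¹ keeps D and makes eⱼ H vanish. The only danger is
thus Σⱼ applied directly after Σⱼ⁻¹, which reducedness forbids. To know that H stays nonzero at all
other vertices, the invariant also asks for classes there that are killed by every arrow of degree
0; this property reproduces itself because two arrows of degree 0 always have product 0. The highest
degree (`BotState`) is dual: the roles of Σⱼ and Σⱼ⁻¹ are exchanged, and socle classes are replaced
by classes outside the image of the degree 0 arrows.

Independence of the word. Σⱼ and Σⱼ⁻¹ are mutually inverse up to homotopy equivalence, so Ψ_w is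
isomorphic on objects to Ψ of the reduced word. The composites are total complexes of a square with
T Y, T T Y⟨1⟩, T Y⟨1⟩ and Y as corners. The split exact sequence T Y → T T Y → T Y, which comes from
eⱼ A eⱼ = k eⱼ ⊕ k zⱼ, contracts the first three corners (`SquareTotal.homotopyEquiv`). -/

namespace Zigzag
-- Graded projective modules are sums of shifted modules Pᵢ
namespace GrProj
open ZigzagAlgebra

variable {k : Type u} [Field k] {n : ℕ}

@[simp] lemma lin_neg {M N : GrProj k n} (f : M ⟶ N) : Hom.lin (-f) = -Hom.lin f := rfl

@[simp] lemma lin_sub {M N : GrProj k n} (f g : M ⟶ N) :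
    Hom.lin (f - g) = Hom.lin f - Hom.lin g := by
  rw [sub_eq_add_neg, lin_add, lin_neg, sub_eq_add_neg]

/-- A morphism of graded modules commutes with projections onto homogeneous parts. -/
lemma proj_lin {M N : GrProj k n} {π : ℤ → M →ₗ[k] M} {ρ : ℤ → N →ₗ[k] N}
    (h0 : ∀ d v, π d v ∈ M.deg d) (h3 : ∀ v, ∃ s : Finset ℤ, v = ∑ d ∈ s, π d v)
    (h1 : ∀ d, ∀ v ∈ M.deg d, π d v = v) (h2 : ∀ d e, d ≠ e → ∀ v ∈ M.deg e, π d v = 0)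
    (g1 : ∀ d, ∀ v ∈ N.deg d, ρ d v = v) (g2 : ∀ d e, d ≠ e → ∀ v ∈ N.deg e, ρ d v = 0)
    (f : M ⟶ N) (d : ℤ) (v : M) : ρ d (Hom.lin f v) = Hom.lin f (π d v) := by
  obtain ⟨s, hs⟩ := h3 v
  rw [hs, map_sum, map_sum, map_sum, map_sum]
  refine Finset.sum_congr rfl fun e _ => ?_
  by_cases h : d = e
  · subst h
    rw [g1 _ _ (Hom.lin_mem f (h0 _ _)), h1 _ _ (h0 _ _)]
  · rw [g2 _ _ h _ (Hom.lin_mem f (h0 _ _)), h2 _ _ h _ (h0 _ _), map_zero]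

/-- The image of an idempotent endomorphism. -/
def image {M : GrProj k n} (p : M ⟶ M) (hp : p ≫ p = p) : GrProj k n where
  carrier := LinearMap.range (Hom.lin p)
  deg := fun d => (M.deg d).comap ((LinearMap.range (Hom.lin p)).subtype.restrictScalars k)
  isInternal := by
    obtain ⟨π, h0, h1, h2, h3⟩ := exists_proj _ M.isInternal
    have key : ∀ d (a : LinearMap.range (Hom.lin p)),
        π d (a : M) ∈ LinearMap.range (Hom.lin p) := by
      rintro d ⟨_, v, rfl⟩
      exact ⟨π d v, (proj_lin h0 h3 h1 h2 h1 h2 p d v).symm⟩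
    refine isInternal_of_proj _ (fun d => ⟨⟨fun a => ⟨π d (a : M), key d a⟩,
      fun a b => Subtype.ext (map_add (π d) _ _)⟩, fun r a => Subtype.ext (map_smul (π d) _ _)⟩)
      (fun d a ha => Subtype.ext (h1 d _ ha)) (fun d d' h a ha => Subtype.ext (h2 d d' h _ ha))
      fun a => ?_
    obtain ⟨s, hs⟩ := h3 a
    have : a = ∑ d ∈ s, ⟨π d (a : M), key d a⟩ := by
      apply Subtype.ext
      rw [Submodule.coe_sum]
      exact hs
    rw [this]
    exact Submodule.sum_mem _ fun d _ => Submodule.mem_iSup_of_mem d (h0 _ _)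
  smul_mem := fun ha hm => M.smul_mem ha hm
  finite := inferInstance
  projective := Module.Projective.of_split (LinearMap.range (Hom.lin p)).subtype
    (Hom.lin p).rangeRestrict (by
      ext ⟨_, v, rfl⟩
      exact congrArg (fun f => Hom.lin f v) hp)

/-- Provides complements of direct summands, both for modules and, degreewise, for complexes;
contractible summands are split off with it. -/
instance : IsIdempotentComplete (GrProj k n) where
  idempotents_split M p hp := by
    refine ⟨image p hp, ofLin (M := image p hp) (N := M) (LinearMap.range (Hom.lin p)).subtype
      (fun _ _ hm => hm), ofLin (M := M) (N := image p hp) (Hom.lin p).rangeRestrict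
      (fun _ _ hm => Hom.lin_mem p hm), ?_, rfl⟩
    ext ⟨_, v, rfl⟩
    exact Subtype.ext (congrArg (fun f => Hom.lin f v) hp)

lemma isZero_iff_subsingleton {M : GrProj k n} : IsZero M ↔ Subsingleton M := by
  rw [IsZero.iff_id_eq_zero]
  constructor
  · intro h
    refine ⟨fun a b => ?_⟩
    have : ∀ a : M, a = 0 := fun a => congrArg (fun f => Hom.lin f a) h
    rw [this a, this b]
  · intro h
    ext m
    exact Subsingleton.elim _ _

/-- Inserting the decomposition of the identity between `s` and `q` gives s q + s q = s q; likewise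
between `i` and `p`. -/
lemma comp_eq_zero_of_complement {C : Type*} [Category C] [Preadditive C]
    {N M L : C} {s : N ⟶ M} {p : M ⟶ N} (hs : s ≫ p = 𝟙 N) {i : L ⟶ M} {q : M ⟶ L}
    (hi : i ≫ q = 𝟙 L) (h : p ≫ s + q ≫ i = 𝟙 M) : s ≫ q = 0 ∧ i ≫ p = 0 := by
  constructor
  · have : s ≫ (p ≫ s + q ≫ i) ≫ q = s ≫ q := by rw [h, Category.id_comp]
    simpa [Preadditive.add_comp, Preadditive.comp_add, Category.assoc, hi, reassoc_of% hs]
      using this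
  · have : i ≫ (p ≫ s + q ≫ i) ≫ p = i ≫ p := by rw [h, Category.id_comp]
    simpa [Preadditive.add_comp, Preadditive.comp_add, Category.assoc, hs, reassoc_of% hi]
      using this

/-- The dimension of a graded module is additive for direct sum decompositions. -/
lemma finrank_eq_add {M N L : GrProj k n} (s : N ⟶ M) (p : M ⟶ N) (i : L ⟶ M) (q : M ⟶ L)
    (hs : s ≫ p = 𝟙 N) (hi : i ≫ q = 𝟙 L) (h : p ≫ s + q ≫ i = 𝟙 M) :
    Module.finrank k M = Module.finrank k N + Module.finrank k L := by
  obtain ⟨hsq, hip⟩ := comp_eq_zero_of_complement hs hi h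
  rw [← Module.finrank_prod]
  refine LinearEquiv.finrank_eq (LinearEquiv.restrictScalars k (LinearEquiv.ofLinearMap
    ((Hom.lin p).prod (Hom.lin q)) ((Hom.lin s).coprod (Hom.lin i)) ?_ ?_))
  · have e1 := fun a => congrArg (fun f => Hom.lin f a) hs
    have e2 := fun a => congrArg (fun f => Hom.lin f a) hi
    have e3 := fun a => congrArg (fun f => Hom.lin f a) hsq
    have e4 := fun a => congrArg (fun f => Hom.lin f a) hip
    simp at e1 e2 e3 e4
    ext a <;> simp [e1, e2, e3, e4]
  · ext a
    simpa using congrArg (fun f => Hom.lin f a) h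

/-- A projective module on which all loops act trivially vanishes. -/
lemma subsingleton_of_z_smul {M : GrProj k n}
    (h : ∀ j (m : M), (z j : ZigzagAlgebra k n) • m = 0) : Subsingleton M := by
  obtain ⟨r, f, g, -, -, hfg⟩ := Module.Finite.exists_comp_eq_id_of_projective (ZigzagAlgebra k n) M
  have hfg' : ∀ m, f (g m) = m := fun m => LinearMap.congr_fun hfg m
  -- The loop coefficient at i of zᵢ a is the idempotent coefficient of a at i, and zᵢ g(m) = g(zᵢ
  -- m) = 0. So g takes values in the radical.
  have h1 : ∀ m t i, (g m t).idem i = 0 := by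
    intro m t i
    have := congrArg (fun v => (v t).loop i) (map_smul g (z i : ZigzagAlgebra k n) m)
    simpa [h, z_loop] using this.symm
  -- A Nakayama argument: the entries of g m are sums of products of two values of g. As these have
  -- no idempotent part, the products have no arrow part; then the factors have no arrow part
  -- either, so the loop part vanishes as well.
  have key : ∀ m t, g m t = ∑ s, g m s * g (f (Pi.single s 1)) t := by
    intro m t
    conv_lhs => rw [← hfg' m, pi_eq_sum_univ' (g m)]
    simp only [map_sum, Finset.sum_apply, map_smul, Pi.smul_apply, smul_eq_mul]
  have sum_arr : ∀ (v : Fin r → ZigzagAlgebra k n) c, (∑ s, v s).arr c = ∑ s, (v s).arr c := by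
    intro v c
    exact map_sum (⟨⟨fun a => a.arr c, rfl⟩, fun _ _ => rfl⟩ : ZigzagAlgebra k n →+ k) _ _
  have sum_loop : ∀ (v : Fin r → ZigzagAlgebra k n) c, (∑ s, v s).loop c = ∑ s, (v s).loop c := by
    intro v c
    exact map_sum (⟨⟨fun a => a.loop c, rfl⟩, fun _ _ => rfl⟩ : ZigzagAlgebra k n →+ k) _ _
  have h2 : ∀ m t c, (g m t).arr c = 0 := by
    intro m t c
    rw [key, sum_arr]
    exact Finset.sum_eq_zero fun s _ => by simp [h1]
  have h3 : ∀ m t c, (g m t).loop c = 0 := by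
    intro m t c
    rw [key, sum_loop]
    exact Finset.sum_eq_zero fun s _ => by simp [h1, h2]
  have h4 : ∀ m : M, m = 0 := fun m => by
    rw [← hfg' m, show g m = 0 from funext fun t => ZigzagAlgebra.ext (h1 m t) (h2 m t) (h3 m t),
      map_zero]
  exact ⟨fun a b => by rw [h4 a, h4 b]⟩

/-- The map `Pᵢ⟨-d⟩ ⟶ M`, `a ↦ a m`, for an element `m` of degree `d`. -/
def ofElement (i : Fin n) {M : GrProj k n} {d : ℤ} (m : M) (hm : m ∈ M.deg d) :
    (P k i).shift (-d) ⟶ M :=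
  ofLin (M := (P k i).shift (-d))
    ((LinearMap.toSpanSingleton (ZigzagAlgebra k n) M m).comp (leftIdeal k i).subtype)
    (fun p a ha => by
      have := M.smul_mem (a := (leftIdeal k i).subtype a) ha hm
      rwa [neg_add_cancel_right] at this)

/-- Evaluation of the second tensor factor at a linear functional. -/
def tensorEval (i : Fin n) (M : GrProj k n) (f : M →ₗ[k] k) :
    leftIdeal k i ⊗[k] idemPart i M →ₗ[ZigzagAlgebra k n] leftIdeal k i :=
  (TensorProduct.AlgebraTensorModule.rid k (ZigzagAlgebra k n) (leftIdeal k i)).toLinearMap ∘ₗ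
    TensorProduct.AlgebraTensorModule.map LinearMap.id (f ∘ₗ (idemPart i M).subtype)

lemma tensorEval_tmul (i : Fin n) (M : GrProj k n) (f : M →ₗ[k] k) (a : leftIdeal k i)
    (m : idemPart i M) : tensorEval i M f (a ⊗ₜ m) = f m • a := rfl

lemma tensorEval_mem (i : Fin n) (M : GrProj k n) (f : M →ₗ[k] k) {d p : ℤ}
    (hf : ∀ e ≠ d, ∀ v ∈ M.deg e, f v = 0) {t : leftIdeal k i ⊗[k] idemPart i M}
    (ht : t ∈ tensorDeg i M p) :
    (tensorEval i M f t : ZigzagAlgebra k n) ∈ homogeneous k n (p - d) := by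
  induction ht using Submodule.span_induction with
  | zero => rw [map_zero]; exact Submodule.zero_mem _
  | add x y _ _ hx hy => rw [map_add]; exact Submodule.add_mem _ hx hy
  | smul r x _ hx => rw [LinearMap.map_smul_of_tower]; exact Submodule.smul_mem _ r hx
  | mem t ht =>
    obtain ⟨p', q', a, m', hpq, ha, hm', rfl⟩ := ht
    rw [tensorEval_tmul]
    by_cases hq : q' = d
    · rw [show p - d = p' by omega]
      exact Submodule.smul_mem _ _ ha
    · rw [hf q' hq _ hm', zero_smul]
      exact Submodule.zero_mem _

/-- By the preceding vanishing criterion some loop acts nontrivially, so there is a homogeneous m₀ =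
eⱼ m₀ with zⱼ m₀ ≠ 0. The map a ↦ a m₀ from Pⱼ has a retraction: the unit M → A eⱼ ⊗ eⱼ M followed
by a functional on the second factor with value 1 on zⱼ m₀. This is the Frobenius form of the zigzag
algebra at work. -/
lemma exists_split_P (M : GrProj k n) (hM : ¬ IsZero M) :
    ∃ (i : Fin n) (d : ℤ) (s : (P k i).shift d ⟶ M) (p : M ⟶ (P k i).shift d), s ≫ p = 𝟙 _ := by
  have : ¬ ∀ j (m : M), (z j : ZigzagAlgebra k n) • m = 0 := fun h =>
    hM (isZero_iff_subsingleton.mpr (subsingleton_of_z_smul h))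
  push Not at this
  obtain ⟨j, m, hm⟩ := this
  obtain ⟨π, h0, h1, h2, h3⟩ := exists_proj _ M.isInternal
  obtain ⟨d, hd⟩ : ∃ d, (z j : ZigzagAlgebra k n) • π d m ≠ 0 := by
    by_contra! hc
    obtain ⟨s, hs⟩ := h3 m
    apply hm
    rw [hs, Finset.smul_sum]
    exact Finset.sum_eq_zero fun d _ => hc d
  set m0 : M := (e j : ZigzagAlgebra k n) • π d m with hm0
  have hm0d : m0 ∈ M.deg d := by
    have := M.smul_mem (e_mem (k := k) j) (h0 d m)
    rwa [zero_add] at this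
  have hzm : (z j : ZigzagAlgebra k n) • m0 ≠ 0 := by
    rw [hm0, smul_smul, z_mul_e, if_pos rfl]; exact hd
  have hzd : (z j : ZigzagAlgebra k n) • m0 ∈ M.deg (1 + d) := M.smul_mem (z_mem j) hm0d
  obtain ⟨f, hf⟩ : ∃ f : Module.Dual k M, f ((z j : ZigzagAlgebra k n) • m0) ≠ 0 := by
    by_contra! hc
    exact hzm ((Module.forall_dual_apply_eq_zero_iff k _).mp hc)
  -- Cutting the functional off to degree 1 + d makes the retraction homogeneous and removes the
  -- term zⱼ ⊗ m₀ of the unit, since m₀ has degree d.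
  let f' : M →ₗ[k] k := (f ((z j : ZigzagAlgebra k n) • m0))⁻¹ • f ∘ₗ π (1 + d)
  have hf' : ∀ e ≠ 1 + d, ∀ v ∈ M.deg e, f' v = 0 := by
    intro e he v hv
    simp [f', h2 (1 + d) e (Ne.symm he) v hv]
  have hf1 : f' ((z j : ZigzagAlgebra k n) • m0) = 1 := by
    simp [f', h1 _ _ hzd, hf]
  let q : M →ₗ[ZigzagAlgebra k n] leftIdeal k j := tensorEval j M f' ∘ₗ Hom.lin ((unit k j).app M)
  have hem : (e j : ZigzagAlgebra k n) • m0 = m0 := by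
    rw [hm0, smul_smul, e_mul_e, if_pos rfl]
  have hqm : q m0 = toLeftIdeal j (e j) := by
    change tensorEval j M f' (unitFun j M m0) = _
    rw [unitFun, map_add, map_add, map_sum, Finset.sum_eq_zero, add_zero, tensorEval_tmul,
      tensorEval_tmul]
    · have a1 : f' (toIdemPart j M m0 : M) = 0 := by
        refine hf' d (by omega) _ ?_
        exact toIdemPart_mem hm0d
      have a2 : f' (toIdemPart j M ((z j : ZigzagAlgebra k n) • m0) : M) = 1 := by
        change f' ((e j : ZigzagAlgebra k n) • (z j : ZigzagAlgebra k n) • m0) = 1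
        rw [smul_smul, e_mul_z, if_pos rfl, hf1]
      rw [a1, a2, zero_smul, zero_add, one_smul]
    · intro c _
      split_ifs with hc
      · rw [tensorEval_tmul]
        have : (toIdemPart j M ((ofArrow c.star : ZigzagAlgebra k n) • m0) : M) = 0 := by
          change (e j : ZigzagAlgebra k n) • (ofArrow c.star : ZigzagAlgebra k n) • m0 = 0
          -- c* ends at the source of c, which is not j, so it kills m₀ = eⱼ m₀.
          rw [← hem, smul_smul (ofArrow _), ofArrow_mul_e, if_neg, zero_smul, smul_zero]
          rw [Arrow.star_tgt, ← hc]
          exact c.src_ne_tgt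
        rw [this, map_zero, zero_smul]
      · exact map_zero _
  refine ⟨j, -d, ofElement j m0 hm0d, ofLin (N := (P k j).shift (-d)) q ?_, ?_⟩
  · intro p v hv
    have hv' := Hom.lin_mem ((unit k j).app M) hv
    change q v ∈ (P k j).deg (p + -d)
    have := tensorEval_mem j M f' hf' hv'
    rwa [show p + 1 - (1 + d) = p + -d by omega] at this
  · refine hom_ext fun a => ?_
    have ha : (a : leftIdeal k j).1 * e j = (a : leftIdeal k j).1 := Subtype.prop
      (p := fun a => a * e j = a) a
    change q ((a : leftIdeal k j).1 • m0) = a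
    rw [map_smul, hqm, ← map_smul, smul_eq_mul, ha]
    exact toLeftIdeal_coe j a

lemma exists_complement {C : Type*} [Category C] [Preadditive C] [IsIdempotentComplete C]
    {N M : C} (s : N ⟶ M) (p : M ⟶ N) (hs : s ≫ p = 𝟙 N) :
    ∃ (L : C) (i : L ⟶ M) (q : M ⟶ L), i ≫ q = 𝟙 L ∧ p ≫ s + q ≫ i = 𝟙 M := by
  obtain ⟨L, i, q, h1, h2⟩ := IsIdempotentComplete.idempotents_split M (𝟙 M - p ≫ s) (by
    simp [Preadditive.sub_comp, Preadditive.comp_sub, reassoc_of% hs])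
  exact ⟨L, i, q, h1, by rw [h2]; abel⟩

lemma nonempty_iso_biproduct_succ {C : Type*} [Category C] [Preadditive C]
    [HasFiniteBiproducts C] {N M L : C} {s : N ⟶ M} {p : M ⟶ N} (hs : s ≫ p = 𝟙 N) {i : L ⟶ M}
    {q : M ⟶ L} (hi : i ≫ q = 𝟙 L) (h : p ≫ s + q ≫ i = 𝟙 M) {r : ℕ} (f : Fin (r + 1) → C)
    (e0 : N ≅ f 0) (e1 : L ≅ ⨁ fun t : Fin r => f t.succ) : Nonempty (M ≅ ⨁ f) := by
  obtain ⟨h1, h2⟩ := comp_eq_zero_of_complement hs hi h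
  have tot : biproduct.π f 0 ≫ biproduct.ι f 0 +
      ∑ t : Fin r, biproduct.π f t.succ ≫ biproduct.ι f t.succ = 𝟙 _ := by
    rw [← biproduct.total, Fin.sum_univ_succ]
  refine ⟨⟨p ≫ e0.hom ≫ biproduct.ι f 0 +
      q ≫ e1.hom ≫ biproduct.desc fun t => biproduct.ι f t.succ,
    biproduct.π f 0 ≫ e0.inv ≫ s +
      (biproduct.lift fun t : Fin r => biproduct.π f t.succ) ≫ e1.inv ≫ i, ?_, ?_⟩⟩
  · have a1 : biproduct.ι f 0 ≫ biproduct.lift (fun t : Fin r => biproduct.π f t.succ) = 0 := by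
      refine biproduct.hom_ext _ _ fun t => ?_
      rw [Category.assoc, biproduct.lift_π, biproduct.ι_π_ne _ (Fin.succ_ne_zero t).symm, zero_comp]
    have a2 : biproduct.desc (fun t : Fin r => biproduct.ι f t.succ) ≫ biproduct.π f 0 = 0 := by
      refine biproduct.hom_ext' _ _ fun t => ?_
      rw [biproduct.ι_desc_assoc, biproduct.ι_π_ne _ (Fin.succ_ne_zero t), comp_zero]
    have a3 : biproduct.desc (fun t : Fin r => biproduct.ι f t.succ) ≫
        biproduct.lift (fun t : Fin r => biproduct.π f t.succ) = 𝟙 _ := by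
      refine biproduct.hom_ext' _ _ fun t => biproduct.hom_ext _ _ fun t' => ?_
      rw [biproduct.ι_desc_assoc, Category.assoc, biproduct.lift_π, Category.comp_id]
      by_cases ht : t = t'
      · subst ht; rw [biproduct.ι_π_self, biproduct.ι_π_self]
      · rw [biproduct.ι_π_ne _ ht, biproduct.ι_π_ne _ (fun h => ht (Fin.succ_injective _ h))]
    simp only [Preadditive.add_comp, Preadditive.comp_add, Category.assoc, reassoc_of% a1,
      reassoc_of% a2, reassoc_of% a3, zero_comp, comp_zero, add_zero, zero_add,
      biproduct.ι_π_self_assoc, Iso.hom_inv_id_assoc, h]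
  · rw [← tot]
    simp only [Preadditive.add_comp, Preadditive.comp_add, Category.assoc, reassoc_of% h1,
      reassoc_of% h2, reassoc_of% hs, reassoc_of% hi, zero_comp, comp_zero, add_zero, zero_add,
      Iso.inv_hom_id_assoc, biproduct.lift_desc]

/-- Induction on the dimension over k: as long as M ≠ 0 a copy of some Pᵢ⟨l⟩ splits off, and it has
positive dimension because it contains zᵢ ≠ 0. -/
lemma exists_iso_biproduct (M : GrProj k n) : ∃ (r : ℕ) (i : Fin r → Fin n) (l : Fin r → ℤ),
    Nonempty (M ≅ ⨁ fun s => (P k (i s)).shift (l s)) := by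
  induction hd : Module.finrank k M using Nat.strong_induction_on generalizing M with
  | h d ih =>
    by_cases hM : IsZero M
    · refine ⟨0, Fin.elim0, Fin.elim0, ⟨hM.iso ?_⟩⟩
      rw [IsZero.iff_id_eq_zero]
      exact biproduct.hom_ext _ _ fun s => s.elim0
    · obtain ⟨i, l, s, p, hs⟩ := exists_split_P M hM
      obtain ⟨L, j, q, hj, h⟩ := exists_complement s p hs
      have hP : 0 < Module.finrank k ((P k i).shift l) := by
        have : Nontrivial ((P k i).shift l) := ⟨toLeftIdeal i (z i), 0, fun h => by
          have := congrArg (fun a : leftIdeal k i => (a : ZigzagAlgebra k n).loop i) h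
          change (z i * e i : ZigzagAlgebra k n).loop i = 0 at this
          simp [z_mul_e, z_loop] at this⟩
        exact Module.finrank_pos
      have := finrank_eq_add s p j q hs hj h
      obtain ⟨r, i', l', ⟨e'⟩⟩ := ih _ (by omega) L rfl
      exact ⟨r + 1, Fin.cons i i', Fin.cons l l',
        nonempty_iso_biproduct_succ hs hj h _ (Iso.refl _) e'⟩

end GrProj
end Zigzag

/-! ### The baric condition as a condition on internal degrees -/

namespace Zigzag
open ZigzagAlgebra GrProj

variable {k : Type u} [Field k] {n : ℕ}

/-- `M` is concentrated in the degrees in which sums of modules `Pᵢ⟨l⟩`, `a ≤ l ≤ b`, live. -/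
def SupportedIn (a b : ℤ) (M : GrProj k n) : Prop :=
  ∀ d, d < -b ∨ -a + 1 < d → ∀ m ∈ M.deg d, m = 0

lemma SupportedIn.of_mono {a b : ℤ} {M N : GrProj k n} (h : SupportedIn a b M) (s : N ⟶ M)
    (p : M ⟶ N) (hs : s ≫ p = 𝟙 N) : SupportedIn a b N := by
  intro d hd m hm
  have := congrArg (fun f => Hom.lin f m) hs
  simp only [lin_comp, lin_id, LinearMap.comp_apply, LinearMap.id_apply] at this
  rw [← this, h d hd _ (Hom.lin_mem s hm), map_zero]

lemma P_deg_eq_zero (i : Fin n) {d : ℤ} (hd : d ≠ 0) (hd' : d ≠ 1) {m : P k i}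
    (hm : m ∈ (P k i).deg d) : m = 0 := by
  obtain ⟨h1, h2, h3⟩ : (leftIdeal k i).subtype m ∈ homogeneous k n d := hm
  refine Subtype.ext (ZigzagAlgebra.ext (h1 hd) (fun c => h2 c ?_) (h3 hd'))
  rcases c.deg_eq with h | h <;> rw [h] <;> omega

/-- Pᵢ⟨l⟩ has eᵢ in degree -l, zᵢ in degree 1 - l, and nothing outside these two degrees.
Conversely, in any decomposition of M the summands inherit the bounds on degrees, and eᵢ and zᵢ turn
these bounds into l ≤ b and a ≤ l. -/
lemma isSumOfShifts_iff {a b : ℤ} {M : GrProj k n} : IsSumOfShifts a b M ↔ SupportedIn a b M := by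
  constructor
  · rintro ⟨r, i, l, hl, ⟨f⟩⟩ d hd m hm
    have tot : (𝟙 M : M ⟶ M) = ∑ s, (f.hom ≫ biproduct.π (fun s => (P k (i s)).shift (l s)) s) ≫
      (biproduct.ι (fun s => (P k (i s)).shift (l s)) s ≫ f.inv) := by
      have := congrArg (fun g => f.hom ≫ g ≫ f.inv)
        (biproduct.total (f := fun s => (P k (i s)).shift (l s)))
      simp only [Preadditive.comp_sum, Preadditive.sum_comp, Category.id_comp, f.hom_inv_id] at this
      simpa only [Category.assoc] using this.symm
    have h0 : ∀ s, Hom.lin (f.hom ≫ biproduct.π (fun s => (P k (i s)).shift (l s)) s) m = 0 :=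
        fun s => by
      have := Hom.lin_mem (f.hom ≫ biproduct.π (fun s => (P k (i s)).shift (l s)) s) hm
      have hs := hl s
      exact P_deg_eq_zero (i s) (d := d + l s) (by omega) (by omega) this
    have lin_sum : ∀ g : Fin r → (M ⟶ M), Hom.lin (∑ s, g s) m = ∑ s, Hom.lin (g s) m := fun g =>
      map_sum (⟨⟨fun f => Hom.lin f m, rfl⟩, fun _ _ => rfl⟩ : (M ⟶ M) →+ M) _ _
    have := congrArg (fun f => Hom.lin f m) tot
    simp only [lin_id, LinearMap.id_apply, lin_sum] at this
    rw [this]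
    refine Finset.sum_eq_zero fun s _ => ?_
    rw [lin_comp, LinearMap.comp_apply, h0, map_zero]
  · intro h
    obtain ⟨r, i, l, ⟨f⟩⟩ := exists_iso_biproduct M
    refine ⟨r, i, l, fun s => ?_, ⟨f⟩⟩
    have hs : SupportedIn a b ((P k (i s)).shift (l s)) :=
      h.of_mono (biproduct.ι (fun s => (P k (i s)).shift (l s)) s ≫ f.inv)
        (f.hom ≫ biproduct.π (fun s => (P k (i s)).shift (l s)) s) (by simp)
    constructor
    · by_contra! hc
      have := hs (1 - l s) (by omega) (toLeftIdeal (i s) (z (i s))) (by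
        change _ ∈ (P k (i s)).deg _
        rw [sub_add_cancel]
        exact toLeftIdeal_mem (z_mem _))
      have := congrArg (fun a : leftIdeal k (i s) => (a : ZigzagAlgebra k n).loop (i s)) this
      change (z (i s) * e (i s) : ZigzagAlgebra k n).loop (i s) = 0 at this
      simp [z_mul_e, z_loop] at this
    · by_contra! hc
      have := hs (- l s) (by omega) (toLeftIdeal (i s) (e (i s))) (by
        change _ ∈ (P k (i s)).deg _
        rw [neg_add_cancel]
        exact toLeftIdeal_mem (e_mem _))
      have := congrArg (fun a : leftIdeal k (i s) => (a : ZigzagAlgebra k n).idem (i s)) this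
      change (e (i s) * e (i s) : ZigzagAlgebra k n).idem (i s) = 0 at this
      simp [e_idem] at this

/-- Contractible summands are split off one after the other; each lowers the total dimension of the
complex, and complements inherit the bounds on degrees. -/
lemma exists_isMinimal {a b : ℤ} (Y : CochainComplex (GrProj k n) ℤ) (hY : IsBounded Y)
    (h : ∀ m, SupportedIn a b (Y.X m)) :
    ∃ Z : CochainComplex (GrProj k n) ℤ, IsBounded Z ∧ IsMinimal Z ∧
      Nonempty ((HomotopyCategory.quotient _ _).obj Z ≅
        (HomotopyCategory.quotient _ (ComplexShape.up ℤ)).obj Y) ∧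
      ∀ m, SupportedIn a b (Z.X m) := by
  induction hd : ∑ᶠ m, Module.finrank k (Y.X m) using Nat.strong_induction_on generalizing Y with
  | h d ih =>
    by_cases hmin : IsMinimal Y
    · exact ⟨Y, hY, hmin, ⟨Iso.refl _⟩, h⟩
    · unfold IsMinimal at hmin
      push Not at hmin
      obtain ⟨Z, s, p, hs, ⟨hZ⟩, hZ0⟩ := hmin
      obtain ⟨L, j, q, hj, htot⟩ := exists_complement s p hs
      have hs' : ∀ m, s.f m ≫ p.f m = 𝟙 _ := fun m => by
        rw [← HomologicalComplex.comp_f, hs, HomologicalComplex.id_f]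
      have hj' : ∀ m, j.f m ≫ q.f m = 𝟙 _ := fun m => by
        rw [← HomologicalComplex.comp_f, hj, HomologicalComplex.id_f]
      have htot' : ∀ m, p.f m ≫ s.f m + q.f m ≫ j.f m = 𝟙 _ := fun m => by
        rw [← HomologicalComplex.comp_f, ← HomologicalComplex.comp_f,
          ← HomologicalComplex.add_f_apply, htot, HomologicalComplex.id_f]
      have hdim := fun m => finrank_eq_add _ _ _ _ (hs' m) (hj' m) (htot' m)
      obtain ⟨m0, hm0⟩ : ∃ m, ¬ IsZero (Z.X m) := by
        by_contra! hc
        apply hZ0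
        rw [IsZero.iff_id_eq_zero]
        ext m : 1
        exact (hc m).eq_of_src _ _
      have hpos : 0 < Module.finrank k (Z.X m0) := by
        have : Nontrivial (Z.X m0) := by
          rw [isZero_iff_subsingleton] at hm0
          exact not_subsingleton_iff_nontrivial.mp hm0
        exact Module.finrank_pos
      have hfin : (Function.support fun m => Module.finrank k (Y.X m)).Finite := by
        obtain ⟨a', b', hab⟩ := hY
        refine (Set.finite_Icc a' b').subset fun m hm => ?_
        by_contra hc
        rw [Set.mem_Icc] at hc
        apply hm
        have := isZero_iff_subsingleton.mp (hab m (by omega))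
        exact Module.finrank_zero_of_subsingleton
      have hlt : ∑ᶠ m, Module.finrank k (L.X m) < d := by
        rw [← hd]
        have hsub : ∀ (W : ℤ → ℕ), (∀ m, W m ≤ Module.finrank k (Y.X m)) →
            ∑ᶠ m, W m = ∑ m ∈ hfin.toFinset, W m := fun W hW =>
          finsum_eq_sum_of_support_subset _ fun m hm => by
            have := hW m
            simp only [Function.mem_support, Set.Finite.coe_toFinset] at hm ⊢
            omega
        rw [hsub _ fun m => (hdim m).symm ▸ Nat.le_add_left _ _, hsub _ fun m => le_rfl]
        refine Finset.sum_lt_sum (fun m _ => (hdim m).symm ▸ Nat.le_add_left _ _) ⟨m0, ?_, ?_⟩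
        · have := hdim m0
          simp only [Set.Finite.mem_toFinset, Function.mem_support]
          omega
        · have := hdim m0
          omega
      have hLb : IsBounded L := by
        obtain ⟨a', b', hab⟩ := hY
        refine ⟨a', b', fun m hm => ?_⟩
        rw [IsZero.iff_id_eq_zero, ← hj' m, (hab m hm).eq_of_tgt (j.f m) 0, zero_comp]
      obtain ⟨W, hW, hWm, ⟨f⟩, hW'⟩ := ih _ hlt L hLb
        (fun m => (h m).of_mono (j.f m) (q.f m) (hj' m)) rfl
      refine ⟨W, hW, hWm, ⟨f ≪≫ ?_⟩, hW'⟩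
      refine ⟨(HomotopyCategory.quotient _ _).map j, (HomotopyCategory.quotient _ _).map q, ?_, ?_⟩
      · rw [← Functor.map_comp, hj, CategoryTheory.Functor.map_id]
      · have h0 : (HomotopyCategory.quotient (GrProj k n) (ComplexShape.up ℤ)).map (𝟙 Z) = 0 := by
          rw [HomotopyCategory.eq_of_homotopy _ _ hZ, Functor.map_zero]
        have h1 : (HomotopyCategory.quotient (GrProj k n) (ComplexShape.up ℤ)).map (p ≫ s) = 0 := by
          rw [Functor.map_comp, ← Category.id_comp s, Functor.map_comp, h0, zero_comp, comp_zero]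
        rw [← Functor.map_comp, ← CategoryTheory.Functor.map_id, ← htot, Functor.map_add, h1,
          zero_add]

/-- Minimality can be dropped: passing to a minimal complex only shrinks the range of degrees. After
this no further use is made of minimal complexes or of explicit sums of modules Pᵢ⟨l⟩. -/
lemma baric_iff {a b : ℤ} {Y : D k n} : baric a b Y ↔
    ∃ Z : CochainComplex (GrProj k n) ℤ, IsBounded Z ∧
      Nonempty ((HomotopyCategory.quotient _ _).obj Z ≅ Y.obj) ∧ ∀ m, SupportedIn a b (Z.X m) := by
  constructor
  · rintro ⟨Z, h1, -, h3, h4⟩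
    exact ⟨Z, h1, h3, fun m => isSumOfShifts_iff.mp (h4 m)⟩
  · rintro ⟨Z, h1, ⟨f⟩, h3⟩
    obtain ⟨W, g1, g2, ⟨g⟩, g4⟩ := exists_isMinimal Z h1 h3
    exact ⟨W, g1, g2, ⟨g ≪≫ f⟩, fun m => isSumOfShifts_iff.mpr (g4 m)⟩

end Zigzag

/-! ### A homogeneous basis of the zigzag algebra -/

namespace Zigzag

/-- The degree of a basis element. -/
def dg (δ : Bool) : ℤ := if δ then 1 else 0

@[simp] lemma dg_true : dg true = 1 := rfl
@[simp] lemma dg_false : dg false = 0 := rfl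

/-- The arrow `l ⟶ j` of degree `dg δ`. -/
def Arrow.between {n : ℕ} (l j : Fin n) (h : l ≠ j) (δ : Bool) : Arrow n :=
  (if decide (l < j) = δ then Label.x else Label.y, ⟨(l, j), h⟩)

namespace Arrow
variable {n : ℕ}

@[simp] lemma between_src (l j : Fin n) (h : l ≠ j) (δ : Bool) : (between l j h δ).src = l := rfl
@[simp] lemma between_tgt (l j : Fin n) (h : l ≠ j) (δ : Bool) : (between l j h δ).tgt = j := rfl

lemma between_deg (l j : Fin n) (h : l ≠ j) (δ : Bool) : (between l j h δ).deg = dg δ := by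
  unfold deg
  simp only [between, label, src, tgt]
  rcases lt_or_gt_of_ne h with h1 | h1 <;> cases δ <;> simp [h1, not_lt.mpr h1.le]

/-- The two colours of arrows from one vertex to another have different degrees, so the ends and the
degree determine the arrow. Hence every e_l A eⱼ has one basis element in degree 0 and one in degree
1, for l = j as well as for l ≠ j. -/
lemma eq_between (c : Arrow n) {δ : Bool} (h : c.deg = dg δ) :
    c = between c.src c.tgt c.src_ne_tgt δ := by
  obtain ⟨a, ⟨⟨l, j⟩, hlj⟩⟩ := c
  unfold deg at h
  simp only [label, src, tgt] at h
  rcases lt_or_gt_of_ne hlj with h1 | h1 <;> cases δ <;> cases a <;>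
    simp_all [between, src, tgt, not_lt.mpr h1.le]

/-- The degrees of c and c* add up to 1. -/
lemma between_star (l j : Fin n) (h : l ≠ j) (δ : Bool) :
    (between l j h δ).star = between j l h.symm (!δ) := by
  refine eq_between _ (δ := !δ) ?_
  have := (between l j h δ).deg_add_deg_star
  rw [between_deg] at this
  cases δ <;> simp_all [dg]

lemma between_inj {l j l' j' : Fin n} {h : l ≠ j} {h' : l' ≠ j'} {δ δ' : Bool}
    (e : between l j h δ = between l' j' h' δ') : l = l' ∧ j = j' ∧ δ = δ' := by
  refine ⟨congrArg src e, congrArg tgt e, ?_⟩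
  have := congrArg deg e
  rw [between_deg, between_deg] at this
  cases δ <;> cases δ' <;> simp_all [dg]

end Arrow

namespace ZigzagAlgebra
variable {k : Type u} [Field k] {n : ℕ}

/-- The basis element of `e_l A e_j` of degree `dg δ`. -/
def bas (k : Type u) [Field k] {n : ℕ} (l j : Fin n) (δ : Bool) : ZigzagAlgebra k n :=
  if h : l = j then (if δ then z j else e j) else ofArrow (Arrow.between l j h δ)

lemma bas_self_false (j : Fin n) : bas k j j false = e j := by simp [bas]
lemma bas_self_true (j : Fin n) : bas k j j true = z j := by simp [bas]
lemma bas_ne {l j : Fin n} (h : l ≠ j) (δ : Bool) :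
    bas k l j δ = ofArrow (Arrow.between l j h δ) := by simp [bas, h]

/-- The coefficient of `bas k l j δ`. -/
def coef (k : Type u) [Field k] {n : ℕ} (l j : Fin n) (δ : Bool) : ZigzagAlgebra k n →ₗ[k] k where
  toFun a := if h : l = j then (if δ then a.loop j else a.idem j) else a.arr (Arrow.between l j h δ)
  map_add' a b := by split_ifs <;> rfl
  map_smul' a b := by split_ifs <;> rfl

lemma coef_self_false (j : Fin n) (a : ZigzagAlgebra k n) : coef k j j false a = a.idem j := by
  simp [coef]
lemma coef_self_true (j : Fin n) (a : ZigzagAlgebra k n) : coef k j j true a = a.loop j := by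
  simp [coef]
lemma coef_ne {l j : Fin n} (h : l ≠ j) (δ : Bool) (a : ZigzagAlgebra k n) :
    coef k l j δ a = a.arr (Arrow.between l j h δ) := by simp [coef, h]

lemma bas_mem (l j : Fin n) (δ : Bool) : bas k l j δ ∈ homogeneous k n (dg δ) := by
  by_cases h : l = j
  · subst h
    cases δ
    · rw [bas_self_false]; exact e_mem l
    · rw [bas_self_true]; exact z_mem l
  · rw [bas_ne h, ← Arrow.between_deg l j h δ]
    exact ofArrow_mem _

lemma bas_mul_e (l j : Fin n) (δ : Bool) : bas k l j δ * e j = bas k l j δ := by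
  by_cases h : l = j
  · subst h
    cases δ
    · rw [bas_self_false, e_mul_e, if_pos rfl]
    · rw [bas_self_true, z_mul_e, if_pos rfl]
  · rw [bas_ne h, ofArrow_mul_e, Arrow.between_tgt, if_pos rfl]

lemma e_mul_bas (i l j : Fin n) (δ : Bool) :
    e i * bas k l j δ = if i = l then bas k l j δ else 0 := by
  by_cases h : l = j
  · subst h
    cases δ
    · rw [bas_self_false, e_mul_e]; split_ifs with h <;> simp [h]
    · rw [bas_self_true, e_mul_z]; split_ifs with h <;> simp [h]
  · rw [bas_ne h, e_mul_ofArrow]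
    simp [eq_comm]

lemma coef_bas (l l' j : Fin n) (δ δ' : Bool) :
    coef k l j δ (bas k l' j δ') = if l = l' ∧ δ = δ' then 1 else 0 := by
  by_cases h : l = j
  · subst h
    by_cases h' : l' = l
    · subst h'
      cases δ <;> cases δ' <;>
        simp [coef_self_false, coef_self_true, bas_self_false, bas_self_true, e_idem, z_loop]
    · cases δ <;> simp [coef_self_false, coef_self_true, bas_ne h', Ne.symm h']
  · by_cases h' : l' = j
    · subst h'
      cases δ' <;> simp [coef_ne h, bas_self_false, bas_self_true, h]
    · rw [coef_ne h, bas_ne h', ofArrow_arr]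
      by_cases h2 : l = l' ∧ δ = δ'
      · obtain ⟨rfl, rfl⟩ := h2
        simp
      · rw [if_neg h2, if_neg]
        intro h3
        have := Arrow.between_inj h3
        exact h2 ⟨this.1, this.2.2⟩

lemma coef_eq_zero (l j : Fin n) (δ : Bool) {p : ℤ} (hp : p ≠ dg δ) {a : ZigzagAlgebra k n}
    (ha : a ∈ homogeneous k n p) : coef k l j δ a = 0 := by
  obtain ⟨h1, h2, h3⟩ := ha
  by_cases h : l = j
  · subst h
    cases δ
    · rw [coef_self_false, h1 hp]
    · rw [coef_self_true, h3 hp]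
  · rw [coef_ne h, h2]
    rw [Arrow.between_deg]
    exact hp.symm

lemma eq_sum_bas (j : Fin n) {a : ZigzagAlgebra k n} (ha : a * e j = a) :
    a = ∑ l, ∑ δ, coef k l j δ a • bas k l j δ := by
  have hi : ∀ i, i ≠ j → a.idem i = 0 := fun i hi => by
    rw [← ha]; simp [e_idem, hi]
  have hl : ∀ i, i ≠ j → a.loop i = 0 := fun i hi => by
    rw [← ha]; simp [e_idem, hi]
  have hc : ∀ c, c.tgt ≠ j → a.arr c = 0 := fun c hi => by
    rw [← ha]; simp [e_idem, hi]
  rw [← Finset.add_sum_erase _ _ (Finset.mem_univ j)]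
  have s1 : ∀ (s : Finset (Fin n)) (v : Fin n → ZigzagAlgebra k n) i,
      (∑ l ∈ s, v l).idem i = ∑ l ∈ s, (v l).idem i := fun s v i =>
    map_sum (⟨⟨fun a => a.idem i, rfl⟩, fun _ _ => rfl⟩ : ZigzagAlgebra k n →+ k) _ _
  have s2 : ∀ (s : Finset (Fin n)) (v : Fin n → ZigzagAlgebra k n) i,
      (∑ l ∈ s, v l).arr i = ∑ l ∈ s, (v l).arr i := fun s v i =>
    map_sum (⟨⟨fun a => a.arr i, rfl⟩, fun _ _ => rfl⟩ : ZigzagAlgebra k n →+ k) _ _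
  have s3 : ∀ (s : Finset (Fin n)) (v : Fin n → ZigzagAlgebra k n) i,
      (∑ l ∈ s, v l).loop i = ∑ l ∈ s, (v l).loop i := fun s v i =>
    map_sum (⟨⟨fun a => a.loop i, rfl⟩, fun _ _ => rfl⟩ : ZigzagAlgebra k n →+ k) _ _
  have hne : ∀ l ∈ Finset.univ.erase j, l ≠ j := fun l hl => by simpa using hl
  ext i
  · simp only [Fintype.sum_bool, add_idem, s1, smul_idem, coef_self_false, coef_self_true,
      bas_self_false, bas_self_true, z_idem, e_idem]
    rw [Finset.sum_eq_zero fun l hl => by rw [bas_ne (hne l hl), bas_ne (hne l hl)]; simp]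
    by_cases h : i = j
    · simp [h]
    · simp [h, hi i h]
  · simp only [Fintype.sum_bool, add_arr, s2, smul_arr, coef_self_false, coef_self_true,
      bas_self_false, bas_self_true, z_arr, e_arr, mul_zero, add_zero, zero_add]
    by_cases h : i.tgt = j
    · subst h
      rw [Finset.sum_eq_single_of_mem i.src (by simpa using i.src_ne_tgt)]
      · rcases i.deg_eq with h0 | h0
        · have h1 := i.eq_between (δ := false) h0
          rw [coef_ne i.src_ne_tgt, coef_ne i.src_ne_tgt, bas_ne i.src_ne_tgt,
            bas_ne i.src_ne_tgt, ← h1, ofArrow_arr, ofArrow_arr, if_pos rfl, if_neg, mul_zero,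
            zero_add, mul_one]
          intro h2
          rw [h1] at h2
          exact absurd (Arrow.between_inj h2).2.2 (by simp)
        · have h1 := i.eq_between (δ := true) h0
          rw [coef_ne i.src_ne_tgt, coef_ne i.src_ne_tgt, bas_ne i.src_ne_tgt,
            bas_ne i.src_ne_tgt, ← h1, ofArrow_arr, ofArrow_arr, if_pos rfl, if_neg, mul_zero,
            add_zero, mul_one]
          intro h2
          rw [h1] at h2
          exact absurd (Arrow.between_inj h2).2.2 (by simp)
      · intro l hl hli
        rw [bas_ne (hne l hl), bas_ne (hne l hl), ofArrow_arr, ofArrow_arr, if_neg, if_neg]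
        · simp
        · exact fun h => hli (congrArg Arrow.src h).symm
        · exact fun h => hli (congrArg Arrow.src h).symm
    · rw [hc i h, Finset.sum_eq_zero]
      intro l hl
      rw [bas_ne (hne l hl), bas_ne (hne l hl), ofArrow_arr, ofArrow_arr, if_neg, if_neg]
      · simp
      · exact fun h' => h (congrArg Arrow.tgt h')
      · exact fun h' => h (congrArg Arrow.tgt h')
  · simp only [Fintype.sum_bool, add_loop, s3, smul_loop, coef_self_false, coef_self_true,
      bas_self_false, bas_self_true, z_loop, e_loop]
    rw [Finset.sum_eq_zero fun l hl => by rw [bas_ne (hne l hl), bas_ne (hne l hl)]; simp]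
    by_cases h : i = j
    · simp [h]
    · simp [h, hl i h]

/-- A nonzero product of two arrows is a loop and has degree 1, so two arrows of degree 0 never have
a nonzero product; only right multiplication by an idempotent survives. All the socle and top
properties below rest on this. -/
lemma bas_false_mul_bas_false {p q : Fin n} (h : p ≠ q) (l j : Fin n) :
    bas k p q false * bas k l j false = if q = l ∧ l = j then bas k p j false else 0 := by
  by_cases hl : l = j
  · subst hl
    rw [bas_self_false]
    by_cases hq : q = l
    · subst hq
      rw [bas_mul_e, if_pos ⟨rfl, rfl⟩]
    · rw [bas_ne h, ofArrow_mul_e, Arrow.between_tgt, if_neg hq, if_neg (by tauto)]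
  · rw [bas_ne h, bas_ne hl, ofArrow_mul_ofArrow, Arrow.between_star, if_neg, if_neg (by tauto)]
    intro h
    exact absurd (Arrow.between_inj h).2.2 (by simp)

/-- In degree 1 only c c* = z survives, since an arrow times a loop vanishes. -/
lemma bas_false_mul_bas_true {p q : Fin n} (h : p ≠ q) (l j : Fin n) :
    bas k p q false * bas k l j true = if q = l ∧ p = j then bas k j j true else 0 := by
  by_cases hl : l = j
  · subst hl
    rw [bas_self_true, bas_ne h, ofArrow_mul_z, if_neg]
    rintro ⟨rfl, rfl⟩
    exact h rfl
  · rw [bas_ne h, bas_ne hl, ofArrow_mul_ofArrow, Arrow.between_star, bas_self_true]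
    by_cases h2 : q = l ∧ p = j
    · obtain ⟨rfl, rfl⟩ := h2
      rw [if_pos (by simp), if_pos ⟨rfl, rfl⟩, Arrow.between_src]
    · rw [if_neg, if_neg h2]
      intro h3
      have := Arrow.between_inj h3
      exact h2 ⟨this.1.symm, this.2.1.symm⟩

end ZigzagAlgebra
end Zigzag

/-! ### Coordinates on A eⱼ ⊗ eⱼ M -/

namespace Zigzag
namespace GrProj
open ZigzagAlgebra

variable {k : Type u} [Field k] {n : ℕ} {j : Fin n}

/-- The coordinate of an element of `A eⱼ ⊗ eⱼ M` at the basis element `bas k l j δ`. -/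
def co (M : GrProj k n) (l : Fin n) (δ : Bool) : tensor j M →ₗ[k] M :=
  (idemPart j M).subtype ∘ₗ (TensorProduct.lid k (idemPart j M)).toLinearMap ∘ₗ
    LinearMap.rTensor (idemPart j M) (coef k l j δ ∘ₗ (leftIdeal k j).subtype.restrictScalars k)

/-- The pure tensor `bas k l j δ ⊗ eⱼ m`. -/
def tm (M : GrProj k n) (l : Fin n) (δ : Bool) : M →ₗ[k] tensor j M :=
  TensorProduct.mk k (leftIdeal k j) (idemPart j M) (toLeftIdeal j (bas k l j δ)) ∘ₗ toIdemPart j M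

variable {M N : GrProj k n}

/-- The map `A eⱼ ⊗ eⱼ M ⟶ A eⱼ ⊗ eⱼ N` induced by a morphism, as a morphism. -/
abbrev tensorMap (j : Fin n) (f : M ⟶ N) : tensor j M ⟶ tensor j N := (tensorFunctor k j).map f

/-- The counit as a morphism. -/
abbrev counitHom (j : Fin n) (M : GrProj k n) : tensor j M ⟶ M := (counit k j).app M

/-- The unit as a morphism. -/
abbrev unitHom (j : Fin n) (M : GrProj k n) : M ⟶ (tensor j M).shift 1 := (unit k j).app M

/-- The linear map underlying the unit. -/
abbrev unitLin (j : Fin n) (M : GrProj k n) : M →ₗ[ZigzagAlgebra k n] tensor j M :=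
  Hom.lin (N := (tensor j M).shift 1) (unitHom j M)

lemma co_tmul (l : Fin n) (δ : Bool) (a : leftIdeal k j) (m : idemPart j M) :
    co M l δ (a ⊗ₜ m : leftIdeal k j ⊗[k] idemPart j M) =
      coef k l j δ (a : ZigzagAlgebra k n) • (m : M) := rfl

lemma tensor_induction {p : tensor j M → Prop} (h0 : p 0) (hadd : ∀ u v, p u → p v → p (u + v))
    (ht : ∀ (a : leftIdeal k j) (m : idemPart j M),
      p (a ⊗ₜ m : leftIdeal k j ⊗[k] idemPart j M)) (u : tensor j M) : p u :=
  TensorProduct.induction_on (motive := p) u h0 ht hadd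

/-- Expansion of an element of the tensor product in coordinates. -/
lemma tensor_eq_sum (u : tensor j M) : u = ∑ l, ∑ δ, tm M l δ (co M l δ u) := by
  induction u using tensor_induction with
  | h0 => simp
  | hadd u v hu hv =>
    conv_lhs => rw [hu, hv]
    simp only [map_add, Finset.sum_add_distrib]
  | ht a m =>
    have h : ∀ l δ, tm M l δ (co M l δ (a ⊗ₜ m : leftIdeal k j ⊗[k] idemPart j M)) =
        (((coef k l j δ (a : ZigzagAlgebra k n) • toLeftIdeal j (bas k l j δ)) ⊗ₜ m :
          leftIdeal k j ⊗[k] idemPart j M)) := fun l δ => by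
      rw [co_tmul, map_smul, ← TensorProduct.smul_tmul']
      change _ • (toLeftIdeal j (bas k l j δ) ⊗ₜ toIdemPart j M m) = _
      rw [toIdemPart_coe]
      rfl
    simp only [h]
    have h2 := congrArg (toLeftIdeal j) (eq_sum_bas j (a := (a : ZigzagAlgebra k n)) a.2)
    rw [toLeftIdeal_coe, map_sum] at h2
    simp only [map_sum, LinearMap.map_smul_of_tower] at h2
    conv_lhs => rw [h2]
    rw [TensorProduct.sum_tmul]
    exact Finset.sum_congr rfl fun l _ => TensorProduct.sum_tmul _ _ _

lemma tensor_ext {u v : tensor j M} (h : ∀ l δ, co M l δ u = co M l δ v) : u = v := by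
  rw [tensor_eq_sum u, tensor_eq_sum v]
  simp only [h]

lemma co_tm (l l' : Fin n) (δ δ' : Bool) (m : M) : co (j := j) M l δ (tm M l' δ' m) =
    if l = l' ∧ δ = δ' then (e j : ZigzagAlgebra k n) • m else 0 := by
  change coef k l j δ (bas k l' j δ' * e j) • (e j : ZigzagAlgebra k n) • m = _
  rw [bas_mul_e, coef_bas]
  split_ifs <;> simp

lemma e_smul_co (l : Fin n) (δ : Bool) (u : tensor j M) :
    (e j : ZigzagAlgebra k n) • co M l δ u = co M l δ u := by
  exact Subtype.prop (p := fun m => (e j : ZigzagAlgebra k n) • m = m)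
    ((TensorProduct.lid k (idemPart j M)).toLinearMap (LinearMap.rTensor (idemPart j M)
      (coef k l j δ ∘ₗ (leftIdeal k j).subtype.restrictScalars k) u))

lemma tensorFunctor_map_tm (f : M ⟶ N) (l : Fin n) (δ : Bool) (m : M) :
    Hom.lin (tensorMap j f) (tm M l δ m) = tm N l δ (Hom.lin f m) := by
  change toLeftIdeal j (bas k l j δ) ⊗ₜ idemPartMap j f (toIdemPart j M m) =
    toLeftIdeal j (bas k l j δ) ⊗ₜ toIdemPart j N (Hom.lin f m)
  congr 1
  exact Subtype.ext (map_smul (Hom.lin f) _ _)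

lemma co_tensorFunctor_map (f : M ⟶ N) (l : Fin n) (δ : Bool) (u : tensor j M) :
    co N l δ (Hom.lin (tensorMap j f) u) = Hom.lin f (co M l δ u) := by
  induction u using tensor_induction with
  | h0 => simp
  | hadd u v hu hv => simp only [map_add, hu, hv]
  | ht a m =>
    exact (LinearMap.map_smul_of_tower (Hom.lin f) (coef k l j δ (a : ZigzagAlgebra k n))
      (m : M)).symm

lemma tm_mem (l : Fin n) (δ : Bool) {m : M} {d : ℤ} (hm : m ∈ M.deg d) :
    tm (j := j) M l δ m ∈ (tensor j M).deg (dg δ + d) :=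
  tmul_mem_tensorDeg rfl (toLeftIdeal_mem (bas_mem l j δ)) (toIdemPart_mem hm)

lemma co_mem (l : Fin n) (δ : Bool) {u : tensor j M} {d : ℤ} (hu : u ∈ (tensor j M).deg d) :
    co M l δ u ∈ M.deg (d - dg δ) := by
  change u ∈ tensorDeg j M d at hu
  induction hu using Submodule.span_induction with
  | zero => exact (map_zero (co (j := j) M l δ)).symm ▸ Submodule.zero_mem _
  | add x y _ _ hx hy => exact (map_add (co (j := j) M l δ) x y).symm ▸ Submodule.add_mem _ hx hy
  | smul r x _ hx => exact (map_smul (co (j := j) M l δ) r x).symm ▸ Submodule.smul_mem _ r hx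
  | mem t ht =>
    obtain ⟨p', q, a, m, hd, ha, hm, rfl⟩ := ht
    rw [co_tmul]
    by_cases hp : p' = dg δ
    · rw [show d - dg δ = q by omega]
      exact Submodule.smul_mem _ _ hm
    · rw [coef_eq_zero l j δ hp ha, zero_smul]
      exact Submodule.zero_mem _

lemma smul_tm (a : ZigzagAlgebra k n) (l : Fin n) (δ : Bool) (m : M) :
    a • tm (j := j) M l δ m = (toLeftIdeal j (a * bas k l j δ) ⊗ₜ toIdemPart j M m :
      leftIdeal k j ⊗[k] idemPart j M) := by
  change (a • toLeftIdeal j (bas k l j δ)) ⊗ₜ toIdemPart j M m = _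
  rw [← map_smul, smul_eq_mul]

lemma e_smul_tm (i l : Fin n) (δ : Bool) (m : M) : (e i : ZigzagAlgebra k n) • tm (j := j) M l δ m =
    if i = l then tm M l δ m else 0 := by
  rw [smul_tm, e_mul_bas]
  split_ifs
  · rfl
  · rw [map_zero, TensorProduct.zero_tmul]; rfl

lemma bas_smul_tm_false {p q : Fin n} (h : p ≠ q) (l : Fin n) (m : M) :
    bas k p q false • tm (j := j) M l false m = if q = l ∧ l = j then tm M p false m else 0 := by
  rw [smul_tm, bas_false_mul_bas_false h]
  split_ifs
  · rfl
  · rw [map_zero, TensorProduct.zero_tmul]; rfl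

lemma bas_smul_tm_true {p q : Fin n} (h : p ≠ q) (l : Fin n) (m : M) :
    bas k p q false • tm (j := j) M l true m = if q = l ∧ p = j then tm M j true m else 0 := by
  rw [smul_tm, bas_false_mul_bas_true h]
  split_ifs
  · rfl
  · rw [map_zero, TensorProduct.zero_tmul]; rfl

lemma counit_tm (l : Fin n) (δ : Bool) (m : M) :
    Hom.lin (counitHom j M) (tm M l δ m) = bas k l j δ • m := by
  change (bas k l j δ * e j) • (e j : ZigzagAlgebra k n) • m = _
  rw [bas_mul_e, smul_smul, bas_mul_e]

lemma e_smul_bas_smul (l : Fin n) (δ : Bool) (m : M) :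
    (e l : ZigzagAlgebra k n) • bas k l j δ • m = bas k l j δ • m := by
  rw [smul_smul, e_mul_bas, if_pos rfl]

/-- The unit sends m to the sum of all `bas k l j δ` ⊗ `bas k j l (!δ)` m: the terms z ⊗ e, e ⊗ z
and c ⊗ c* are the same pairing of a basis with its dual basis, because passing from c to c*
exchanges the degrees 0 and 1. -/
lemma co_unit (l : Fin n) (δ : Bool) (m : M) :
    co M l δ (unitLin j M m) = bas k j l (!δ) • m := by
  have h1 : ∀ (x : ZigzagAlgebra k n) (y : M), co M l δ
      (toLeftIdeal j x ⊗ₜ toIdemPart j M y : leftIdeal k j ⊗[k] idemPart j M) =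
      coef k l j δ (x * e j) • (e j : ZigzagAlgebra k n) • y := fun _ _ => rfl
  change co M l δ (toLeftIdeal j (z j) ⊗ₜ toIdemPart j M m + toLeftIdeal j (e j) ⊗ₜ toIdemPart j M
      ((z j : ZigzagAlgebra k n) • m) + ∑ c : Arrow n, if c.tgt = j then
        toLeftIdeal j (ofArrow c) ⊗ₜ
        toIdemPart j M ((ofArrow c.star : ZigzagAlgebra k n) • m) else 0 :
      leftIdeal k j ⊗[k] idemPart j M) = _
  refine ((map_add (co (j := j) M l δ) _ _).trans
      (congrArg₂ _ ((map_add (co (j := j) M l δ) _ _).trans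
    (congrArg₂ _ (h1 _ _) (h1 _ _))) (map_sum (co (j := j) M l δ) _ _))).trans ?_
  rw [Finset.sum_congr rfl (g := fun c : Arrow n => if c.tgt = j then
    coef k l j δ (ofArrow c : ZigzagAlgebra k n) •
      (ofArrow c.star : ZigzagAlgebra k n) • m else 0) fun c _ => by
    split_ifs with h
    · refine (h1 _ _).trans ?_
      rw [ofArrow_mul_e, if_pos h, smul_smul (e j), e_mul_ofArrow, if_pos
        (show c.star.src = j from h)]
    · exact map_zero (co (j := j) M l δ)]
  rw [z_mul_e, if_pos rfl, e_mul_e, if_pos rfl, smul_smul (e j), e_mul_z, if_pos rfl]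
  by_cases hl : l = j
  · subst hl
    rw [Finset.sum_eq_zero]
    · cases δ <;> simp [coef_self_false, coef_self_true, bas_self_false, bas_self_true, e_idem,
        z_loop]
    · intro c _
      cases δ <;> simp [coef_self_false, coef_self_true]
  · rw [Finset.sum_eq_single (Arrow.between l j hl δ)]
    · simp [coef_ne hl, ofArrow_arr, bas_ne (Ne.symm hl), Arrow.between_star]
    · intro c _ hc
      simp [coef_ne hl, ofArrow_arr, Ne.symm hc]
    · intro h; exact absurd (Finset.mem_univ _) h

end GrProj
end Zigzag

/-! ### The complexes Σⱼ Y and Σⱼ⁻¹ Y as cones with explicit differentials -/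

namespace Zigzag
open ZigzagAlgebra GrProj

variable {k : Type u} [Field k] {n : ℕ}

/-- A presentation of `Y'` as the cone of the counit `A eⱼ ⊗ eⱼ Y ⟶ Y`. -/
structure InvCone (j : Fin n) (Y Y' : CochainComplex (GrProj k n) ℤ) where
  iu : ∀ s r, s + 1 = r → (tensor j (Y.X r) ⟶ Y'.X s)
  iy : ∀ s, Y.X s ⟶ Y'.X s
  pu : ∀ s r, s + 1 = r → (Y'.X s ⟶ tensor j (Y.X r))
  py : ∀ s, Y'.X s ⟶ Y.X s
  iu_pu : ∀ s r h, iu s r h ≫ pu s r h = 𝟙 _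
  iu_py : ∀ s r h, iu s r h ≫ py s = 0
  iy_pu : ∀ s r h, iy s ≫ pu s r h = 0
  iy_py : ∀ s, iy s ≫ py s = 𝟙 _
  total : ∀ s r h, pu s r h ≫ iu s r h + py s ≫ iy s = 𝟙 _
  iu_d : ∀ s r r' (h : s + 1 = r) (h' : r + 1 = r'), iu s r h ≫ Y'.d s r =
    -(tensorMap j (Y.d r r') ≫ iu r r' h') + counitHom j (Y.X r) ≫ iy r
  iy_d : ∀ s r, iy s ≫ Y'.d s r = Y.d s r ≫ iy r

/-- A presentation of `Y'` as the cone of the unit `Y ⟶ (A eⱼ ⊗ eⱼ Y)⟨1⟩` shifted by `[-1]`. -/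
structure UnitCone (j : Fin n) (Y Y' : CochainComplex (GrProj k n) ℤ) where
  iu : ∀ r s, r + 1 = s → ((tensor j (Y.X r)).shift 1 ⟶ Y'.X s)
  iy : ∀ s, Y.X s ⟶ Y'.X s
  pu : ∀ r s, r + 1 = s → (Y'.X s ⟶ (tensor j (Y.X r)).shift 1)
  py : ∀ s, Y'.X s ⟶ Y.X s
  iu_pu : ∀ r s h, iu r s h ≫ pu r s h = 𝟙 _
  iu_py : ∀ r s h, iu r s h ≫ py s = 0
  iy_pu : ∀ r s h, iy s ≫ pu r s h = 0
  iy_py : ∀ s, iy s ≫ py s = 𝟙 _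
  total : ∀ r s h, pu r s h ≫ iu r s h + py s ≫ iy s = 𝟙 _
  iu_d : ∀ r s s' (h : r + 1 = s) (h' : s + 1 = s'), iu r s h ≫ Y'.d s s' =
    -((GrProj.shiftFunctor k n 1).map (tensorMap j (Y.d r s)) ≫ iu s s' h')
  iy_d : ∀ s s' (h : s + 1 = s'), iy s ≫ Y'.d s s' =
    Y.d s s' ≫ iy s' - unitHom j (Y.X s) ≫ iu s s' h

open CochainComplex in
/-- The complex `sigmaInvComplex` is a cone of the counit. -/
noncomputable def invCone (j : Fin n) (Y : CochainComplex (GrProj k n) ℤ) :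
    InvCone j Y ((sigmaInvComplex k j).obj Y) :=
  let φ := (NatTrans.mapHomologicalComplex (counit k j) (ComplexShape.up ℤ)).app Y
  { iu := fun s r h => (mappingCone.inl φ).v r s (by omega)
    iy := fun s => (mappingCone.inr φ).f s
    pu := fun s r h => (mappingCone.fst φ).1.v s r h
    py := fun s => (mappingCone.snd φ).v s s (add_zero s)
    iu_pu := fun s r h => mappingCone.inl_v_fst_v φ r s h
    iu_py := fun s r h => mappingCone.inl_v_snd_v φ r s _
    iy_pu := fun s r h => mappingCone.inr_f_fst_v φ s r h
    iy_py := fun s => mappingCone.inr_f_snd_v φ s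
    total := fun s r h => mappingCone.id_X φ s r h
    iu_d := fun s r r' h h' => by
      refine (mappingCone.inl_v_d φ r s r' (by omega) (by omega)).trans ?_
      rw [sub_eq_neg_add]
      rfl
    iy_d := fun s r => mappingCone.inr_f_d φ s r }

open CochainComplex in
/-- The complex `sigmaComplex` is a shifted cone of the unit. -/
noncomputable def unitCone (j : Fin n) (Y : CochainComplex (GrProj k n) ℤ) :
    UnitCone j Y ((sigmaComplex k j).obj Y) :=
  let φ := (NatTrans.mapHomologicalComplex (unit k j) (ComplexShape.up ℤ)).app Y
  -- The indices are kept free, related only by r + 0 = q and s + 0 = q', so that r = s + -1 can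
  -- later be substituted without transporting along an equality of degrees.
  have hu : ∀ r s q q' (h : r + 0 = q) (h' : s + 0 = q'), (HomComplex.Cochain.ofHom
      (mappingCone.inr φ)).v r q h ≫ (mappingCone φ).d q q' =
      ((((tensorFunctor k j ⋙ GrProj.shiftFunctor k n 1).mapHomologicalComplex
        (ComplexShape.up ℤ)).obj Y).d r s) ≫
        (HomComplex.Cochain.ofHom (mappingCone.inr φ)).v s q' h' := by
    intro r s q q' h h'
    obtain rfl : q = r := by omega
    obtain rfl : q' = s := by omega
    simp only [HomComplex.Cochain.ofHom_v]
    exact mappingCone.inr_f_d φ _ _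
  have hy : ∀ s s' q q' (h : s + -1 = q) (h' : s' + -1 = q') (h'' : s + 0 = q'),
      (mappingCone.inl φ).v s q h ≫ (mappingCone φ).d q q' =
      φ.f s ≫ (HomComplex.Cochain.ofHom (mappingCone.inr φ)).v s q' h'' -
        (((𝟭 (GrProj k n)).mapHomologicalComplex (ComplexShape.up ℤ)).obj Y).d s s' ≫
          (mappingCone.inl φ).v s' q' h' := by
    intro s s' q q' h h' h''
    obtain rfl : q' = s := by omega
    simp only [HomComplex.Cochain.ofHom_v]
    exact mappingCone.inl_v_d φ q' q s' _ _
  { iu := fun r s h => (HomComplex.Cochain.ofHom (mappingCone.inr φ)).v r (s + -1) (by omega)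
    iy := fun s => (mappingCone.inl φ).v s (s + -1) (by omega)
    pu := fun r s h => (mappingCone.snd φ).v (s + -1) r (by omega)
    py := fun s => (mappingCone.fst φ).1.v (s + -1) s (by omega)
    iu_pu := fun r s h => by
      obtain rfl : r = s + -1 := by omega
      rw [HomComplex.Cochain.ofHom_v]
      exact mappingCone.inr_f_snd_v φ (s + -1)
    iu_py := fun r s h => by
      obtain rfl : r = s + -1 := by omega
      rw [HomComplex.Cochain.ofHom_v]
      exact mappingCone.inr_f_fst_v φ (s + -1) s (by omega)
    iy_pu := fun r s h => by
      obtain rfl : r = s + -1 := by omega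
      exact mappingCone.inl_v_snd_v φ s (s + -1) (by omega)
    iy_py := fun s => mappingCone.inl_v_fst_v φ s (s + -1) (by omega)
    total := fun r s h => by
      obtain rfl : r = s + -1 := by omega
      rw [HomComplex.Cochain.ofHom_v, add_comm]
      exact mappingCone.id_X φ (s + -1) s (by omega)
    iu_d := fun r s s' h h' => by
      -- The shift by [-1] changes the sign of the differential; this is the source of both signs in
      -- `UnitCone`.
      have hd : ((sigmaComplex k j).obj Y).d s s' = -(mappingCone φ).d (s + -1) (s' + -1) := by
        change Int.negOnePow (-1) • (mappingCone φ).d (s + -1) (s' + -1) = _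
        rw [Int.negOnePow_neg, Int.negOnePow_one, Units.neg_smul, one_smul]
      rw [hd]
      exact (Preadditive.comp_neg _ _).trans (congrArg Neg.neg (hu r s _ _ _ _))
    iy_d := fun s s' h => by
      have hd : ((sigmaComplex k j).obj Y).d s s' = -(mappingCone φ).d (s + -1) (s' + -1) := by
        change Int.negOnePow (-1) • (mappingCone φ).d (s + -1) (s' + -1) = _
        rw [Int.negOnePow_neg, Int.negOnePow_one, Units.neg_smul, one_smul]
      rw [hd]
      exact (Preadditive.comp_neg _ _).trans <|
        (congrArg Neg.neg (hy s s' (s + -1) (s' + -1) rfl rfl (by omega))).trans (neg_sub _ _) }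

end Zigzag

/-! ### Elements of the cones, cocycles and boundaries in a fixed internal degree -/

namespace Zigzag
open ZigzagAlgebra GrProj

variable {k : Type u} [Field k] {n : ℕ}

namespace InvCone
variable {j : Fin n} {Y Y' : CochainComplex (GrProj k n) ℤ} (C : InvCone j Y Y')

/-- The element with given components. -/
def pair (s r : ℤ) (h : s + 1 = r) (u : tensor j (Y.X r)) (y : Y.X s) : Y'.X s :=
  Hom.lin (C.iu s r h) u + Hom.lin (C.iy s) y

variable {s r : ℤ} {h : s + 1 = r} {u u' : tensor j (Y.X r)} {y y' : Y.X s}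

lemma pu_pair : Hom.lin (C.pu s r h) (C.pair s r h u y) = u := by
  have h1 := congrArg (fun f => Hom.lin f u) (C.iu_pu s r h)
  have h2 := congrArg (fun f => Hom.lin f y) (C.iy_pu s r h)
  simp only [lin_comp, lin_id, lin_zero, LinearMap.comp_apply, LinearMap.id_apply,
    LinearMap.zero_apply] at h1 h2
  rw [pair, map_add, h1, h2, add_zero]

lemma py_pair : Hom.lin (C.py s) (C.pair s r h u y) = y := by
  have h1 := congrArg (fun f => Hom.lin f u) (C.iu_py s r h)
  have h2 := congrArg (fun f => Hom.lin f y) (C.iy_py s)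
  simp only [lin_comp, lin_id, lin_zero, LinearMap.comp_apply, LinearMap.id_apply,
    LinearMap.zero_apply] at h1 h2
  rw [pair, map_add, h1, h2, zero_add]

lemma exists_pair (h : s + 1 = r) {d : ℤ} {m : Y'.X s} (hm : m ∈ (Y'.X s).deg d) :
    ∃ u ∈ (tensor j (Y.X r)).deg d, ∃ y ∈ (Y.X s).deg d, m = C.pair s r h u y := by
  refine ⟨_, Hom.lin_mem (C.pu s r h) hm, _, Hom.lin_mem (C.py s) hm, ?_⟩
  have := congrArg (fun f => Hom.lin f m) (C.total s r h)
  simp only [lin_comp, lin_id, lin_add, LinearMap.comp_apply, LinearMap.id_apply,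
    LinearMap.add_apply] at this
  exact this.symm

lemma pair_inj (e : C.pair s r h u y = C.pair s r h u' y') : u = u' ∧ y = y' :=
  ⟨by rw [← C.pu_pair (h := h) (u := u) (y := y), e, pu_pair],
    by rw [← C.py_pair (h := h) (u := u) (y := y), e, py_pair]⟩

lemma pair_mem {d : ℤ} (hu : u ∈ (tensor j (Y.X r)).deg d) (hy : y ∈ (Y.X s).deg d) :
    C.pair s r h u y ∈ (Y'.X s).deg d :=
  Submodule.add_mem _ (Hom.lin_mem _ hu) (Hom.lin_mem _ hy)

lemma smul_pair (a : ZigzagAlgebra k n) : a • C.pair s r h u y = C.pair s r h (a • u) (a • y) := by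
  simp only [pair, smul_add, map_smul]

@[simp] lemma pair_zero : C.pair s r h 0 0 = 0 := by simp [pair]

lemma d_pair {r' : ℤ} (h' : r + 1 = r') : Hom.lin (Y'.d s r) (C.pair s r h u y) =
    C.pair r r' h' (-Hom.lin (tensorMap j (Y.d r r')) u)
      (Hom.lin (counitHom j (Y.X r)) u + Hom.lin (Y.d s r) y) := by
  have h1 := congrArg (fun f => Hom.lin f u) (C.iu_d s r r' h h')
  have h2 := congrArg (fun f => Hom.lin f y) (C.iy_d s r)
  simp only [lin_comp, lin_add, lin_neg, LinearMap.comp_apply, LinearMap.add_apply,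
    LinearMap.neg_apply] at h1 h2
  rw [pair, map_add, h1, h2, pair, map_add, map_neg]
  abel

end InvCone

namespace UnitCone
variable {j : Fin n} {Y Y' : CochainComplex (GrProj k n) ℤ} (C : UnitCone j Y Y')

/-- The inclusion of the tensor part, as a linear map. -/
def iuLin (r s : ℤ) (h : r + 1 = s) : tensor j (Y.X r) →ₗ[ZigzagAlgebra k n] Y'.X s :=
  Hom.lin (M := (tensor j (Y.X r)).shift 1) (C.iu r s h)

/-- The projection to the tensor part, as a linear map. -/
def puLin (r s : ℤ) (h : r + 1 = s) : Y'.X s →ₗ[ZigzagAlgebra k n] tensor j (Y.X r) :=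
  Hom.lin (N := (tensor j (Y.X r)).shift 1) (C.pu r s h)

/-- The element with given components. -/
def pair (r s : ℤ) (h : r + 1 = s) (y : Y.X s) (u : tensor j (Y.X r)) : Y'.X s :=
  Hom.lin (C.iy s) y + C.iuLin r s h u

variable {s r : ℤ} {h : r + 1 = s} {u u' : tensor j (Y.X r)} {y y' : Y.X s}

lemma puLin_pair : C.puLin r s h (C.pair r s h y u) = u := by
  have h1 : C.puLin r s h (C.iuLin r s h u) = u := congrArg
    (fun f : (tensor j (Y.X r)).shift 1 ⟶ (tensor j (Y.X r)).shift 1 => Hom.lin f u) (C.iu_pu r s h)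
  have h2 : C.puLin r s h (Hom.lin (C.iy s) y) = 0 :=
    congrArg (fun f => Hom.lin f y) (C.iy_pu r s h)
  rw [pair, map_add, h1, h2, zero_add]

lemma py_pair : Hom.lin (C.py s) (C.pair r s h y u) = y := by
  have h1 : Hom.lin (C.py s) (C.iuLin r s h u) = 0 := congrArg
    (fun f : (tensor j (Y.X r)).shift 1 ⟶ Y.X s => Hom.lin f u) (C.iu_py r s h)
  have h2 : Hom.lin (C.py s) (Hom.lin (C.iy s) y) = y := congrArg (fun f => Hom.lin f y) (C.iy_py s)
  rw [pair, map_add, h1, h2, add_zero]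

lemma exists_pair (h : r + 1 = s) {d : ℤ} {m : Y'.X s} (hm : m ∈ (Y'.X s).deg d) :
    ∃ y ∈ (Y.X s).deg d, ∃ u ∈ (tensor j (Y.X r)).deg (d + 1), m = C.pair r s h y u := by
  refine ⟨_, Hom.lin_mem (C.py s) hm, _, Hom.lin_mem (C.pu r s h) hm, ?_⟩
  have := congrArg (fun f => Hom.lin f m) (C.total r s h)
  rw [add_comm] at this
  exact this.symm

lemma pair_inj (e : C.pair r s h y u = C.pair r s h y' u') : y = y' ∧ u = u' :=
  ⟨by rw [← C.py_pair (h := h) (u := u) (y := y), e, py_pair],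
    by rw [← C.puLin_pair (h := h) (u := u) (y := y), e, puLin_pair]⟩

lemma pair_mem {d : ℤ} (hy : y ∈ (Y.X s).deg d) (hu : u ∈ (tensor j (Y.X r)).deg (d + 1)) :
    C.pair r s h y u ∈ (Y'.X s).deg d :=
  Submodule.add_mem _ (Hom.lin_mem _ hy) (Hom.lin_mem (C.iu r s h) (d := d) hu)

lemma smul_pair (a : ZigzagAlgebra k n) : a • C.pair r s h y u = C.pair r s h (a • y) (a • u) := by
  simp only [pair, smul_add, map_smul]

lemma pair_sub : C.pair r s h (y - y') (u - u') = C.pair r s h y u - C.pair r s h y' u' := by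
  simp only [pair, map_sub]; abel

@[simp] lemma pair_zero : C.pair r s h 0 0 = 0 := by simp [pair]

lemma d_pair {s' : ℤ} (h' : s + 1 = s') : Hom.lin (Y'.d s s') (C.pair r s h y u) =
    C.pair s s' h' (Hom.lin (Y.d s s') y)
      (-(Hom.lin (tensorMap j (Y.d r s)) u) - unitLin j (Y.X s) y) := by
  have h1 : Hom.lin (Y'.d s s') (C.iuLin r s h u) =
      -C.iuLin s s' h' (Hom.lin (tensorMap j (Y.d r s)) u) :=
    congrArg (fun f : (tensor j (Y.X r)).shift 1 ⟶ Y'.X s' => Hom.lin f u) (C.iu_d r s s' h h')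
  have h2 : Hom.lin (Y'.d s s') (Hom.lin (C.iy s) y) = Hom.lin (C.iy s') (Hom.lin (Y.d s s') y) -
      C.iuLin s s' h' (unitLin j (Y.X s) y) := by
    refine (congrArg (fun f => Hom.lin f y) (C.iy_d s s' h')).trans ?_
    simp only [lin_sub]
    rfl
  rw [pair, map_add, h1, h2, pair, map_sub, map_neg]
  abel

end UnitCone

section States
variable (Y : CochainComplex (GrProj k n) ℤ)

/-- Cocycles in cohomological degree `s`. -/
def IsCocycle (s : ℤ) (m : Y.X s) : Prop := ∀ s', s + 1 = s' → Hom.lin (Y.d s s') m = 0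

/-- Coboundaries of elements of internal degree `D`. -/
def IsBdry (D s : ℤ) (m : Y.X s) : Prop :=
  ∃ s', s' + 1 = s ∧ ∃ m' ∈ (Y.X s').deg D, Hom.lin (Y.d s' s) m' = m

variable {Y} {D s : ℤ} {m m' : Y.X s}

lemma IsCocycle.neg (h : IsCocycle Y s m) : IsCocycle Y s (-m) :=
  fun s' hs => by rw [map_neg, h s' hs, neg_zero]

lemma d_d (s s' s'' : ℤ) (m : Y.X s) : Hom.lin (Y.d s' s'') (Hom.lin (Y.d s s') m) = 0 := by
  have := congrArg (fun f => Hom.lin f m) (Y.d_comp_d s s' s'')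
  exact this

lemma IsBdry.isCocycle (h : IsBdry Y D s m) : IsCocycle Y s m := by
  obtain ⟨s', -, m', -, rfl⟩ := h
  exact fun s'' _ => d_d _ _ _ _

lemma isBdry_zero : IsBdry Y D s 0 :=
  ⟨s - 1, by omega, 0, Submodule.zero_mem _, map_zero _⟩

lemma IsBdry.exists_of_eq (h : IsBdry Y D s m) {s' : ℤ} (hs : s' + 1 = s) :
    ∃ v ∈ (Y.X s').deg D, Hom.lin (Y.d s' s) v = m := by
  obtain ⟨s'', hs', v, hv, rfl⟩ := h
  obtain rfl : s' = s'' := by omega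
  exact ⟨v, hv, rfl⟩

/-- An element of `A eⱼ ⊗ eⱼ Y` whose coordinates are boundaries is a boundary. -/
lemma exists_tensorMap_eq {j : Fin n} {r : ℤ} (hr : r + 1 = s) {u : tensor j (Y.X s)}
    (h : ∀ l δ, IsBdry Y (D - dg δ) s (co (Y.X s) l δ u)) :
    ∃ v ∈ (tensor j (Y.X r)).deg D, Hom.lin (tensorMap j (Y.d r s)) v = u := by
  choose v hv hv' using fun l δ => (h l δ).exists_of_eq hr
  refine ⟨∑ l, ∑ δ, tm _ l δ (v l δ), ?_, ?_⟩
  · refine Submodule.sum_mem _ fun l _ => Submodule.sum_mem _ fun δ _ => ?_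
    have := tm_mem (j := j) l δ (hv l δ)
    rwa [add_sub_cancel] at this
  · conv_rhs => rw [tensor_eq_sum u]
    simp only [map_sum, tensorFunctor_map_tm, hv']

lemma co_isCocycle {j : Fin n} {u : tensor j (Y.X s)} (h : ∀ s', s + 1 = s' →
    Hom.lin (tensorMap j (Y.d s s')) u = 0) (l : Fin n) (δ : Bool) :
    IsCocycle Y s (co (Y.X s) l δ u) := fun s' hs => by
  rw [← co_tensorFunctor_map, h s' hs, map_zero]

lemma counit_tensorMap {j : Fin n} {M N : GrProj k n} (f : M ⟶ N) (u : tensor j M) :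
    Hom.lin (counitHom j N) (Hom.lin (tensorMap j f) u) = Hom.lin f (Hom.lin (counitHom j M) u) :=
  congrArg (fun f => Hom.lin f u) ((counit k j).naturality f)

lemma unitLin_map {j : Fin n} {M N : GrProj k n} (f : M ⟶ N) (m : M) :
    unitLin j N (Hom.lin f m) = Hom.lin (tensorMap j f) (unitLin j M m) :=
  congrArg (fun f => Hom.lin f m) ((unit k j).naturality f)

end States
end Zigzag

/-! ### The lowest internal degree, which controls φ₊ -/

namespace Zigzag
open ZigzagAlgebra GrProj

variable {k : Type u} [Field k] {n : ℕ}

lemma bas_false_mem (p q : Fin n) : bas k p q false ∈ homogeneous k n 0 := bas_mem p q false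

lemma e_mul_self_smul (i : Fin n) (M : GrProj k n) (m : M) :
    (e i : ZigzagAlgebra k n) • (e i : ZigzagAlgebra k n) • m = (e i : ZigzagAlgebra k n) • m := by
  rw [smul_smul, e_mul_e, if_pos rfl]

/-- The cohomology of `Y` in the lowest internal degree `D`: its lowest cohomological degree is
`t`, where at every vertex other than `i` there is a nonzero class killed by all arrows of
degree `0`; at `i` the cohomology is nonzero or zero according to `ε`. -/
structure TopState (Y : CochainComplex (GrProj k n) ℤ) (D t : ℤ) (i : Fin n) (ε : Bool) :
    Prop where
  low : ∀ s d, d < D → ∀ m ∈ (Y.X s).deg d, m = 0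
  exact_lt : ∀ s < t, ∀ m ∈ (Y.X s).deg D, IsCocycle Y s m → IsBdry Y D s m
  soc : ∀ l ≠ i, ∃ h ∈ (Y.X t).deg D, (e l : ZigzagAlgebra k n) • h = h ∧ IsCocycle Y t h ∧
    ¬ IsBdry Y D t h ∧ ∀ p ≠ l, IsBdry Y D t (bas k p l false • h)
  pos : ε = true → ∃ h ∈ (Y.X t).deg D, (e i : ZigzagAlgebra k n) • h = h ∧ IsCocycle Y t h ∧
    ¬ IsBdry Y D t h
  neg : ε = false → ∀ h ∈ (Y.X t).deg D, (e i : ZigzagAlgebra k n) • h = h → IsCocycle Y t h →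
    IsBdry Y D t h

/-- The cohomology of `Y` in the highest internal degree `D`: its highest cohomological degree is
`t`, where at every vertex other than `i` there is a class outside the span of the images of the
arrows of degree `0`; at `i` the cohomology is zero or nonzero according to `ε`. -/
structure BotState (Y : CochainComplex (GrProj k n) ℤ) (D t : ℤ) (i : Fin n) (ε : Bool) :
    Prop where
  high : ∀ s d, D < d → ∀ m ∈ (Y.X s).deg d, m = 0
  exact_gt : ∀ s > t, ∀ m ∈ (Y.X s).deg D, IsCocycle Y s m → IsBdry Y D s m
  top : ∀ l ≠ i, ∃ h ∈ (Y.X t).deg D, (e l : ZigzagAlgebra k n) • h = h ∧ IsCocycle Y t h ∧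
    ∀ g : Fin n → Y.X t, (∀ q, g q ∈ (Y.X t).deg D) → (∀ q, IsCocycle Y t (g q)) →
      ¬ IsBdry Y D t (h - ∑ q ∈ Finset.univ.erase l, bas k l q false • g q)
  pos : ε = true → ∀ h ∈ (Y.X t).deg D, (e i : ZigzagAlgebra k n) • h = h → IsCocycle Y t h →
    IsBdry Y D t h
  neg : ε = false → ∃ h ∈ (Y.X t).deg D, (e i : ZigzagAlgebra k n) • h = h ∧ IsCocycle Y t h ∧
    ¬ IsBdry Y D t h

/-- The coordinate at a basis element of degree 1 has internal degree D - 1. So in the lowest degree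
T Y reduces to A₀ eⱼ ⊗ eⱼ Y_D. -/
lemma deg_sub_one_eq {D : ℤ} {Y : CochainComplex (GrProj k n) ℤ}
    (low : ∀ s d, d < D → ∀ m ∈ (Y.X s).deg d, m = 0) {j : Fin n} {s : ℤ} {u : tensor j (Y.X s)}
    (hu : u ∈ (tensor j (Y.X s)).deg D) (l : Fin n) : co (Y.X s) l true u = 0 :=
  low s (D - 1) (by omega) _ (co_mem l true hu)

lemma co_false_mem {D : ℤ} {M : GrProj k n} {j : Fin n} {u : tensor j M}
    (hu : u ∈ (tensor j M).deg D) (l : Fin n) : co M l false u ∈ M.deg D := by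
  have := co_mem l false hu
  rwa [dg_false, sub_zero] at this

lemma co_true_mem {D : ℤ} {M : GrProj k n} {j : Fin n} {u : tensor j M}
    (hu : u ∈ (tensor j M).deg (D + 1)) (l : Fin n) : co M l true u ∈ M.deg D := by
  have := co_mem l true hu
  rwa [dg_true, add_sub_cancel_right] at this

lemma tm_false_mem {D : ℤ} {M : GrProj k n} (j l : Fin n) {m : M} (hm : m ∈ M.deg D) :
    tm (j := j) M l false m ∈ (tensor j M).deg D := by
  have := tm_mem (j := j) l false hm
  rwa [dg_false, zero_add] at this

lemma tm_true_mem {D : ℤ} {M : GrProj k n} (j l : Fin n) {m : M} (hm : m ∈ M.deg D) :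
    tm (j := j) M l true m ∈ (tensor j M).deg (D + 1) := by
  have := tm_mem (j := j) l true hm
  rwa [dg_true, add_comm] at this

lemma eq_of_e_smul_tensor {M : GrProj k n} {j : Fin n} (i : Fin n) {u : tensor j M}
    (hu : (e i : ZigzagAlgebra k n) • u = u) :
    u = tm M i true (co M i true u) + tm M i false (co M i false u) := by
  conv_lhs => rw [← hu, tensor_eq_sum u]
  rw [Finset.smul_sum, Finset.sum_eq_single i]
  · simp only [Fintype.sum_bool, smul_add, e_smul_tm, if_true]
  · intro l _ hl
    simp only [Fintype.sum_bool, smul_add, e_smul_tm, if_neg hl.symm, add_zero]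
  · intro h; exact absurd (Finset.mem_univ _) h

lemma bas_smul_bas_smul_false {M : GrProj k n} {p l j : Fin n} (hp : p ≠ l) (hl : l ≠ j) (h : M) :
    bas k p l false • bas k l j false • h = 0 := by
  rw [smul_smul, bas_false_mul_bas_false hp, if_neg (by tauto), zero_smul]

section InvCone
variable {j : Fin n} {Y Y' : CochainComplex (GrProj k n) ℤ}

lemma InvCone.low (C : InvCone j Y Y') {D : ℤ} (low : ∀ s d, d < D → ∀ m ∈ (Y.X s).deg d, m = 0)
    (s d : ℤ) (hd : d < D)
    (m : Y'.X s) (hm : m ∈ (Y'.X s).deg d) : m = 0 := by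
  obtain ⟨u, hu, y, hy, rfl⟩ := C.exists_pair rfl hm
  have hu0 : u = 0 := tensor_ext fun l δ => by
    rw [map_zero]
    exact low _ (d - dg δ) (by cases δ <;> simp <;> omega) _ (co_mem l δ hu)
  rw [hu0, low s d hd y hy, C.pair_zero]

lemma InvCone.cocycle_iff (C : InvCone j Y Y') {s r r' : ℤ} {h : s + 1 = r} (h' : r + 1 = r')
    {u : tensor j (Y.X r)}
    {y : Y.X s} : IsCocycle Y' s (C.pair s r h u y) ↔
      Hom.lin (tensorMap j (Y.d r r')) u = 0 ∧
        Hom.lin (counitHom j (Y.X r)) u + Hom.lin (Y.d s r) y = 0 := by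
  constructor
  · intro hc
    have := hc r h
    rw [C.d_pair h', ← C.pair_zero (h := h')] at this
    have := C.pair_inj this
    exact ⟨neg_eq_zero.mp this.1, this.2⟩
  · rintro ⟨h1, h2⟩ r'' h''
    obtain rfl : r = r'' := by omega
    rw [C.d_pair h', h1, h2, neg_zero, C.pair_zero]

/-- The long exact sequence of the cone, chased on elements: in degree D the cohomology of T Y in
cohomological degree s + 1 consists of copies of eⱼ H^{s+1}(Y), so a cocycle of Y' can be moved by a
boundary into Y and then bounds there. -/
lemma InvCone.exact (C : InvCone j Y Y') {D : ℤ} (low : ∀ s d, d < D → ∀ m ∈ (Y.X s).deg d, m = 0)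
    {s : ℤ}
    (h1 : ∀ m ∈ (Y.X (s + 1)).deg D, (e j : ZigzagAlgebra k n) • m = m → IsCocycle Y (s + 1) m →
      IsBdry Y D (s + 1) m)
    (h2 : ∀ m ∈ (Y.X s).deg D, IsCocycle Y s m → IsBdry Y D s m)
    (m : Y'.X s) (hm : m ∈ (Y'.X s).deg D) (hc : IsCocycle Y' s m) : IsBdry Y' D s m := by
  obtain ⟨u, hu, y, hy, rfl⟩ := C.exists_pair rfl hm
  rw [C.cocycle_iff rfl] at hc
  obtain ⟨hu0, hy0⟩ := hc
  have hco := co_isCocycle (j := j) (u := u) (Y := Y) fun s' hs => by subst hs; exact hu0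
  obtain ⟨v, hv, hvu⟩ := exists_tensorMap_eq (Y := Y) (D := D) (r := s) rfl (u := u) fun l δ => by
    cases δ
    · rw [dg_false, sub_zero]
      exact h1 _ (co_false_mem hu l) (e_smul_co l false u) (hco l false)
    · rw [deg_sub_one_eq low hu]
      exact isBdry_zero
  obtain ⟨x, hx, hxy⟩ := (h2 (y + Hom.lin (counitHom j (Y.X s)) v)
    (Submodule.add_mem _ hy (Hom.lin_mem _ hv)) fun s' hs => by
      subst hs
      rw [map_add, ← counit_tensorMap, hvu]
      exact (add_comm _ _).trans hy0).exists_of_eq (sub_add_cancel s 1)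
  refine ⟨s - 1, by omega, C.pair (s - 1) s (by omega) (-v) x,
    C.pair_mem (Submodule.neg_mem _ hv) hx, ?_⟩
  rw [C.d_pair rfl, map_neg, neg_neg, hvu, hxy, map_neg]
  congr 1
  abel

/-- At the vertex j and in the lowest degree D, the tensor part is just eⱼ ⊗ eⱼ Y, which the counit
identifies with eⱼ Y. So eⱼ Y'_D is the cone of an isomorphism, and eⱼ ⊗ y is the primitive of a
cocycle with second component y. -/
lemma InvCone.bdry_of_e_smul (C : InvCone j Y Y') {D : ℤ}
    (low : ∀ s d, d < D → ∀ m ∈ (Y.X s).deg d, m = 0) {s : ℤ}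
    (m : Y'.X s) (hm : m ∈ (Y'.X s).deg D) (hj : (e j : ZigzagAlgebra k n) • m = m)
    (hc : IsCocycle Y' s m) : IsBdry Y' D s m := by
  obtain ⟨u, hu, y, hy, rfl⟩ := C.exists_pair rfl hm
  rw [C.cocycle_iff rfl] at hc
  rw [C.smul_pair] at hj
  obtain ⟨hju, hjy⟩ := C.pair_inj hj
  have hu1 := eq_of_e_smul_tensor j hju
  rw [deg_sub_one_eq low hu, map_zero, zero_add] at hu1
  have h2 := hc.2
  rw [hu1, counit_tm, bas_self_false, e_smul_co] at h2
  refine ⟨s - 1, by omega, C.pair (s - 1) s (by omega) (tm _ j false y) 0,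
    C.pair_mem (tm_false_mem j j hy) (Submodule.zero_mem _), ?_⟩
  rw [C.d_pair rfl, tensorFunctor_map_tm, counit_tm, bas_self_false, hjy, map_zero, add_zero,
    ← map_neg, neg_eq_of_add_eq_zero_left h2, ← hu1]

/-- Applying `Σⱼ⁻¹` to a complex with last letter at another vertex. -/
lemma TopState.invCone (C : InvCone j Y Y') {D t : ℤ} {i : Fin n} {ε : Bool}
    (S : TopState Y D (t + 1) i ε)
    (hij : j ≠ i) : TopState Y' D t j false where
  low := C.low S.low
  exact_lt s hs := C.exact S.low (fun m hm _ hc => S.exact_lt _ (by omega) m hm hc)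
    (S.exact_lt s (by omega))
  soc l hl := by
    obtain ⟨h, hh, hjh, hc, hb, hsoc⟩ := S.soc j hij
    -- As h is killed in cohomology by the degree 0 arrow l ⟶ j, its image under the counit is a
    -- boundary dy; subtracting y completes the tensor of that arrow with h to a cocycle. The
    -- idempotent e_l keeps the correction at the vertex l.
    obtain ⟨y, hy, hdy⟩ := (hsoc l hl).exists_of_eq rfl
    set y' : Y.X t := (e l : ZigzagAlgebra k n) • y
    have hy' : y' ∈ (Y.X t).deg D := by
      have := (Y.X t).smul_mem (e_mem (k := k) l) hy
      rwa [zero_add] at this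
    have hdy' : Hom.lin (Y.d t (t + 1)) y' = bas k l j false • h := by
      rw [map_smul, hdy, e_smul_bas_smul]
    refine ⟨C.pair t (t + 1) rfl (tm _ l false h) (-y'),
      C.pair_mem (tm_false_mem j l hh) (Submodule.neg_mem _ hy'), ?_, ?_, ?_, ?_⟩
    · rw [C.smul_pair, e_smul_tm, if_pos rfl, smul_neg, e_mul_self_smul]
    · rw [C.cocycle_iff rfl, tensorFunctor_map_tm, hc _ rfl, map_zero, counit_tm, map_neg, hdy',
        add_neg_cancel]
      exact ⟨rfl, rfl⟩
    · intro hbd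
      obtain ⟨m, hm, hdm⟩ := hbd.exists_of_eq (sub_add_cancel t 1)
      obtain ⟨v, hv, x, hx, rfl⟩ := C.exists_pair (sub_add_cancel t 1) hm
      rw [C.d_pair rfl] at hdm
      -- Reading off the coordinate at the arrow l ⟶ j turns a primitive of the new class into a
      -- primitive of h.
      have := congrArg (co (Y.X (t + 1)) l false) (C.pair_inj hdm).1
      rw [map_neg, co_tensorFunctor_map, co_tm, if_pos ⟨rfl, rfl⟩, hjh] at this
      exact hb ⟨t, rfl, -co _ l false v, Submodule.neg_mem _ (co_false_mem hv l), by
        rw [map_neg, this]⟩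
    · intro p hp
      have h0 : bas k p l false • y' ∈ (Y.X t).deg D := by
        have := (Y.X t).smul_mem (bas_false_mem (k := k) p l) hy'
        rwa [zero_add] at this
      -- A degree 0 arrow p ⟶ l kills the tensor component and sends y' to a cocycle, both because
      -- degree 0 arrows multiply to 0. That cocycle sits in cohomological degree t, below the
      -- lowest degree t + 1 of the cohomology of Y, so it bounds.
      obtain ⟨x, hx, hdx⟩ := (S.exact_lt t (by omega) _ h0 fun s' hs => by
        subst hs
        rw [map_smul, hdy', bas_smul_bas_smul_false hp hl]).exists_of_eq (sub_add_cancel t 1)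
      refine ⟨t - 1, by omega, C.pair (t - 1) t (by omega) 0 (-x),
        C.pair_mem (Submodule.zero_mem _) (Submodule.neg_mem _ hx), ?_⟩
      rw [C.d_pair rfl, C.smul_pair, bas_smul_tm_false hp, if_neg (by tauto), map_zero, map_zero,
        neg_zero, zero_add, map_neg, hdx, smul_neg]
  pos h := absurd h (by simp)
  neg _ := fun h hh hj hc => C.bdry_of_e_smul S.low h hh hj hc

/-- Applying `Σⱼ⁻¹` again. -/
lemma TopState.invCone_self (C : InvCone j Y Y') {D t : ℤ} (S : TopState Y D t j false) :
    TopState Y' D t j false where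
  low := C.low S.low
  exact_lt s hs := by
    refine C.exact S.low (fun m hm hj hc => ?_) (S.exact_lt s hs)
    rcases (show s + 1 < t ∨ s + 1 = t by omega) with h | h
    · exact S.exact_lt _ h m hm hc
    · subst h
      exact S.neg rfl m hm hj hc
  soc l hl := by
    obtain ⟨h, hh, hlh, hc, hb, hsoc⟩ := S.soc l hl
    -- Since eⱼ H vanishes in cohomological degrees up to t, the tensor part contributes nothing
    -- that could bound in degree t, and the socle classes of Y persist.
    refine ⟨C.pair t (t + 1) rfl 0 h, C.pair_mem (Submodule.zero_mem _) hh, ?_, ?_, ?_, ?_⟩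
    · rw [C.smul_pair, smul_zero, hlh]
    · rw [C.cocycle_iff rfl, map_zero, map_zero, hc _ rfl, zero_add]
      exact ⟨rfl, rfl⟩
    · intro hbd
      obtain ⟨m, hm, hdm⟩ := hbd.exists_of_eq (sub_add_cancel t 1)
      obtain ⟨v, hv, x, hx, rfl⟩ := C.exists_pair (sub_add_cancel t 1) hm
      rw [C.d_pair rfl] at hdm
      obtain ⟨h1, h2⟩ := C.pair_inj hdm
      have hco := co_isCocycle (j := j) (u := v) (Y := Y) fun s' hs => by
        subst hs; exact neg_eq_zero.mp h1
      -- The tensor component v of a primitive has its coordinates in eⱼ H^t = 0, so v = dw; the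
      -- counit of w replaces v and gives a primitive of h inside Y.
      obtain ⟨w, hw, hwv⟩ := exists_tensorMap_eq (Y := Y) (D := D) (sub_add_cancel t 1) (u := v)
        fun l δ => by
          cases δ
          · rw [dg_false, sub_zero]
            exact S.neg rfl _ (co_false_mem hv l) (e_smul_co l false v) (hco l false)
          · rw [deg_sub_one_eq S.low hv]
            exact isBdry_zero
      refine hb ⟨t - 1, by omega, Hom.lin (counitHom j _) w + x,
        Submodule.add_mem _ (Hom.lin_mem _ hw) hx, ?_⟩
      rw [map_add, ← counit_tensorMap, hwv, h2]
    · intro p hp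
      obtain ⟨x, hx, hdx⟩ := (hsoc p hp).exists_of_eq (sub_add_cancel t 1)
      refine ⟨t - 1, by omega, C.pair (t - 1) t (by omega) 0 x,
        C.pair_mem (Submodule.zero_mem _) hx, ?_⟩
      rw [C.d_pair rfl, C.smul_pair, map_zero, map_zero, neg_zero, zero_add, hdx, smul_zero]
  pos h := absurd h (by simp)
  neg _ := fun h hh hj hc => C.bdry_of_e_smul S.low h hh hj hc

end InvCone

section UnitCone
variable {j : Fin n} {Y Y' : CochainComplex (GrProj k n) ℤ}

lemma UnitCone.cocycle_iff (C : UnitCone j Y Y') {r s s' : ℤ} {h : r + 1 = s} (h' : s + 1 = s')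
    {u : tensor j (Y.X r)}
    {y : Y.X s} : IsCocycle Y' s (C.pair r s h y u) ↔
      Hom.lin (Y.d s s') y = 0 ∧
        Hom.lin (tensorMap j (Y.d r s)) u + unitLin j (Y.X s) y = 0 := by
  constructor
  · intro hc
    have := hc s' h'
    rw [C.d_pair h', ← C.pair_zero (h := h')] at this
    have := C.pair_inj this
    refine ⟨this.1, ?_⟩
    rw [← neg_eq_zero, neg_add]
    exact (sub_eq_add_neg _ _).symm.trans this.2
  · rintro ⟨h1, h2⟩ s'' h''
    obtain rfl : s' = s'' := by omega
    rw [C.d_pair h', h1, sub_eq_add_neg, ← neg_add, h2, neg_zero, C.pair_zero]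

/-- Applying `Σⱼ` to a complex whose lowest cohomology does not vanish at `j`. -/
lemma TopState.unitCone (C : UnitCone j Y Y') {D t : ℤ} {i : Fin n} {ε : Bool}
    (S : TopState Y D t i ε)
    (hij : j = i → ε = true) : TopState Y' (D - 1) (t + 1) j true := by
  obtain ⟨h, hh, hjh, hc, hb⟩ : ∃ h ∈ (Y.X t).deg D, (e j : ZigzagAlgebra k n) • h = h ∧
      IsCocycle Y t h ∧ ¬ IsBdry Y D t h := by
    by_cases hj : j = i
    · subst hj
      exact S.pos (hij rfl)
    · obtain ⟨h, h1, h2, h3, h4, -⟩ := S.soc j hj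
      exact ⟨h, h1, h2, h3, h4⟩
  -- In degree D - 1 the complex Y is zero, so Y' there is A₀ eⱼ ⊗ eⱼ Y_D moved up by one
  -- cohomological degree. The class h at j yields one nonzero class at every vertex l, including j.
  have hpair : ∀ l, C.pair t (t + 1) rfl 0 (tm _ l false h) ∈ (Y'.X (t + 1)).deg (D - 1) ∧
      (e l : ZigzagAlgebra k n) • C.pair t (t + 1) rfl 0 (tm _ l false h) =
        C.pair t (t + 1) rfl 0 (tm _ l false h) ∧
      IsCocycle Y' (t + 1) (C.pair t (t + 1) rfl 0 (tm _ l false h)) ∧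
      ¬ IsBdry Y' (D - 1) (t + 1) (C.pair t (t + 1) rfl 0 (tm _ l false h)) := by
    intro l
    refine ⟨C.pair_mem (Submodule.zero_mem _) ?_, ?_, ?_, ?_⟩
    · rw [sub_add_cancel]; exact tm_false_mem j l hh
    · rw [C.smul_pair, smul_zero, e_smul_tm, if_pos rfl]
    · rw [C.cocycle_iff rfl, map_zero, map_zero, tensorFunctor_map_tm, hc _ rfl, map_zero, add_zero]
      exact ⟨rfl, rfl⟩
    · intro hbd
      obtain ⟨m, hm, hdm⟩ := hbd.exists_of_eq rfl
      obtain ⟨x, hx, v, hv, rfl⟩ := C.exists_pair (sub_add_cancel t 1) hm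
      rw [sub_add_cancel] at hv
      rw [C.d_pair rfl, S.low _ _ (by omega) x hx] at hdm
      have := congrArg (co (Y.X t) l false) (C.pair_inj hdm).2
      rw [map_zero, sub_zero, map_neg, co_tensorFunctor_map, co_tm, if_pos ⟨rfl, rfl⟩, hjh] at this
      exact hb ⟨t - 1, by omega, -co _ l false v, Submodule.neg_mem _ (co_false_mem hv l), by
        rw [map_neg, this]⟩
  refine ⟨?_, ?_, ?_, ?_, ?_⟩
  · intro s d hd m hm
    obtain ⟨y, hy, u, hu, rfl⟩ := C.exists_pair (sub_add_cancel s 1) hm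
    have hu0 : u = 0 := tensor_ext fun l δ => by
      rw [map_zero]
      exact S.low _ (d + 1 - dg δ) (by cases δ <;> simp <;> omega) _ (co_mem l δ hu)
    rw [hu0, S.low s d (by omega) y hy, C.pair_zero]
  · intro s hs m hm hcm
    obtain ⟨y, hy, u, hu, rfl⟩ := C.exists_pair (sub_add_cancel s 1) hm
    obtain rfl := S.low s (D - 1) (by omega) y hy
    rw [sub_add_cancel] at hu
    rw [C.cocycle_iff rfl, map_zero, map_zero, add_zero] at hcm
    have hco := co_isCocycle (j := j) (u := u) (Y := Y) fun s' hs => by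
      obtain rfl : s' = s := by omega
      exact hcm.2
    obtain ⟨v, hv, hvu⟩ := exists_tensorMap_eq (Y := Y) (D := D) (sub_add_cancel (s - 1) 1)
      (u := u) fun l δ => by
        cases δ
        · rw [dg_false, sub_zero]
          exact S.exact_lt _ (by omega) _ (co_false_mem hu l) (hco l false)
        · rw [deg_sub_one_eq S.low hu]
          exact isBdry_zero
    refine ⟨s - 1, by omega, C.pair (s - 1 - 1) (s - 1) (by omega) 0 (-v),
      C.pair_mem (Submodule.zero_mem _) (Submodule.neg_mem _ ?_), ?_⟩
    · rwa [sub_add_cancel]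
    · rw [C.d_pair (sub_add_cancel s 1), map_zero, map_zero, map_neg, hvu, neg_neg, sub_zero]
  · intro l hl
    obtain ⟨h1, h2, h3, h4⟩ := hpair l
    refine ⟨_, h1, h2, h3, h4, fun p hp => ?_⟩
    -- For l ≠ j the product of the degree 0 arrows p ⟶ l and l ⟶ j is zero, so the class is killed
    -- already on the level of cochains.
    rw [C.smul_pair, smul_zero, bas_smul_tm_false hp, if_neg (by tauto), C.pair_zero]
    exact isBdry_zero
  · intro _
    exact ⟨_, hpair j⟩
  · intro h; exact absurd h (by simp)

end UnitCone
end Zigzag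

/-! ### The highest internal degree, which controls φ₋ -/

namespace Zigzag
open ZigzagAlgebra GrProj

variable {k : Type u} [Field k] {n : ℕ}

/-- The coordinate at a basis element of degree 0 would have internal degree D + 1. So T Y in its
highest degree D + 1 reduces to A₁ eⱼ ⊗ eⱼ Y_D. -/
lemma co_false_eq {D : ℤ} {Y : CochainComplex (GrProj k n) ℤ}
    (high : ∀ s d, D < d → ∀ m ∈ (Y.X s).deg d, m = 0) {j : Fin n} {s : ℤ} {u : tensor j (Y.X s)}
    (hu : u ∈ (tensor j (Y.X s)).deg (D + 1)) (l : Fin n) : co (Y.X s) l false u = 0 :=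
  high s (D + 1) (by omega) _ (co_false_mem hu l)

/-- Acting by a degree 0 arrow that starts at l produces, among the degree 1 basis elements of A eⱼ,
at most the loop zⱼ; for l ≠ j the coordinate at l is not reached. -/
lemma co_bas_smul {M : GrProj k n} {j l q : Fin n} (hl : l ≠ j) (hq : l ≠ q) (u : tensor j M) :
    co M l true (bas k l q false • u) = 0 := by
  rw [tensor_eq_sum u]
  simp only [Finset.smul_sum, Fintype.sum_bool, smul_add, map_sum, map_add, bas_smul_tm_true hq,
    bas_smul_tm_false hq]
  refine Finset.sum_eq_zero fun l' _ => ?_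
  split_ifs <;> simp [co_tm, hl]

lemma bas_smul_eq_zero {M : GrProj k n} {i p q : Fin n} (h : i ≠ q) (δ : Bool) {m : M}
    (hm : (e i : ZigzagAlgebra k n) • m = m) : bas k p q δ • m = 0 := by
  rw [← hm, ← bas_mul_e, smul_smul, mul_assoc, e_mul_e, if_neg h.symm, mul_zero, zero_smul]

lemma unitLin_mem {M : GrProj k n} {j : Fin n} {d : ℤ} {m : M} (hm : m ∈ M.deg d) :
    unitLin j M m ∈ (tensor j M).deg (d + 1) :=
  Hom.lin_mem (N := (tensor j M).shift 1) (unitHom j M) hm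

lemma co_bas_sum {Y : CochainComplex (GrProj k n) ℤ} {j l : Fin n} {s : ℤ} (hl : l ≠ j)
    (u : Fin n → tensor j (Y.X s)) :
    co (Y.X s) l true (∑ q ∈ Finset.univ.erase l, bas k l q false • u q) = 0 := by
  rw [map_sum]
  exact Finset.sum_eq_zero fun q hq => co_bas_smul hl (Finset.ne_of_mem_erase hq).symm _

section UnitCone
variable {j : Fin n} {Y Y' : CochainComplex (GrProj k n) ℤ}

lemma UnitCone.high (C : UnitCone j Y Y') {D : ℤ}
    (high : ∀ s d, D < d → ∀ m ∈ (Y.X s).deg d, m = 0) (s d : ℤ) (hd : D < d)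
    (m : Y'.X s) (hm : m ∈ (Y'.X s).deg d) : m = 0 := by
  obtain ⟨y, hy, u, hu, rfl⟩ := C.exists_pair (sub_add_cancel s 1) hm
  have hu0 : u = 0 := tensor_ext fun l δ => by
    rw [map_zero]
    exact high _ (d + 1 - dg δ) (by cases δ <;> simp <;> omega) _ (co_mem l δ hu)
  rw [hu0, high s d hd y hy, C.pair_zero]

lemma UnitCone.sum_pair (C : UnitCone j Y Y') {r s : ℤ} {h : r + 1 = s} (l : Fin n)
    (y : Fin n → Y.X s) (u : Fin n → tensor j (Y.X r)) :
    ∑ q ∈ Finset.univ.erase l, bas k l q false • C.pair r s h (y q) (u q) =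
      C.pair r s h (∑ q ∈ Finset.univ.erase l, bas k l q false • y q)
        (∑ q ∈ Finset.univ.erase l, bas k l q false • u q) := by
  simp only [C.smul_pair]
  simp only [UnitCone.pair, map_sum, Finset.sum_add_distrib]

/-- The long exact sequence of the cone of the unit. A primitive x of the first component reduces
the cocycle to one in the tensor part, whose coordinates lie in eⱼ H^r(Y). -/
lemma UnitCone.exact (C : UnitCone j Y Y') {D : ℤ}
    (high : ∀ s d, D < d → ∀ m ∈ (Y.X s).deg d, m = 0) {r s : ℤ} (hr : r + 1 = s)
    (h1 : ∀ m ∈ (Y.X r).deg D, (e j : ZigzagAlgebra k n) • m = m → IsCocycle Y r m →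
      IsBdry Y D r m)
    (h2 : ∀ m ∈ (Y.X s).deg D, IsCocycle Y s m → IsBdry Y D s m)
    (m : Y'.X s) (hm : m ∈ (Y'.X s).deg D) (hc : IsCocycle Y' s m) : IsBdry Y' D s m := by
  obtain ⟨y, hy, u, hu, rfl⟩ := C.exists_pair hr hm
  rw [C.cocycle_iff rfl] at hc
  obtain ⟨hy0, hu0⟩ := hc
  obtain ⟨x, hx, rfl⟩ := (h2 y hy fun s' hs => by subst hs; exact hy0).exists_of_eq hr
  have hw : u + unitLin j (Y.X r) x ∈ (tensor j (Y.X r)).deg (D + 1) :=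
    Submodule.add_mem _ hu (unitLin_mem hx)
  have hco := co_isCocycle (j := j) (u := u + unitLin j (Y.X r) x) (Y := Y) fun s' hs => by
    obtain rfl : s' = s := by omega
    rw [map_add, ← unitLin_map]
    exact hu0
  obtain ⟨v, hv, hvu⟩ := exists_tensorMap_eq (Y := Y) (D := D + 1) (sub_add_cancel r 1)
    (u := u + unitLin j (Y.X r) x) fun l δ => by
      cases δ
      · rw [co_false_eq high hw]
        exact isBdry_zero
      · rw [dg_true, add_sub_cancel_right]
        exact h1 _ (co_true_mem hw l) (e_smul_co l true _) (hco l true)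
  refine ⟨r, hr, C.pair (r - 1) r (by omega) x (-v),
    C.pair_mem hx (Submodule.neg_mem _ hv), ?_⟩
  rw [C.d_pair hr, map_neg, neg_neg, hvu, add_sub_cancel_right]

/-- Dual to the counit case: in the highest degree the tensor part at the vertex j is zⱼ ⊗ eⱼ Y, and
the unit maps eⱼ Y isomorphically onto it. -/
lemma UnitCone.bdry_of_e_smul (C : UnitCone j Y Y') {D : ℤ}
    (high : ∀ s d, D < d → ∀ m ∈ (Y.X s).deg d, m = 0) {s : ℤ}
    (m : Y'.X s) (hm : m ∈ (Y'.X s).deg D) (hj : (e j : ZigzagAlgebra k n) • m = m)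
    (hc : IsCocycle Y' s m) : IsBdry Y' D s m := by
  obtain ⟨y, hy, u, hu, rfl⟩ := C.exists_pair (sub_add_cancel s 1) hm
  rw [C.cocycle_iff rfl] at hc
  rw [C.smul_pair] at hj
  obtain ⟨hjy, hju⟩ := C.pair_inj hj
  have hu1 := eq_of_e_smul_tensor j hju
  rw [co_false_eq high hu, map_zero, add_zero] at hu1
  set w := co (Y.X (s - 1)) j true u with hw
  have hjw : (e j : ZigzagAlgebra k n) • w = w := e_smul_co j true u
  have hwD : w ∈ (Y.X (s - 1)).deg D := co_true_mem hu j
  have h2 := congrArg (co (Y.X s) j true) hc.2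
  rw [map_add, co_tensorFunctor_map, ← hw, co_unit, Bool.not_true, bas_self_false, hjy,
    map_zero] at h2
  -- As w = eⱼ w has the highest degree D, all other coordinates of its unit vanish: those at degree
  -- 0 basis elements involve the action of a degree 1 element on w, and those at vertices l ≠ j
  -- involve an arrow that does not end at j.
  have hη : unitLin j _ w = u := by
    rw [hu1]
    refine tensor_ext fun l δ => ?_
    rw [co_unit, co_tm]
    cases δ
    · rw [if_neg (by simp)]
      refine high (s - 1) (1 + D) (by omega) _ ?_
      exact (Y.X (s - 1)).smul_mem (bas_mem j l true) hwD
    · by_cases hl : l = j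
      · subst hl
        rw [if_pos ⟨rfl, rfl⟩, Bool.not_true, bas_self_false]
      · rw [if_neg (by tauto), bas_smul_eq_zero (Ne.symm hl) _ hjw]
  refine ⟨s - 1, by omega, C.pair (s - 1 - 1) (s - 1) (by omega) (-w) 0,
    C.pair_mem (Submodule.neg_mem _ hwD) (Submodule.zero_mem _), ?_⟩
  rw [C.d_pair (sub_add_cancel s 1), map_neg, map_neg, hη, map_zero, neg_zero, zero_sub, neg_neg,
    neg_eq_of_add_eq_zero_right h2]

/-- Applying `Σⱼ` to a complex with last letter at another vertex. -/
lemma BotState.unitCone (C : UnitCone j Y Y') {D t : ℤ} {i : Fin n} {ε : Bool}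
    (S : BotState Y D t i ε) (hij : j ≠ i) : BotState Y' D (t + 1) j true where
  high := C.high S.high
  exact_gt s hs := C.exact S.high (sub_add_cancel s 1)
    (fun m hm _ hc => S.exact_gt _ (by omega) m hm hc) (S.exact_gt s (by omega))
  top l hl := by
    obtain ⟨h, hh, hjh, hc, hR⟩ := S.top j hij
    refine ⟨C.pair t (t + 1) rfl 0 (tm _ l true h),
      C.pair_mem (Submodule.zero_mem _) (tm_true_mem j l hh), ?_, ?_, ?_⟩
    · rw [C.smul_pair, smul_zero, e_smul_tm, if_pos rfl]
    · rw [C.cocycle_iff rfl, map_zero, map_zero, tensorFunctor_map_tm, hc _ rfl, map_zero, add_zero]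
      exact ⟨rfl, rfl⟩
    · intro g hg hgc hbd
      choose y hy u hu hyu using fun q => C.exists_pair (rfl : t + 1 = t + 1) (hg q)
      have hy1 : ∀ q, Hom.lin (Y.d (t + 1) (t + 1 + 1)) (y q) = 0 := fun q => by
        have := hgc q
        rw [hyu, C.cocycle_iff rfl] at this
        exact this.1
      -- The Y-components of the cocycles g q lie above cohomological degree t, so they bound.
      choose x hx hxy using fun q => (S.exact_gt (t + 1) (by omega) (y q) (hy q) fun s' hs => by
        subst hs; exact hy1 q).exists_of_eq rfl
      simp only [hyu] at hbd
      rw [C.sum_pair, ← C.pair_sub, zero_sub] at hbd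
      obtain ⟨m, hm, hdm⟩ := hbd.exists_of_eq rfl
      obtain ⟨x', hx', v, hv, rfl⟩ := C.exists_pair (sub_add_cancel t 1) hm
      rw [C.d_pair rfl] at hdm
      obtain ⟨e1, e2⟩ := C.pair_inj hdm
      -- At the degree 1 arrow l ⟶ j the images of degree 0 arrows are invisible, and the unit of x'
      -- contributes the degree 0 arrow j ⟶ l applied to x'. So h equals, up to sign and a boundary,
      -- the image of x' under that arrow.
      have e3 := congrArg (co (Y.X t) l true) e2
      rw [map_sub, map_sub, map_neg, co_tensorFunctor_map, co_unit, co_tm, if_pos ⟨rfl, rfl⟩, hjh,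
        Bool.not_true, co_bas_sum hl, sub_zero] at e3
      -- The element x' need not be a cocycle. Adding the primitives of the correction terms makes
      -- it one, and by `hb` the arrow j ⟶ l does not see the difference, as degree 0 arrows
      -- multiply to 0.
      set x'' := x' + ∑ q ∈ Finset.univ.erase l, bas k l q false • x q with hx''
      have hx''D : x'' ∈ (Y.X t).deg D := by
        refine Submodule.add_mem _ hx' (Submodule.sum_mem _ fun q _ => ?_)
        have := (Y.X t).smul_mem (bas_false_mem (k := k) l q) (hx q)
        rwa [zero_add] at this
      have hx''c : IsCocycle Y t x'' := fun s' hs => by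
        subst hs
        rw [hx'', map_add, map_sum, e1]
        simp only [map_smul, hxy]
        exact neg_add_cancel _
      have hb : bas k j l false • x'' = bas k j l false • x' := by
        rw [hx'', smul_add, Finset.smul_sum, Finset.sum_eq_zero, add_zero]
        intro q hq
        exact bas_smul_bas_smul_false (Ne.symm hl) (Finset.ne_of_mem_erase hq).symm _
      -- The family concentrated at q = l with value -x'' exhibits h as lying in the image of the
      -- degree 0 arrows modulo boundaries, contrary to the choice of h.
      refine hR (fun q => if q = l then -x'' else 0) (fun q => ?_) (fun q => ?_) ?_
      · split_ifs
        · exact Submodule.neg_mem _ hx''D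
        · exact Submodule.zero_mem _
      · split_ifs
        · exact hx''c.neg
        · exact isBdry_zero (D := D).isCocycle
      · rw [Finset.sum_eq_single_of_mem l (by simpa using hl) fun q _ hq => by
          rw [if_neg hq, smul_zero], if_pos rfl, smul_neg, sub_neg_eq_add, hb, ← e3]
        refine ⟨t - 1, by omega, -co _ l true v, Submodule.neg_mem _ (co_true_mem hv l), ?_⟩
        rw [map_neg]
        abel
  pos _ := fun h hh hj hc => C.bdry_of_e_smul S.high h hh hj hc
  neg h := absurd h (by simp)

/-- Applying `Σⱼ` again. -/
lemma BotState.unitCone_self (C : UnitCone j Y Y') {D t : ℤ} (S : BotState Y D t j true) :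
    BotState Y' D t j true where
  high := C.high S.high
  exact_gt s hs := by
    refine C.exact S.high (sub_add_cancel s 1) (fun m hm hj hc => ?_) (S.exact_gt s hs)
    rcases (show t < s - 1 ∨ t = s - 1 by omega) with h | h
    · exact S.exact_gt _ h m hm hc
    · subst h
      exact S.pos rfl m hm hj hc
  top l hl := by
    obtain ⟨h, hh, hlh, hc, hR⟩ := S.top l hl
    have hco := co_isCocycle (j := j) (u := unitLin j (Y.X t) h) (Y := Y) fun s' hs => by
      rw [← unitLin_map, hc _ hs, map_zero]
    -- The unit of h has its coordinates in eⱼ H^t = 0, so it bounds; a primitive, projected to the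
    -- vertex l, completes h to a cocycle of Y'.
    obtain ⟨v, hv, hvu⟩ := exists_tensorMap_eq (Y := Y) (D := D + 1) (sub_add_cancel t 1)
      (u := unitLin j (Y.X t) h) fun l' δ => by
        cases δ
        · rw [co_false_eq S.high (unitLin_mem hh)]
          exact isBdry_zero
        · rw [dg_true, add_sub_cancel_right]
          exact S.pos rfl _ (co_true_mem (unitLin_mem hh) l') (e_smul_co l' true _) (hco l' true)
    have hv' : (e l : ZigzagAlgebra k n) • v ∈ (tensor j (Y.X (t - 1))).deg (D + 1) := by
      have := (tensor j (Y.X (t - 1))).smul_mem (e_mem (k := k) l) hv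
      rwa [zero_add] at this
    refine ⟨C.pair (t - 1) t (by omega) h (-((e l : ZigzagAlgebra k n) • v)),
      C.pair_mem hh (Submodule.neg_mem _ hv'), ?_, ?_, ?_⟩
    · rw [C.smul_pair, hlh, smul_neg, e_mul_self_smul]
    · rw [C.cocycle_iff rfl, hc _ rfl, map_neg, map_smul, hvu, ← map_smul, hlh, neg_add_cancel]
      exact ⟨rfl, rfl⟩
    · intro g hg hgc hbd
      choose y hy u hu hyu using fun q => C.exists_pair (sub_add_cancel t 1) (hg q)
      simp only [hyu] at hbd
      rw [C.sum_pair, ← C.pair_sub] at hbd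
      obtain ⟨m, hm, hdm⟩ := hbd.exists_of_eq (sub_add_cancel t 1)
      obtain ⟨x', hx', v', hv', rfl⟩ := C.exists_pair (sub_add_cancel (t - 1) 1) hm
      rw [C.d_pair (sub_add_cancel t 1)] at hdm
      refine hR y hy (fun q => ?_) ⟨t - 1, by omega, x', hx', (C.pair_inj hdm).1⟩
      have := hgc q
      rw [hyu, C.cocycle_iff rfl] at this
      exact fun s' hs => by subst hs; exact this.1
  pos _ := fun h hh hj hc => C.bdry_of_e_smul S.high h hh hj hc
  neg h := absurd h (by simp)

end UnitCone

section InvCone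
variable {j : Fin n} {Y Y' : CochainComplex (GrProj k n) ℤ}

lemma InvCone.sum_pair (C : InvCone j Y Y') {r s : ℤ} {h : s + 1 = r} (l : Fin n)
    (y : Fin n → Y.X s) (u : Fin n → tensor j (Y.X r)) :
    ∑ q ∈ Finset.univ.erase l, bas k l q false • C.pair s r h (u q) (y q) =
      C.pair s r h (∑ q ∈ Finset.univ.erase l, bas k l q false • u q)
        (∑ q ∈ Finset.univ.erase l, bas k l q false • y q) := by
  simp only [C.smul_pair]
  simp only [InvCone.pair, map_sum, Finset.sum_add_distrib]

/-- Applying `Σⱼ⁻¹` to a complex whose highest cohomology does not vanish at `j`. -/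
lemma BotState.invCone (C : InvCone j Y Y') {D t : ℤ} {i : Fin n} {ε : Bool}
    (S : BotState Y D (t + 1) i ε) (hij : j = i → ε = false) :
    BotState Y' (D + 1) t j false := by
  obtain ⟨h, hh, hjh, hc, hb⟩ : ∃ h ∈ (Y.X (t + 1)).deg D, (e j : ZigzagAlgebra k n) • h = h ∧
      IsCocycle Y (t + 1) h ∧ ¬ IsBdry Y D (t + 1) h := by
    by_cases hj : j = i
    · subst hj
      exact S.neg (hij rfl)
    · obtain ⟨h, h1, h2, h3, h4⟩ := S.top j hj
      -- A class outside the image of the degree 0 arrows is nonzero: take the zero family.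
      refine ⟨h, h1, h2, h3, fun hb => h4 (fun _ => 0) (fun _ => Submodule.zero_mem _)
        (fun _ => isBdry_zero (D := D).isCocycle) ?_⟩
      simpa using hb
  -- In degree D + 1 the complex Y is zero, so Y' there is A₁ eⱼ ⊗ eⱼ Y_D moved down by one
  -- cohomological degree.
  have hy0 : ∀ {s} {y : Y.X s}, y ∈ (Y.X s).deg (D + 1) → y = 0 := fun hy =>
    S.high _ _ (by omega) _ hy
  have hpair : ∀ l, C.pair t (t + 1) rfl (tm _ l true h) 0 ∈ (Y'.X t).deg (D + 1) ∧
      (e l : ZigzagAlgebra k n) • C.pair t (t + 1) rfl (tm _ l true h) 0 =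
        C.pair t (t + 1) rfl (tm _ l true h) 0 ∧
      IsCocycle Y' t (C.pair t (t + 1) rfl (tm _ l true h) 0) ∧
      ∀ u : Fin n → tensor j (Y.X (t + 1)), co (Y.X (t + 1)) l true
          (∑ q ∈ Finset.univ.erase l, bas k l q false • u q) = 0 → ∀ y,
        ¬ IsBdry Y' (D + 1) t (C.pair t (t + 1) rfl
          (tm _ l true h - ∑ q ∈ Finset.univ.erase l, bas k l q false • u q) y) := by
    intro l
    refine ⟨C.pair_mem (tm_true_mem j l hh) (Submodule.zero_mem _), ?_, ?_, ?_⟩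
    · rw [C.smul_pair, smul_zero, e_smul_tm, if_pos rfl]
    · rw [C.cocycle_iff rfl, map_zero, tensorFunctor_map_tm, hc _ rfl, map_zero, add_zero]
      exact ⟨rfl, hy0 (Hom.lin_mem _ (tm_true_mem j l hh))⟩
    · intro u hu y hbd
      obtain ⟨m, hm, hdm⟩ := hbd.exists_of_eq (sub_add_cancel t 1)
      obtain ⟨v, hv, x, hx, rfl⟩ := C.exists_pair (sub_add_cancel t 1) hm
      rw [C.d_pair rfl] at hdm
      have := congrArg (co (Y.X (t + 1)) l true) (C.pair_inj hdm).1
      rw [map_neg, co_tensorFunctor_map, map_sub, co_tm, if_pos ⟨rfl, rfl⟩, hjh, hu,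
        sub_zero] at this
      exact hb ⟨t, rfl, -co _ l true v, Submodule.neg_mem _ (co_true_mem hv l), by
        rw [map_neg, this]⟩
  refine ⟨?_, ?_, ?_, ?_, ?_⟩
  · intro s d hd m hm
    obtain ⟨u, hu, y, hy, rfl⟩ := C.exists_pair rfl hm
    have hu0 : u = 0 := tensor_ext fun l δ => by
      rw [map_zero]
      exact S.high _ (d - dg δ) (by cases δ <;> simp <;> omega) _ (co_mem l δ hu)
    rw [hu0, S.high s d (by omega) y hy, C.pair_zero]
  · intro s hs m hm hcm
    obtain ⟨u, hu, y, hy, rfl⟩ := C.exists_pair rfl hm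
    obtain rfl := hy0 hy
    rw [C.cocycle_iff rfl] at hcm
    have hco := co_isCocycle (j := j) (u := u) (Y := Y) fun s' hs => by
      subst hs; exact hcm.1
    obtain ⟨v, hv, hvu⟩ := exists_tensorMap_eq (Y := Y) (D := D + 1) (r := s) rfl
      (u := u) fun l δ => by
        cases δ
        · rw [co_false_eq S.high hu]
          exact isBdry_zero
        · rw [dg_true, add_sub_cancel_right]
          exact S.exact_gt _ (by omega) _ (co_true_mem hu l) (hco l true)
    refine ⟨s - 1, by omega, C.pair (s - 1) s (by omega) (-v) 0,
      C.pair_mem (Submodule.neg_mem _ hv) (Submodule.zero_mem _), ?_⟩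
    rw [C.d_pair rfl, map_neg, hvu, neg_neg, map_zero, add_zero,
      hy0 (Hom.lin_mem (counitHom j (Y.X s)) (Submodule.neg_mem _ hv))]
  · intro l hl
    obtain ⟨h1, h2, h3, h4⟩ := hpair l
    refine ⟨_, h1, h2, h3, fun g hg hgc hbd => ?_⟩
    choose u hu y hy hyu using fun q => C.exists_pair (rfl : t + 1 = t + 1) (hg q)
    simp only [hyu] at hbd
    rw [C.sum_pair] at hbd
    refine h4 u (co_bas_sum hl u) (0 - ∑ q ∈ Finset.univ.erase l, bas k l q false • y q) ?_
    convert hbd using 1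
    simp only [InvCone.pair, map_sub]
    abel
  · intro h; exact absurd h (by simp)
  · intro _
    obtain ⟨h1, h2, h3, h4⟩ := hpair j
    refine ⟨_, h1, h2, h3, ?_⟩
    have := h4 (fun _ => 0) (by simp) 0
    simpa using this

end InvCone
end Zigzag

/-! ### Words: bounds on degrees and survival of the extremal classes -/

namespace Zigzag
open ZigzagAlgebra GrProj

variable {k : Type u} [Field k] {n : ℕ}

/-- The functor `Ψ_w` on complexes. -/
noncomputable def PsiComplex (k : Type u) [Field k] {n : ℕ} :
    List (Fin n × Bool) → CochainComplex (GrProj k n) ℤ → CochainComplex (GrProj k n) ℤ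
  | [], Y => Y
  | (i, true) :: w, Y => (sigmaComplex k i).obj (PsiComplex k w Y)
  | (i, false) :: w, Y => (sigmaInvComplex k i).obj (PsiComplex k w Y)

/-- The functors on 𝒟 are induced from functors on complexes, so on objects they agree with these as
an equality, not only up to isomorphism. -/
lemma Psi_obj (w : List (Fin n × Bool)) (X : D k n) : ((Psi k w).obj X).obj =
    (HomotopyCategory.quotient _ _).obj (PsiComplex k w X.obj.as) := by
  induction w with
  | nil => rfl
  | cons a w ih =>
    obtain ⟨i, ε⟩ := a
    have h : ((Psi k w).obj X).obj.as = PsiComplex k w X.obj.as := congrArg (fun Z => Z.as) ih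
    cases ε
    · change (HomotopyCategory.quotient _ _).obj
        ((sigmaInvComplex k i).obj ((Psi k w).obj X).obj.as) = _
      rw [h]; rfl
    · change (HomotopyCategory.quotient _ _).obj
        ((sigmaComplex k i).obj ((Psi k w).obj X).obj.as) = _
      rw [h]; rfl

lemma tensor_supportedIn {j : Fin n} {a b : ℤ} {M : GrProj k n} (h : SupportedIn a b M) {d : ℤ}
    (hd : d < -b ∨ -a + 2 < d) {u : tensor j M} (hu : u ∈ (tensor j M).deg d) : u = 0 :=
  tensor_ext fun l δ => by
    rw [map_zero]
    exact h (d - dg δ) (by cases δ <;> simp <;> omega) _ (co_mem l δ hu)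

/-- The extra degree of T Y lies above those of Y and hence enlarges the interval at a. -/
lemma InvCone.supportedIn {j : Fin n} {Y Y' : CochainComplex (GrProj k n) ℤ} (C : InvCone j Y Y')
    {a b : ℤ} (h : ∀ m, SupportedIn a b (Y.X m)) (m : ℤ) : SupportedIn (a - 1) b (Y'.X m) := by
  intro d hd v hv
  obtain ⟨u, hu, y, hy, rfl⟩ := C.exists_pair rfl hv
  rw [tensor_supportedIn (h _) (by omega) hu, h m d (by omega) y hy, C.pair_zero]

/-- The shift ⟨1⟩ moves the extra degree of T Y below those of Y, so the interval grows at b. -/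
lemma UnitCone.supportedIn {j : Fin n} {Y Y' : CochainComplex (GrProj k n) ℤ} (C : UnitCone j Y Y')
    {a b : ℤ} (h : ∀ m, SupportedIn a b (Y.X m)) (m : ℤ) : SupportedIn a (b + 1) (Y'.X m) := by
  intro d hd v hv
  obtain ⟨y, hy, u, hu, rfl⟩ := C.exists_pair (sub_add_cancel m 1) hv
  rw [tensor_supportedIn (h _) (by omega) hu, h m d (by omega) y hy, C.pair_zero]

/-- The number of positive letters of a word. -/
def numPos (w : List (Fin n × Bool)) : ℕ := w.countP (fun s => s.2 = true)

/-- The number of negative letters of a word. -/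
def numNeg (w : List (Fin n × Bool)) : ℕ := w.countP (fun s => s.2 = false)

@[simp] lemma numPos_nil : numPos ([] : List (Fin n × Bool)) = 0 := rfl
@[simp] lemma numNeg_nil : numNeg ([] : List (Fin n × Bool)) = 0 := rfl
@[simp] lemma numPos_cons_true (i : Fin n) (w) : numPos ((i, true) :: w) = numPos w + 1 := by
  simp [numPos]
@[simp] lemma numPos_cons_false (i : Fin n) (w) : numPos ((i, false) :: w) = numPos w := by
  simp [numPos]
@[simp] lemma numNeg_cons_true (i : Fin n) (w) : numNeg ((i, true) :: w) = numNeg w := by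
  simp [numNeg]
@[simp] lemma numNeg_cons_false (i : Fin n) (w) : numNeg ((i, false) :: w) = numNeg w + 1 := by
  simp [numNeg]

lemma PsiComplex_supportedIn (w : List (Fin n × Bool)) {a b : ℤ}
    {Y : CochainComplex (GrProj k n) ℤ} (h : ∀ m, SupportedIn a b (Y.X m)) :
    ∀ m, SupportedIn (a - numNeg w) (b + numPos w) ((PsiComplex k w Y).X m) := by
  induction w with
  | nil => simpa [PsiComplex] using h
  | cons c w ih =>
    obtain ⟨i, ε⟩ := c
    cases ε
    · have := (Zigzag.invCone i (PsiComplex k w Y)).supportedIn ih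
      simp only [numNeg_cons_false, numPos_cons_false, Nat.cast_add, Nat.cast_one, ← sub_sub]
      exact this
    · have := (Zigzag.unitCone i (PsiComplex k w Y)).supportedIn ih
      simp only [numNeg_cons_true, numPos_cons_true, Nat.cast_add, Nat.cast_one, ← add_assoc]
      exact this

/-- A cohomology class of internal degree `D` bounds the support of homotopy equivalent
complexes. -/
lemma bounds_of_not_isBdry {Y Z : CochainComplex (GrProj k n) ℤ} {D t a b : ℤ}
    (e : (HomotopyCategory.quotient _ _).obj Z ≅
      (HomotopyCategory.quotient _ (ComplexShape.up ℤ)).obj Y)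
    (hZ : ∀ m, SupportedIn a b (Z.X m)) {h : Y.X t} (hh : h ∈ (Y.X t).deg D)
    (hc : IsCocycle Y t h) (hb : ¬ IsBdry Y D t h) : -b ≤ D ∧ D ≤ -a + 1 := by
  by_contra hD
  let E := HomotopyCategory.homotopyEquivOfIso e
  apply hb
  -- If Z has nothing in degree D, the composite of Y → Z → Y kills h, and its homotopy to the
  -- identity supplies a primitive of h.
  have h0 : Hom.lin (E.inv.f t) h = 0 := hZ t D (by omega) _ (Hom.lin_mem _ hh)
  have hcomm := E.homotopyInvHomId.comm t
  rw [dNext_eq _ (show (ComplexShape.up ℤ).Rel t (t + 1) from rfl),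
    prevD_eq _ (show (ComplexShape.up ℤ).Rel (t - 1) t from sub_add_cancel t 1)] at hcomm
  have := congrArg (fun f => Hom.lin f h) hcomm
  simp only [HomologicalComplex.comp_f, lin_comp, lin_add, LinearMap.add_apply,
    LinearMap.comp_apply, h0, hc _ rfl, map_zero, zero_add, HomologicalComplex.id_f, lin_id,
    LinearMap.id_apply] at this
  exact ⟨t - 1, by omega, -_, Submodule.neg_mem _
    (Hom.lin_mem (E.homotopyInvHomId.hom t (t - 1)) hh),
    by rw [map_neg, neg_eq_of_add_eq_zero_right this.symm]⟩

/-- The module `Pᵢ` as a complex. -/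
noncomputable def singleP (k : Type u) [Field k] {n : ℕ} (i : Fin n) :
    CochainComplex (GrProj k n) ℤ := (HomologicalComplex.single _ _ 0).obj (P k i)

/-- The isomorphism of the chain group in degree `0` with `Pᵢ`. -/
noncomputable def singlePIso (i : Fin n) : P k i ≅ (singleP k i).X 0 :=
  (HomologicalComplex.singleObjXSelf (ComplexShape.up ℤ) 0 (P k i)).symm

lemma singleP_isZero (i : Fin n) {m : ℤ} (hm : m ≠ 0) : IsZero ((singleP k i).X m) :=
  HomologicalComplex.isZero_single_obj_X _ _ _ _ hm

lemma singleP_eq_zero (i : Fin n) {m : ℤ} (hm : m ≠ 0) (v : (singleP k i).X m) : v = 0 :=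
  have := isZero_iff_subsingleton.mp (singleP_isZero (k := k) i hm)
  Subsingleton.elim _ _

lemma singleP_cocycle (i : Fin n) (s : ℤ) (v : (singleP k i).X s) :
    IsCocycle (singleP k i) s v := fun s' _ => by
  rw [show (singleP k i).d s s' = 0 from HomologicalComplex.single_obj_d _ _ _ _ _]; rfl

lemma singleP_not_bdry (i : Fin n) {D s : ℤ} {v : (singleP k i).X s}
    (h : IsBdry (singleP k i) D s v) : v = 0 := by
  obtain ⟨s', _, m, _, rfl⟩ := h
  rw [show (singleP k i).d s' s = 0 from HomologicalComplex.single_obj_d _ _ _ _ _]; rfl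

/-- The element of the chain group in degree `0` given by an element of the algebra. -/
noncomputable def singleElt (i : Fin n) : ZigzagAlgebra k n →ₗ[ZigzagAlgebra k n]
    (singleP k i).X 0 :=
  Hom.lin (singlePIso i).hom ∘ₗ (toLeftIdeal i : ZigzagAlgebra k n →ₗ[ZigzagAlgebra k n] P k i)

/-- The element of the algebra underlying an element of the chain group in degree `0`. -/
noncomputable def singleVal (i : Fin n) : (singleP k i).X 0 →ₗ[ZigzagAlgebra k n]
    ZigzagAlgebra k n :=
  ((leftIdeal k i).subtype : P k i →ₗ[ZigzagAlgebra k n] ZigzagAlgebra k n) ∘ₗ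
    Hom.lin (singlePIso i).inv

lemma singleVal_singleElt (i : Fin n) (a : ZigzagAlgebra k n) :
    singleVal i (singleElt i a) = a * e i := by
  have := congrArg (fun f => Hom.lin f (toLeftIdeal i a : P k i)) (singlePIso (k := k) i).hom_inv_id
  exact congrArg (leftIdeal k i).subtype this

lemma singleElt_singleVal (i : Fin n) (v : (singleP k i).X 0) :
    singleElt i (singleVal i v) = v := by
  have h : (toLeftIdeal i (singleVal i v) : P k i) = Hom.lin (singlePIso i).inv v :=
    toLeftIdeal_coe i _
  have := congrArg (fun f => Hom.lin f v) (singlePIso (k := k) i).inv_hom_id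
  change Hom.lin (singlePIso i).hom (toLeftIdeal i (singleVal i v) : P k i) = v
  rw [h]
  exact this

lemma singleVal_mul_e (i : Fin n) (v : (singleP k i).X 0) :
    singleVal i v * e i = singleVal i v := by
  rw [← singleVal_singleElt, singleElt_singleVal]

lemma singleVal_mem (i : Fin n) {v : (singleP k i).X 0} {d : ℤ}
    (hv : v ∈ ((singleP k i).X 0).deg d) : singleVal i v ∈ homogeneous k n d :=
  Hom.lin_mem (singlePIso i).inv hv

lemma singleElt_mem (i : Fin n) {a : ZigzagAlgebra k n} {d : ℤ}
    (ha : a ∈ homogeneous k n d) : singleElt i a ∈ ((singleP k i).X 0).deg d :=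
  Hom.lin_mem (singlePIso i).hom (toLeftIdeal_mem ha : _ ∈ (P k i).deg d)

lemma singleElt_bas_ne_zero (l i : Fin n) (δ : Bool) : singleElt i (bas k l i δ) ≠ 0 := by
  intro h
  have h1 := congrArg (fun v => coef k l i δ (singleVal i v)) h
  rw [singleVal_singleElt, bas_mul_e, coef_bas, if_pos ⟨rfl, rfl⟩, map_zero, map_zero] at h1
  exact one_ne_zero h1

lemma e_smul_singleElt (l i : Fin n) (δ : Bool) : (e l : ZigzagAlgebra k n) •
    singleElt i (bas k l i δ) = singleElt i (bas k l i δ) := by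
  rw [← map_smul, smul_eq_mul, e_mul_bas, if_pos rfl]

lemma singleP_supportedIn (i : Fin n) (m : ℤ) : SupportedIn 0 0 ((singleP k i).X m) := by
  intro d hd v hv
  by_cases hm : m = 0
  · subst hm
    rw [← singleElt_singleVal i v, eq_sum_bas i (singleVal_mul_e i v)]
    have : ∀ l δ, coef k l i δ (singleVal i v) = 0 := fun l δ =>
      coef_eq_zero l i δ (by cases δ <;> simp <;> omega) (singleVal_mem i hv)
    simp [this]
  · exact singleP_eq_zero i hm v

/-- In its lowest degree Pᵢ looks like a complex to which σᵢ was applied last: eᵢ at the vertex i,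
and at any other vertex l the degree 0 arrow l ⟶ i, which all degree 0 arrows kill. -/
lemma topState_singleP (i : Fin n) : TopState (singleP k i) 0 0 i true where
  low s d hd m hm := singleP_supportedIn i s d (by omega) m hm
  exact_lt s hs m _ _ := by
    rw [singleP_eq_zero i (by omega) m]; exact isBdry_zero
  soc l hl := by
    refine ⟨singleElt i (bas k l i false), singleElt_mem i (bas_false_mem l i),
      e_smul_singleElt l i false, singleP_cocycle i 0 _,
      fun h => singleElt_bas_ne_zero l i false (singleP_not_bdry i h), fun p hp => ?_⟩
    rw [← map_smul, smul_eq_mul, bas_false_mul_bas_false hp, if_neg (by tauto), map_zero]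
    exact isBdry_zero
  pos _ := ⟨singleElt i (bas k i i false), singleElt_mem i (bas_false_mem i i),
      e_smul_singleElt i i false, singleP_cocycle i 0 _,
      fun h => singleElt_bas_ne_zero i i false (singleP_not_bdry i h)⟩
  neg h := absurd h (by simp)

lemma coef_bas_mul {l i q : Fin n} (hl : l ≠ i) (hq : l ≠ q) {a : ZigzagAlgebra k n}
    (ha : a * e i = a) : coef k l i true (bas k l q false * a) = 0 := by
  rw [eq_sum_bas i ha]
  simp only [Finset.mul_sum, Fintype.sum_bool, mul_add, map_sum, map_add, mul_smul_comm, map_smul,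
    bas_false_mul_bas_true hq, bas_false_mul_bas_false hq]
  refine Finset.sum_eq_zero fun l' _ => ?_
  split_ifs <;> simp [coef_bas, hl]

/-- In its highest degree the same Pᵢ looks like a complex to which σᵢ⁻¹ was applied last: zᵢ at the
vertex i, and at l ≠ i the degree 1 arrow l ⟶ i, which is not reached by degree 0 arrows. -/
lemma botState_singleP (i : Fin n) : BotState (singleP k i) 1 0 i false where
  high s d hd m hm := singleP_supportedIn i s d (by omega) m hm
  exact_gt s hs m _ _ := by
    rw [singleP_eq_zero i (by omega) m]; exact isBdry_zero
  top l hl := by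
    refine ⟨singleElt i (bas k l i true), singleElt_mem i (bas_mem l i true),
      e_smul_singleElt l i true, singleP_cocycle i 0 _, fun g _ _ h => ?_⟩
    have h0 := congrArg (fun v => coef k l i true (singleVal i v)) (singleP_not_bdry i h)
    rw [map_sub, map_sub, map_sum, map_sum, singleVal_singleElt, bas_mul_e, coef_bas,
      if_pos ⟨rfl, rfl⟩, map_zero, map_zero, Finset.sum_eq_zero, sub_zero] at h0
    · exact one_ne_zero h0
    · intro q hq
      rw [map_smul, smul_eq_mul]
      exact coef_bas_mul hl (Finset.ne_of_mem_erase hq).symm (singleVal_mul_e i _)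
  pos h := absurd h (by simp)
  neg _ := ⟨singleElt i (bas k i i true), singleElt_mem i (bas_mem i i true),
      e_smul_singleElt i i true, singleP_cocycle i 0 _,
      fun h => singleElt_bas_ne_zero i i true (singleP_not_bdry i h)⟩

lemma isReduced_of_cons {a b : Fin n × Bool} {L : List (Fin n × Bool)}
    (h : FreeGroup.IsReduced (a :: L)) (hb : L.head? = some b) :
    FreeGroup.IsReduced L ∧ (a.1 = b.1 → a.2 = b.2) := by
  cases L with
  | nil => simp at hb
  | cons c L =>
    simp only [List.head?_cons, Option.some.injEq] at hb
    subst hb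
    rw [FreeGroup.isReduced_cons_cons] at h
    exact ⟨h.2, h.1⟩

/-- The test object plays the part of a letter σ at `i0` appended to the word, whence the
reducedness of the longer word. The state always records the first letter of that word, which is the
one applied last. -/
lemma topState_PsiComplex (i0 : Fin n) (w : List (Fin n × Bool))
    (hw : FreeGroup.IsReduced (w ++ [(i0, true)])) (i : Fin n) (ε : Bool)
    (hi : (w ++ [(i0, true)]).head? = some (i, ε)) :
    ∃ t, TopState (PsiComplex k w (singleP k i0)) (-numPos w) t i ε := by
  induction w generalizing i ε with
  | nil =>
    simp only [List.nil_append, List.head?_cons, Option.some.injEq, Prod.mk.injEq] at hi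
    obtain ⟨rfl, rfl⟩ := hi
    exact ⟨0, by simpa [PsiComplex] using topState_singleP i0⟩
  | cons c w ih =>
    obtain ⟨j, δ⟩ := c
    simp only [List.cons_append, List.head?_cons, Option.some.injEq, Prod.mk.injEq] at hi
    obtain ⟨rfl, rfl⟩ := hi
    obtain ⟨⟨i, ε⟩, hb⟩ : ∃ b, (w ++ [(i0, true)]).head? = some b := by
      cases w <;> simp
    obtain ⟨h1, h2⟩ := isReduced_of_cons hw hb
    obtain ⟨t, S⟩ := ih h1 i ε hb
    cases δ
    · rw [numPos_cons_false]
      -- If the letter has the same index as the preceding one, reducedness makes the signs equal,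
      -- so a negative letter here repeats a negative one.
      by_cases hj : j = i
      · subst hj
        obtain rfl : false = ε := h2 rfl
        exact ⟨t, S.invCone_self (Zigzag.invCone j _)⟩
      · rw [← sub_add_cancel t 1] at S
        exact ⟨t - 1, S.invCone (Zigzag.invCone j _) hj⟩
    · have := S.unitCone (Zigzag.unitCone j _) (fun h => (h2 h).symm)
      rw [numPos_cons_true]
      exact ⟨t + 1, by
        rw [show -((numPos w + 1 : ℕ) : ℤ) = -numPos w - 1 by push_cast; ring]
        exact this⟩

/-- Same induction with the signs exchanged. The test object now stands for an inverse letter, and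
the additional 1 is the degree of the loop in P at `i0`. -/
lemma botState_PsiComplex (i0 : Fin n) (w : List (Fin n × Bool))
    (hw : FreeGroup.IsReduced (w ++ [(i0, false)])) (i : Fin n) (ε : Bool)
    (hi : (w ++ [(i0, false)]).head? = some (i, ε)) :
    ∃ t, BotState (PsiComplex k w (singleP k i0)) (numNeg w + 1) t i ε := by
  induction w generalizing i ε with
  | nil =>
    simp only [List.nil_append, List.head?_cons, Option.some.injEq, Prod.mk.injEq] at hi
    obtain ⟨rfl, rfl⟩ := hi
    exact ⟨0, by simpa [PsiComplex] using botState_singleP i0⟩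
  | cons c w ih =>
    obtain ⟨j, δ⟩ := c
    simp only [List.cons_append, List.head?_cons, Option.some.injEq, Prod.mk.injEq] at hi
    obtain ⟨rfl, rfl⟩ := hi
    obtain ⟨⟨i, ε⟩, hb⟩ : ∃ b, (w ++ [(i0, false)]).head? = some b := by
      cases w <;> simp
    obtain ⟨h1, h2⟩ := isReduced_of_cons hw hb
    obtain ⟨t, S⟩ := ih h1 i ε hb
    cases δ
    · rw [numNeg_cons_false, Nat.cast_add, Nat.cast_one]
      rw [← sub_add_cancel t 1] at S
      exact ⟨t - 1, S.invCone (Zigzag.invCone j _) (fun h => (h2 h).symm)⟩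
    · rw [numNeg_cons_true]
      by_cases hj : j = i
      · subst hj
        obtain rfl : true = ε := h2 rfl
        exact ⟨t, S.unitCone_self (Zigzag.unitCone j _)⟩
      · exact ⟨t + 1, S.unitCone (Zigzag.unitCone j _) hj⟩

end Zigzag

/-! ### The split exact sequence T M → T T M → T M -/

namespace Zigzag
namespace GrProj
open ZigzagAlgebra

variable {k : Type u} [Field k] {n : ℕ} {j : Fin n} {M N : GrProj k n}

/-- The map `A eⱼ ⊗ eⱼ M ⟶ A eⱼ ⊗ eⱼ N` induced by a map of vector spaces. -/
def idemLift (j : Fin n) (g : M →ₗ[k] N) : tensor j M →ₗ[ZigzagAlgebra k n] tensor j N :=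
  (TensorProduct.AlgebraTensorModule.map LinearMap.id
    (toIdemPart j N ∘ₗ g ∘ₗ (idemPart j M).subtype) :
    leftIdeal k j ⊗[k] idemPart j M →ₗ[ZigzagAlgebra k n] leftIdeal k j ⊗[k] idemPart j N)

lemma co_idemLift (g : M →ₗ[k] N) (l : Fin n) (δ : Bool) (u : tensor j M) :
    co N l δ (idemLift j g u) = (e j : ZigzagAlgebra k n) • g (co M l δ u) := by
  induction u using tensor_induction with
  | h0 => simp only [map_zero, smul_zero]
  | hadd u v hu hv => simp only [map_add, hu, hv, smul_add]
  | ht a m =>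
    refine (?_ : coef k l j δ (a : ZigzagAlgebra k n) • (e j : ZigzagAlgebra k n) • g m = _)
    rw [co_tmul, map_smul, smul_comm]

lemma mem_deg_of_co {u : tensor j M} {d : ℤ} (h : ∀ l δ, co M l δ u ∈ M.deg (d - dg δ)) :
    u ∈ (tensor j M).deg d := by
  rw [tensor_eq_sum u]
  refine Submodule.sum_mem _ fun l _ => Submodule.sum_mem _ fun δ _ => ?_
  have := tm_mem (j := j) l δ (h l δ)
  rwa [add_sub_cancel] at this

lemma idemLift_mem {g : M →ₗ[k] N} {c : ℤ} (hg : ∀ d, ∀ m ∈ M.deg d, g m ∈ N.deg (d + c)) {d : ℤ}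
    {u : tensor j M} (hu : u ∈ (tensor j M).deg d) : idemLift j g u ∈ (tensor j N).deg (d + c) :=
  mem_deg_of_co fun l δ => by
    rw [co_idemLift]
    have := N.smul_mem (e_mem j) (hg _ _ (co_mem l δ hu))
    rwa [show 0 + (d - dg δ + c) = d + c - dg δ by ring] at this

/-- The map `A eⱼ ⊗ eⱼ A eⱼ ⊗ eⱼ M ⟶ A eⱼ ⊗ eⱼ M` that extracts the coefficient of the loop. -/
def contract (j : Fin n) (M : GrProj k n) :
    tensor j (tensor j M) →ₗ[ZigzagAlgebra k n] tensor j M := idemLift j (co M j true)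

/-- The map `A eⱼ ⊗ eⱼ M ⟶ A eⱼ ⊗ eⱼ A eⱼ ⊗ eⱼ M` that inserts the idempotent. -/
def insert (j : Fin n) (M : GrProj k n) :
    tensor j M →ₗ[ZigzagAlgebra k n] tensor j (tensor j M) := idemLift j (tm M j false)

lemma co_contract (l : Fin n) (δ : Bool) (v : tensor j (tensor j M)) :
    co M l δ (contract j M v) = co M j true (co (tensor j M) l δ v) :=
  (co_idemLift _ _ _ _).trans (e_smul_co _ _ _)

lemma co_insert (l : Fin n) (δ : Bool) (u : tensor j M) :
    co (tensor j M) l δ (insert j M u) = tm M j false (co M l δ u) := by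
  refine (co_idemLift _ _ _ _).trans ?_
  rw [e_smul_tm, if_pos rfl]

lemma contract_insert (u : tensor j M) : contract j M (insert j M u) = 0 :=
  tensor_ext fun l δ => by
    rw [co_contract, co_insert, co_tm, if_neg (by simp), map_zero]

lemma eq_tm_add_tm {x : tensor j M} (hx : (e j : ZigzagAlgebra k n) • x = x) :
    x = tm M j false (co M j false x) + tm M j true (co M j true x) := by
  conv_lhs => rw [← hx, tensor_eq_sum x, Finset.smul_sum, Finset.sum_eq_single j
    (fun l _ hl => by simp only [Finset.smul_sum, e_smul_tm, if_neg hl.symm,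
      Finset.sum_const_zero]) (fun h => absurd (Finset.mem_univ _) h)]
  rw [Fintype.sum_bool, smul_add, e_smul_tm, e_smul_tm, if_pos rfl, if_pos rfl, add_comm]

/-- The middle factor eⱼ A eⱼ of T T M has basis eⱼ, zⱼ, so an element without zⱼ-part is inserted
from T M. This is exactness in the middle. -/
lemma exists_insert {v : tensor j (tensor j M)} (hv : contract j M v = 0) :
    ∃ w, v = insert j M w := by
  refine ⟨∑ l, ∑ δ, tm M l δ (co M j false (co (tensor j M) l δ v)), tensor_ext fun l δ => ?_⟩
  have h := eq_tm_add_tm (e_smul_co (M := tensor j M) l δ v)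
  rw [← co_contract, hv, map_zero, map_zero, add_zero] at h
  rw [co_insert]
  simp only [map_sum, co_tm, e_smul_co]
  rw [Finset.sum_eq_single l, Finset.sum_eq_single δ]
  · simpa using h
  · intro b _ hb; rw [if_neg (by tauto), map_zero]
  · simp
  · intro b _ hb; exact Finset.sum_eq_zero fun _ _ => by rw [if_neg (by tauto), map_zero]
  · simp

/-- The elements `bas k j l (!δ)` and `bas k l j δ` form dual bases for the pairing that takes the
loop coefficient of a product. This is why `contract` splits the unit. -/
lemma coef_bas_mul_bas (l l' : Fin n) (δ δ' : Bool) :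
    coef k j j true (bas k j l (!δ) * bas k l' j δ') = if l = l' ∧ δ = δ' then 1 else 0 := by
  by_cases h : l = j
  · subst h
    by_cases h' : l' = l
    · subst h'
      cases δ <;> cases δ' <;> simp [bas_self_false, bas_self_true, coef_self_true, z_mul_e, z_loop,
        e_mul_z, e_mul_e, z_mul_z, e_loop]
    · rw [if_neg (by tauto), bas_ne h']
      cases δ
      · simp [bas_self_true, coef_self_true, z_mul_ofArrow]
      · rw [Bool.not_true, bas_self_false, e_mul_ofArrow, Arrow.between_src, if_neg h', map_zero]
  · by_cases h' : l' = j
    · subst h'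
      rw [if_neg (by tauto), bas_ne (Ne.symm h)]
      cases δ' <;> simp [bas_self_false, bas_self_true, coef_self_true, ofArrow_mul_z,
        ofArrow_mul_e, h]
    · rw [bas_ne h', bas_ne (Ne.symm h), ofArrow_mul_ofArrow, Arrow.between_star]
      by_cases hh : l = l' ∧ δ = δ'
      · obtain ⟨rfl, rfl⟩ := hh
        simp [coef_self_true, z_loop]
      · rw [if_neg hh, if_neg, map_zero]
        intro h3
        obtain ⟨h4, -, h5⟩ := Arrow.between_inj h3
        exact hh ⟨h4.symm, by simpa using h5.symm⟩

lemma co_bas_smul (l : Fin n) (δ : Bool) (u : tensor j M) :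
    co M j true (bas k j l (!δ) • u) = co M l δ u := by
  induction u using tensor_induction with
  | h0 => simp
  | hadd u v hu hv => simp only [smul_add, map_add, hu, hv]
  | ht a m =>
    refine (?_ : coef k j j true (bas k j l (!δ) * (a : ZigzagAlgebra k n)) • (m : M) = _)
    rw [co_tmul, eq_sum_bas j (a := (a : ZigzagAlgebra k n)) a.2]
    simp only [Finset.mul_sum, map_sum, mul_smul_comm, map_smul, coef_bas_mul_bas, coef_bas]

lemma contract_unit (u : tensor j M) : contract j M (unitLin j (tensor j M) u) = u :=
  tensor_ext fun l δ => by rw [co_contract, co_unit, co_bas_smul]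

lemma counit_insert (u : tensor j M) : Hom.lin (counitHom j (tensor j M)) (insert j M u) = u := by
  rw [tensor_eq_sum (insert j M u), map_sum]
  simp only [map_sum, counit_tm, co_insert]
  conv_rhs => rw [tensor_eq_sum u]
  refine Finset.sum_congr rfl fun l _ => Finset.sum_congr rfl fun δ _ => ?_
  rw [smul_tm, bas_self_false, bas_mul_e]
  rfl

lemma tensorMap_counit_insert (u : tensor j M) :
    Hom.lin (tensorMap j (counitHom j M)) (insert j M u) = u :=
  tensor_ext fun l δ => by
    rw [co_tensorFunctor_map, co_insert, counit_tm, bas_self_false, e_smul_co]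

lemma contract_naturality (f : M ⟶ N) (v : tensor j (tensor j M)) :
    contract j N (Hom.lin (tensorMap j (tensorMap j f)) v) =
      Hom.lin (tensorMap j f) (contract j M v) :=
  tensor_ext fun l δ => by
    simp only [co_contract, co_tensorFunctor_map]

lemma insert_naturality (f : M ⟶ N) (v : tensor j M) :
    insert j N (Hom.lin (tensorMap j f) v) =
      Hom.lin (tensorMap j (tensorMap j f)) (insert j M v) :=
  tensor_ext fun l δ => by
    simp only [co_insert, co_tensorFunctor_map, tensorFunctor_map_tm]

lemma contract_mem {d : ℤ} {v : tensor j (tensor j M)} (hv : v ∈ (tensor j (tensor j M)).deg d) :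
    contract j M v ∈ (tensor j M).deg (d - 1) :=
  idemLift_mem (fun _ _ hm => co_mem j true hm) hv

lemma insert_mem {d : ℤ} {v : tensor j M} (hv : v ∈ (tensor j M).deg d) :
    insert j M v ∈ (tensor j (tensor j M)).deg d := by
  have := idemLift_mem (c := 0) (fun _ m hm => by
    have := tm_mem (j := j) j false hm
    rwa [dg_false, add_comm] at this) hv
  rwa [add_zero] at this

end GrProj
end Zigzag

/-! ### Contracting the total complex of a square to one corner -/

namespace Zigzag

/-- A presentation of `Z` as the total complex of a commutative square with sides `i : A ⟶ B`,
`e : A ⟶ Y`, `p : B ⟶ W` and `η : Y ⟶ W`, where `A`, `B` and `W` have the differentials `dA`, `dB`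
and `dW`. -/
structure SquareTotal {C : Type*} [Category C] [Preadditive C] {A B W : ℤ → C}
    {Y : CochainComplex C ℤ} (dA : ∀ s r, A s ⟶ A r) (dB : ∀ s r, B s ⟶ B r)
    (dW : ∀ s r, W s ⟶ W r) (i : ∀ s, A s ⟶ B s) (e : ∀ s, A s ⟶ Y.X s) (p : ∀ s, B s ⟶ W s)
    (η : ∀ s, Y.X s ⟶ W s) (Z : CochainComplex C ℤ) where
  iA : ∀ s r, s + 1 = r → (A r ⟶ Z.X s)
  iB : ∀ s, B s ⟶ Z.X s
  iY : ∀ s, Y.X s ⟶ Z.X s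
  iW : ∀ q s, q + 1 = s → (W q ⟶ Z.X s)
  pB : ∀ s, Z.X s ⟶ B s
  pY : ∀ s, Z.X s ⟶ Y.X s
  pW : ∀ q s, q + 1 = s → (Z.X s ⟶ W q)
  iA_pB : ∀ s r h, iA s r h ≫ pB s = 0
  iA_pY : ∀ s r h, iA s r h ≫ pY s = 0
  iA_pW : ∀ s r h q h', iA s r h ≫ pW q s h' = 0
  iB_pB : ∀ s, iB s ≫ pB s = 𝟙 _
  iB_pY : ∀ s, iB s ≫ pY s = 0
  iB_pW : ∀ q s h, iB s ≫ pW q s h = 0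
  iY_pB : ∀ s, iY s ≫ pB s = 0
  iY_pY : ∀ s, iY s ≫ pY s = 𝟙 _
  iY_pW : ∀ q s h, iY s ≫ pW q s h = 0
  iW_pB : ∀ q s h, iW q s h ≫ pB s = 0
  iW_pY : ∀ q s h, iW q s h ≫ pY s = 0
  iW_pW : ∀ q s h, iW q s h ≫ pW q s h = 𝟙 _
  ext : ∀ (q s r : ℤ) (h : q + 1 = s) (h' : s + 1 = r) {T : C} {φ ψ : Z.X s ⟶ T},
    iA s r h' ≫ φ = iA s r h' ≫ ψ → iB s ≫ φ = iB s ≫ ψ → iY s ≫ φ = iY s ≫ ψ →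
    iW q s h ≫ φ = iW q s h ≫ ψ → φ = ψ
  iA_d : ∀ s r r' (h : s + 1 = r) (h' : r + 1 = r'), iA s r h ≫ Z.d s r =
    -(dA r r' ≫ iA r r' h') + i r ≫ iB r + e r ≫ iY r
  iB_d : ∀ s r (h : s + 1 = r), iB s ≫ Z.d s r = dB s r ≫ iB r + p s ≫ iW s r h
  iY_d : ∀ s r (h : s + 1 = r), iY s ≫ Z.d s r = Y.d s r ≫ iY r - η s ≫ iW s r h
  iW_d : ∀ q s r (h : q + 1 = s) (h' : s + 1 = r), iW q s h ≫ Z.d s r = -(dW q s ≫ iW s r h')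

namespace SquareTotal

variable {C : Type*} [Category C] [Preadditive C] {A B W : ℤ → C} {Y Z : CochainComplex C ℤ}
  {dA : ∀ s r, A s ⟶ A r} {dB : ∀ s r, B s ⟶ B r} {dW : ∀ s r, W s ⟶ W r}
  {i : ∀ s, A s ⟶ B s} {e : ∀ s, A s ⟶ Y.X s} {p : ∀ s, B s ⟶ W s} {η : ∀ s, Y.X s ⟶ W s}
  (S : SquareTotal dA dB dW i e p η Z)

/-- Splittings that contract the total complex of a square to one of its corners. -/
structure Splitting {C : Type*} [Category C] [Preadditive C] {A B W : ℤ → C}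
    {Y : CochainComplex C ℤ} (dA : ∀ s r, A s ⟶ A r) (dB : ∀ s r, B s ⟶ B r)
    (dW : ∀ s r, W s ⟶ W r) (i : ∀ s, A s ⟶ B s) (e : ∀ s, A s ⟶ Y.X s) (p : ∀ s, B s ⟶ W s)
    (η : ∀ s, Y.X s ⟶ W s) where
  ρ : ∀ s, B s ⟶ A s
  l : ∀ s, W s ⟶ B s
  i_ρ : ∀ s, i s ≫ ρ s = 𝟙 _
  l_p : ∀ s, l s ≫ p s = 𝟙 _
  l_ρ : ∀ s, l s ≫ ρ s = 0
  i_p : ∀ s, i s ≫ p s = e s ≫ η s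
  p_l : ∀ s, p s ≫ l s + ρ s ≫ i s = 𝟙 _ + ρ s ≫ i s ≫ p s ≫ l s
  e_d : ∀ s r, e s ≫ Y.d s r = dA s r ≫ e r
  η_d : ∀ s r, η s ≫ dW s r = Y.d s r ≫ η r
  ρ_d : ∀ s r, ρ s ≫ dA s r = dB s r ≫ ρ r
  l_d : ∀ s r, l s ≫ dB s r = dW s r ≫ l r

variable (σ : Splitting dA dB dW i e p η)

/-- The projection of the total complex to `Y`. -/
def toY : Z ⟶ Y where
  -- The second term makes the map vanish on the sums i a + e a, which are the components of the
  -- differential of A in B and Y.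
  f s := S.pY s - S.pB s ≫ σ.ρ s ≫ e s
  comm' s r (h : s + 1 = r) := by
    refine S.ext (s - 1) s r (by omega) h ?_ ?_ ?_ ?_
    · simp only [Preadditive.comp_sub, Preadditive.sub_comp, reassoc_of% S.iA_d s r (r + 1) h rfl,
        Preadditive.add_comp, Preadditive.neg_comp, Category.assoc, S.iA_pY, S.iB_pY, S.iY_pY,
        reassoc_of% S.iA_pB, reassoc_of% S.iB_pB, reassoc_of% S.iY_pB,
        reassoc_of% S.iA_pY, reassoc_of% σ.i_ρ]
      simp
    · simp only [Preadditive.comp_sub, Preadditive.sub_comp, reassoc_of% S.iB_d s r h,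
        Preadditive.add_comp, Category.assoc, S.iB_pY, S.iW_pY, reassoc_of% S.iB_pB,
        reassoc_of% S.iW_pB, reassoc_of% S.iB_pY, σ.e_d, reassoc_of% σ.ρ_d]
      simp
    · simp only [Preadditive.comp_sub, Preadditive.sub_comp, reassoc_of% S.iY_d s r h,
        Category.assoc, S.iY_pY, S.iW_pY, reassoc_of% S.iY_pB, reassoc_of% S.iW_pB,
        reassoc_of% S.iY_pY]
      simp
    · simp only [Preadditive.comp_sub, Preadditive.sub_comp,
        reassoc_of% S.iW_d (s - 1) s r (by omega) h, Preadditive.neg_comp, Category.assoc,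
        S.iW_pY, reassoc_of% S.iW_pB, reassoc_of% S.iW_pY]
      simp

/-- The inclusion of `Y` into the total complex. -/
def ofY : Y ⟶ Z where
  -- The B-component is chosen with image η y under p, which cancels the W-component of the
  -- differential of y.
  f s := η s ≫ σ.l s ≫ S.iB s + S.iY s
  comm' s r (h : s + 1 = r) := by
    simp only [Preadditive.add_comp, Preadditive.comp_add, Category.assoc, S.iB_d s r h,
      S.iY_d s r h, reassoc_of% σ.l_p, reassoc_of% σ.l_d, reassoc_of% σ.η_d]
    simp

lemma ofY_toY : S.ofY σ ≫ S.toY σ = 𝟙 Y := by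
  ext s
  simp only [HomologicalComplex.comp_f, ofY, toY, Preadditive.add_comp, Preadditive.comp_sub,
    Category.assoc, S.iB_pY, S.iY_pY, reassoc_of% S.iB_pB, reassoc_of% S.iY_pB,
    reassoc_of% σ.l_ρ, HomologicalComplex.id_f]
  simp

/-- The homotopy between the identity of the total complex and the projection to `Y`. -/
def homotopy : Homotopy (𝟙 Z) (S.toY σ ≫ S.ofY σ) where
  -- The homotopy inverts i by ρ and p by l. The two parts do not interfere because l ≫ ρ = 0.
  hom s r := if h : r + 1 = s then
    S.pB s ≫ σ.ρ s ≫ S.iA r s h + S.pW r s h ≫ σ.l r ≫ S.iB r else 0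
  zero s r hsr := dif_neg hsr
  comm s := by
    -- On B the maps p l and ρ i do not add up to the identity, since i p = e η need not vanish; the
    -- defect ρ e η l is exactly what the composite through Y contributes.
    have h : p s ≫ σ.l s ≫ S.iB s = S.iB s + σ.ρ s ≫ e s ≫ η s ≫ σ.l s ≫ S.iB s -
        σ.ρ s ≫ i s ≫ S.iB s := by
      have := congrArg (· ≫ S.iB s) (σ.p_l s)
      simp only [Preadditive.add_comp, Category.assoc, Category.id_comp,
        reassoc_of% σ.i_p] at this
      rw [← this, add_sub_cancel_right]
    have hs : s - 1 + 1 = s := by omega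
    rw [dNext_eq _ (show (ComplexShape.up ℤ).Rel s (s + 1) from rfl),
      prevD_eq _ (show (ComplexShape.up ℤ).Rel (s - 1) s from hs), dif_pos rfl, dif_pos hs]
    simp only [HomologicalComplex.comp_f, ofY, toY, HomologicalComplex.id_f, Preadditive.add_comp,
      Preadditive.comp_add, Category.assoc, Preadditive.sub_comp,
      S.iA_d (s - 1) s (s + 1) hs rfl, S.iB_d (s - 1) s hs]
    refine S.ext (s - 1) s (s + 1) hs rfl ?_ ?_ ?_ ?_
    · simp only [Preadditive.comp_add, Preadditive.comp_sub, Preadditive.comp_neg,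
        reassoc_of% S.iA_d s (s + 1) (s + 1 + 1) rfl rfl, Preadditive.add_comp,
        Preadditive.neg_comp, Category.assoc, reassoc_of% S.iA_pB, reassoc_of% S.iB_pB,
        reassoc_of% S.iY_pB, reassoc_of% S.iA_pW, reassoc_of% S.iB_pW, reassoc_of% S.iY_pW,
        reassoc_of% S.iA_pY, reassoc_of% σ.i_ρ]
      simp
    · simp only [Preadditive.comp_add, Preadditive.comp_sub, Preadditive.comp_neg,
        reassoc_of% S.iB_d s (s + 1) rfl, Preadditive.add_comp, Category.assoc,
        reassoc_of% S.iB_pB, reassoc_of% S.iW_pB, reassoc_of% S.iB_pW, reassoc_of% S.iW_pW,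
        reassoc_of% S.iB_pY, h, reassoc_of% σ.ρ_d]
      simp
      abel
    · simp only [Preadditive.comp_add, Preadditive.comp_sub, Preadditive.comp_neg,
        reassoc_of% S.iY_d s (s + 1) rfl, Preadditive.sub_comp, Category.assoc,
        reassoc_of% S.iY_pB, reassoc_of% S.iW_pB, reassoc_of% S.iY_pW, reassoc_of% S.iW_pW,
        reassoc_of% S.iY_pY]
      simp
    · simp only [Preadditive.comp_add, Preadditive.comp_sub, Preadditive.comp_neg,
        reassoc_of% S.iW_d (s - 1) s (s + 1) hs rfl, Preadditive.neg_comp, Category.assoc,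
        reassoc_of% S.iW_pB, reassoc_of% S.iW_pW, reassoc_of% S.iW_pY, reassoc_of% σ.l_p,
        reassoc_of% σ.l_d]
      simp

/-- The total complex of a square with suitable splittings is homotopy equivalent to `Y`. -/
def homotopyEquiv : HomotopyEquiv Z Y where
  hom := S.toY σ
  inv := S.ofY σ
  homotopyHomInvId := (S.homotopy σ).symm
  homotopyInvHomId := Homotopy.ofEq (S.ofY_toY σ)

end SquareTotal
end Zigzag

/-! ### Iterated cones as total complexes of squares -/

namespace Zigzag

section AbstractCones

variable {C : Type*} [Category C] [Preadditive C] {T S : C ⥤ C}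

/-- A presentation of `Y'` as the cone of a map `T Y ⟶ Y`. -/
structure LeftCone (ε : ∀ X, T.obj X ⟶ X) (Y Y' : CochainComplex C ℤ) where
  iu : ∀ s r, s + 1 = r → (T.obj (Y.X r) ⟶ Y'.X s)
  iy : ∀ s, Y.X s ⟶ Y'.X s
  pu : ∀ s r, s + 1 = r → (Y'.X s ⟶ T.obj (Y.X r))
  py : ∀ s, Y'.X s ⟶ Y.X s
  iu_pu : ∀ s r h, iu s r h ≫ pu s r h = 𝟙 _
  iu_py : ∀ s r h, iu s r h ≫ py s = 0
  iy_pu : ∀ s r h, iy s ≫ pu s r h = 0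
  iy_py : ∀ s, iy s ≫ py s = 𝟙 _
  total : ∀ s r h, pu s r h ≫ iu s r h + py s ≫ iy s = 𝟙 _
  iu_d : ∀ s r r' (h : s + 1 = r) (h' : r + 1 = r'), iu s r h ≫ Y'.d s r =
    -(T.map (Y.d r r') ≫ iu r r' h') + ε (Y.X r) ≫ iy r
  iy_d : ∀ s r, iy s ≫ Y'.d s r = Y.d s r ≫ iy r

/-- A presentation of `Y'` as the cone of a map `Y ⟶ S Y` shifted by `[-1]`. -/
structure RightCone (η : ∀ X, X ⟶ S.obj X) (Y Y' : CochainComplex C ℤ) where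
  iu : ∀ r s, r + 1 = s → (S.obj (Y.X r) ⟶ Y'.X s)
  iy : ∀ s, Y.X s ⟶ Y'.X s
  pu : ∀ r s, r + 1 = s → (Y'.X s ⟶ S.obj (Y.X r))
  py : ∀ s, Y'.X s ⟶ Y.X s
  iu_pu : ∀ r s h, iu r s h ≫ pu r s h = 𝟙 _
  iu_py : ∀ r s h, iu r s h ≫ py s = 0
  iy_pu : ∀ r s h, iy s ≫ pu r s h = 0
  iy_py : ∀ s, iy s ≫ py s = 𝟙 _
  total : ∀ r s h, pu r s h ≫ iu r s h + py s ≫ iy s = 𝟙 _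
  iu_d : ∀ r s s' (h : r + 1 = s) (h' : s + 1 = s'), iu r s h ≫ Y'.d s s' =
    -(S.map (Y.d r s) ≫ iu s s' h')
  iy_d : ∀ s s' (h : s + 1 = s'), iy s ≫ Y'.d s s' =
    Y.d s s' ≫ iy s' - η (Y.X s) ≫ iu s s' h

variable {ε : ∀ X, T.obj X ⟶ X} {η : ∀ X, X ⟶ S.obj X} {Y Y₁ Z : CochainComplex C ℤ}

lemma LeftCone.map_ext (F : C ⥤ C) [F.Additive] (K : LeftCone ε Y Z) {s r : ℤ} (h : s + 1 = r)
    {X : C} {φ ψ : F.obj (Z.X s) ⟶ X} (hu : F.map (K.iu s r h) ≫ φ = F.map (K.iu s r h) ≫ ψ)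
    (hy : F.map (K.iy s) ≫ φ = F.map (K.iy s) ≫ ψ) : φ = ψ := by
  rw [← Category.id_comp φ, ← Category.id_comp ψ, ← F.map_id, ← K.total s r h]
  simp only [F.map_add, F.map_comp, Preadditive.add_comp, Category.assoc, hu, hy]

lemma RightCone.map_ext (F : C ⥤ C) [F.Additive] (K : RightCone η Y Z) {s r : ℤ} (h : r + 1 = s)
    {X : C} {φ ψ : F.obj (Z.X s) ⟶ X} (hu : F.map (K.iu r s h) ≫ φ = F.map (K.iu r s h) ≫ ψ)
    (hy : F.map (K.iy s) ≫ φ = F.map (K.iy s) ≫ ψ) : φ = ψ := by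
  rw [← Category.id_comp φ, ← Category.id_comp ψ, ← F.map_id, ← K.total r s h]
  simp only [F.map_add, F.map_comp, Preadditive.add_comp, Category.assoc, hu, hy]

/-- A left cone of a right cone is the total complex of a square. -/
def RightCone.squareTotal [T.Additive] (hε : ∀ {X X'} (f : X ⟶ X'), T.map f ≫ ε X' = ε X ≫ f)
    (K : RightCone η Y Y₁) (L : LeftCone ε Y₁ Z) :
    SquareTotal (fun s r => T.map (Y.d s r)) (fun s r => T.map (S.map (Y.d s r)))
      (fun s r => S.map (Y.d s r)) (fun s => T.map (η (Y.X s))) (fun s => ε (Y.X s))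
      (fun s => ε (S.obj (Y.X s))) (fun s => η (Y.X s)) Z where
  iA s r h := T.map (K.iy r) ≫ L.iu s r h
  iB s := T.map (K.iu s (s + 1) rfl) ≫ L.iu s (s + 1) rfl
  iY s := K.iy s ≫ L.iy s
  iW q s h := K.iu q s h ≫ L.iy s
  pB s := L.pu s (s + 1) rfl ≫ T.map (K.pu s (s + 1) rfl)
  pY s := L.py s ≫ K.py s
  pW q s h := L.py s ≫ K.pu q s h
  iA_pB s r h := by
    subst h
    rw [Category.assoc, reassoc_of% L.iu_pu, ← T.map_comp, K.iy_pu, T.map_zero]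
  iA_pY s r h := by rw [Category.assoc, reassoc_of% L.iu_py, zero_comp, comp_zero]
  iA_pW s r h q h' := by rw [Category.assoc, reassoc_of% L.iu_py, zero_comp, comp_zero]
  iB_pB s := by rw [Category.assoc, reassoc_of% L.iu_pu, ← T.map_comp, K.iu_pu, T.map_id]
  iB_pY s := by rw [Category.assoc, reassoc_of% L.iu_py, zero_comp, comp_zero]
  iB_pW q s h := by rw [Category.assoc, reassoc_of% L.iu_py, zero_comp, comp_zero]
  iY_pB s := by rw [Category.assoc, reassoc_of% L.iy_pu, zero_comp, comp_zero]
  iY_pY s := by rw [Category.assoc, reassoc_of% L.iy_py, K.iy_py]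
  iY_pW q s h := by rw [Category.assoc, reassoc_of% L.iy_py, K.iy_pu]
  iW_pB q s h := by rw [Category.assoc, reassoc_of% L.iy_pu, zero_comp, comp_zero]
  iW_pY q s h := by rw [Category.assoc, reassoc_of% L.iy_py, K.iu_py]
  iW_pW q s h := by rw [Category.assoc, reassoc_of% L.iy_py, K.iu_pu]
  ext q s r h h' X φ ψ hA hB hY hW := by
    subst h'
    simp only [Category.assoc] at hA hB hY hW
    exact L.map_ext (𝟭 C) rfl (K.map_ext T rfl hB hA) (K.map_ext (𝟭 C) h hW hY)
  iA_d s r r' h h' := by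
    subst h'
    rw [Category.assoc, L.iu_d s r (r + 1) h rfl, Preadditive.comp_add, Preadditive.comp_neg,
      reassoc_of% hε, ← T.map_comp_assoc, K.iy_d r (r + 1) rfl, T.map_sub, T.map_comp, T.map_comp,
      Preadditive.sub_comp, neg_sub, sub_eq_neg_add]
    simp only [Category.assoc]
  iB_d s r h := by
    subst h
    rw [Category.assoc, L.iu_d s (s + 1) (s + 1 + 1) rfl rfl, Preadditive.comp_add,
      Preadditive.comp_neg, reassoc_of% hε, ← T.map_comp_assoc,
      K.iu_d s (s + 1) (s + 1 + 1) rfl rfl, T.map_neg, T.map_comp, Preadditive.neg_comp, neg_neg]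
    simp only [Category.assoc]
  iY_d s r h := by
    rw [Category.assoc, L.iy_d, reassoc_of% K.iy_d s r h, Preadditive.sub_comp]
    simp only [Category.assoc]
  iW_d q s r h h' := by
    rw [Category.assoc, L.iy_d, reassoc_of% K.iu_d q s r h h', Preadditive.neg_comp]
    simp only [Category.assoc]

/-- A right cone of a left cone is the total complex of a square. -/
def LeftCone.squareTotal [S.Additive] (hη : ∀ {X X'} (f : X ⟶ X'), f ≫ η X' = η X ≫ S.map f)
    (L : LeftCone ε Y Y₁) (K : RightCone η Y₁ Z) :
    SquareTotal (fun s r => T.map (Y.d s r)) (fun s r => S.map (T.map (Y.d s r)))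
      (fun s r => S.map (Y.d s r)) (fun s => η (T.obj (Y.X s))) (fun s => ε (Y.X s))
      (fun s => S.map (ε (Y.X s))) (fun s => η (Y.X s)) Z where
  iA s r h := L.iu s r h ≫ K.iy s
  -- This sign turns the term -η of the outer differential into the map A ⟶ B with positive sign, so
  -- that both orders of composition fit the same sign pattern.
  iB s := -(S.map (L.iu (s - 1) s (by omega)) ≫ K.iu (s - 1) s (by omega))
  iY s := L.iy s ≫ K.iy s
  iW q s h := S.map (L.iy q) ≫ K.iu q s h
  pB s := -(K.pu (s - 1) s (by omega) ≫ S.map (L.pu (s - 1) s (by omega)))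
  pY s := K.py s ≫ L.py s
  pW q s h := K.pu q s h ≫ S.map (L.py q)
  iA_pB s r h := by
    rw [Category.assoc, Preadditive.comp_neg, reassoc_of% K.iy_pu, zero_comp, neg_zero, comp_zero]
  iA_pY s r h := by rw [Category.assoc, reassoc_of% K.iy_py, L.iu_py]
  iA_pW s r h q h' := by rw [Category.assoc, reassoc_of% K.iy_pu, zero_comp, comp_zero]
  iB_pB s := by
    rw [Preadditive.neg_comp, Preadditive.comp_neg, neg_neg, Category.assoc,
      reassoc_of% K.iu_pu, ← S.map_comp, L.iu_pu, S.map_id]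
  iB_pY s := by
    rw [Preadditive.neg_comp, Category.assoc, reassoc_of% K.iu_py, zero_comp, comp_zero, neg_zero]
  iB_pW q s h := by
    obtain rfl : q = s - 1 := by omega
    rw [Preadditive.neg_comp, Category.assoc, reassoc_of% K.iu_pu, ← S.map_comp, L.iu_py,
      S.map_zero, neg_zero]
  iY_pB s := by
    rw [Category.assoc, Preadditive.comp_neg, reassoc_of% K.iy_pu, zero_comp, neg_zero, comp_zero]
  iY_pY s := by rw [Category.assoc, reassoc_of% K.iy_py, L.iy_py]
  iY_pW q s h := by rw [Category.assoc, reassoc_of% K.iy_pu, zero_comp, comp_zero]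
  iW_pB q s h := by
    obtain rfl : q = s - 1 := by omega
    rw [Category.assoc, Preadditive.comp_neg, reassoc_of% K.iu_pu, Preadditive.comp_neg,
      ← S.map_comp, L.iy_pu, S.map_zero, neg_zero]
  iW_pY q s h := by rw [Category.assoc, reassoc_of% K.iu_py, zero_comp, comp_zero]
  iW_pW q s h := by
    rw [Category.assoc, reassoc_of% K.iu_pu, ← S.map_comp, L.iy_py, S.map_id]
  ext q s r h h' X φ ψ hA hB hY hW := by
    obtain rfl : q = s - 1 := by omega
    simp only [Category.assoc, Preadditive.neg_comp, neg_inj] at hA hB hY hW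
    exact K.map_ext (𝟭 C) h (L.map_ext S _ hB hW) (L.map_ext (𝟭 C) h' hA hY)
  iA_d s r r' h h' := by
    obtain rfl : s = r - 1 := by omega
    rw [Category.assoc, K.iy_d _ r h, Preadditive.comp_sub, ← Category.assoc,
      L.iu_d _ r r' h h', reassoc_of% hη, Preadditive.add_comp, Preadditive.neg_comp,
      Preadditive.comp_neg]
    simp only [Category.assoc]
    abel
  iB_d s r h := by
    obtain rfl : s = r - 1 := by omega
    rw [Preadditive.neg_comp, Category.assoc, K.iu_d _ (r - 1) r (by omega) h,
      Preadditive.comp_neg, neg_neg, ← S.map_comp_assoc, L.iu_d _ (r - 1) r (by omega) h,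
      S.map_add, S.map_neg, S.map_comp, S.map_comp, Preadditive.add_comp, Preadditive.neg_comp,
      Preadditive.comp_neg]
    simp only [Category.assoc]
  iY_d s r h := by
    rw [Category.assoc, K.iy_d s r h, Preadditive.comp_sub, ← Category.assoc, L.iy_d,
      reassoc_of% hη]
    simp only [Category.assoc]
  iW_d q s r h h' := by
    rw [Category.assoc, K.iu_d q s r h h', Preadditive.comp_neg, ← S.map_comp_assoc, L.iy_d,
      S.map_comp, Category.assoc]

end AbstractCones
end Zigzag

/-! ### Σⱼ and Σⱼ⁻¹ are mutually inverse up to homotopy -/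

namespace Zigzag
open ZigzagAlgebra GrProj

variable {k : Type u} [Field k] {n : ℕ}

namespace GrProj

variable {j : Fin n} {M N : GrProj k n}

/-- The identity as a map to the shifted module. -/
def toShift (M : GrProj k n) (c : ℤ) : M →ₗ[ZigzagAlgebra k n] M.shift c := LinearMap.id

/-- The identity as a map from the shifted module. -/
def ofShift (M : GrProj k n) (c : ℤ) : M.shift c →ₗ[ZigzagAlgebra k n] M := LinearMap.id

lemma toShift_ofShift {c : ℤ} (m : M.shift c) : toShift M c (ofShift M c m) = m := rfl
lemma ofShift_toShift {c : ℤ} (m : M) : ofShift M c (toShift M c m) = m := rfl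

lemma toShift_mem {c d : ℤ} {m : M} (hm : m ∈ M.deg d) :
    toShift M c m ∈ (M.shift c).deg (d + -c) := by
  change m ∈ M.deg (d + -c + c)
  rwa [neg_add_cancel_right]

lemma ofShift_mem {c d : ℤ} {m : M.shift c} (hm : m ∈ (M.shift c).deg d) :
    ofShift M c m ∈ M.deg (d + c) := hm

/-- The identity as a map to the tensor product with the shifted module. -/
def tensorToShift (j : Fin n) (M : GrProj k n) (c : ℤ) :
    tensor j M →ₗ[ZigzagAlgebra k n] tensor j (M.shift c) :=
  idemLift j ((toShift M c).restrictScalars k)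

/-- The identity as a map from the tensor product with the shifted module. -/
def tensorOfShift (j : Fin n) (M : GrProj k n) (c : ℤ) :
    tensor j (M.shift c) →ₗ[ZigzagAlgebra k n] tensor j M :=
  idemLift j ((ofShift M c).restrictScalars k)

lemma co_tensorToShift {c : ℤ} (l : Fin n) (δ : Bool) (u : tensor j M) :
    co (M.shift c) l δ (tensorToShift j M c u) = toShift M c (co M l δ u) := by
  rw [tensorToShift, co_idemLift, LinearMap.restrictScalars_apply, ← map_smul, e_smul_co]

lemma co_tensorOfShift {c : ℤ} (l : Fin n) (δ : Bool) (u : tensor j (M.shift c)) :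
    co M l δ (tensorOfShift j M c u) = ofShift M c (co (M.shift c) l δ u) := by
  rw [tensorOfShift, co_idemLift, LinearMap.restrictScalars_apply, ← map_smul, e_smul_co]

lemma tensorToShift_tensorOfShift {c : ℤ} (u : tensor j (M.shift c)) :
    tensorToShift j M c (tensorOfShift j M c u) = u :=
  tensor_ext fun l δ => by rw [co_tensorToShift, co_tensorOfShift, toShift_ofShift]

lemma tensorOfShift_tensorToShift {c : ℤ} (u : tensor j M) :
    tensorOfShift j M c (tensorToShift j M c u) = u :=
  tensor_ext fun l δ => by rw [co_tensorOfShift, co_tensorToShift, ofShift_toShift]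

lemma tensorToShift_mem {c d : ℤ} {u : tensor j M} (hu : u ∈ (tensor j M).deg d) :
    tensorToShift j M c u ∈ (tensor j (M.shift c)).deg (d + -c) :=
  idemLift_mem (fun _ _ hm => toShift_mem hm) hu

lemma tensorOfShift_mem {c d : ℤ} {u : tensor j (M.shift c)}
    (hu : u ∈ (tensor j (M.shift c)).deg d) : tensorOfShift j M c u ∈ (tensor j M).deg (d + c) :=
  idemLift_mem (fun _ _ hm => ofShift_mem hm) hu

lemma counit_tensorToShift {c : ℤ} (u : tensor j M) :
    Hom.lin (counitHom j (M.shift c)) (tensorToShift j M c u) =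
      toShift M c (Hom.lin (counitHom j M) u) := by
  conv_lhs => rw [tensor_eq_sum (tensorToShift j M c u)]
  conv_rhs => rw [tensor_eq_sum u]
  simp only [map_sum, counit_tm, co_tensorToShift, map_smul]

/-- By exactness v is the sum of an inserted element w and of I applied to its contraction, and P v
= w + P (I (contract v)). Arbitrary splittings I and P are allowed, because the two orders of
composition use the unit and the counit on different tensor factors. -/
lemma insert_add_contract {I : tensor j M →ₗ[ZigzagAlgebra k n] tensor j (tensor j M)}
    {P : tensor j (tensor j M) →ₗ[ZigzagAlgebra k n] tensor j M}
    (hI : ∀ u, contract j M (I u) = u) (hP : ∀ u, P (GrProj.insert j M u) = u)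
    (v : tensor j (tensor j M)) : GrProj.insert j M (P v) + I (contract j M v) =
      v + GrProj.insert j M (P (I (contract j M v))) := by
  obtain ⟨w, hw⟩ := exists_insert (v := v - I (contract j M v)) (by rw [map_sub, hI, sub_self])
  have hv : v = GrProj.insert j M w + I (contract j M v) := by rw [← hw, sub_add_cancel]
  generalize contract j M v = c at hv ⊢
  rw [hv, map_add, map_add, hP]
  abel

/-- The map induced by the unit on `A eⱼ ⊗ eⱼ M`. -/
def tensorUnit (j : Fin n) (M : GrProj k n) :
    tensor j M →ₗ[ZigzagAlgebra k n] tensor j (tensor j M) :=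
  tensorOfShift j (tensor j M) 1 ∘ₗ
    Hom.lin (N := tensor j ((tensor j M).shift 1)) (tensorMap j (unitHom j M))

lemma tensorToShift_tensorUnit (u : tensor j M) :
    tensorToShift j (tensor j M) 1 (tensorUnit j M u) = Hom.lin (tensorMap j (unitHom j M)) u :=
  tensorToShift_tensorOfShift _

lemma contract_tensorUnit (u : tensor j M) : contract j M (tensorUnit j M u) = u :=
  tensor_ext fun l δ => by
    rw [co_contract, tensorUnit, LinearMap.comp_apply, co_tensorOfShift, co_tensorFunctor_map]
    refine (co_unit j true _).trans ?_
    rw [Bool.not_true, bas_self_false, e_smul_co]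

/-- The map `contract` on the tensor product with the shifted module. -/
def contractShift (j : Fin n) (M : GrProj k n) : tensor j ((tensor j M).shift 1) ⟶ tensor j M :=
  ofLin (contract j M ∘ₗ tensorOfShift j (tensor j M) 1) fun d v hv => by
    have := contract_mem (tensorOfShift_mem hv)
    rwa [add_sub_cancel_right] at this

/-- The map `insert` to the tensor product with the shifted module. -/
def insertShift (j : Fin n) (M : GrProj k n) :
    (tensor j M).shift 1 ⟶ tensor j ((tensor j M).shift 1) :=
  ofLin (tensorToShift j (tensor j M) 1 ∘ₗ GrProj.insert j M ∘ₗ ofShift (tensor j M) 1)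
    fun d v hv => by
      have := tensorToShift_mem (c := 1) (insert_mem (ofShift_mem hv))
      rwa [add_neg_cancel_right] at this

lemma contractShift_tensorToShift (v : tensor j (tensor j M)) :
    Hom.lin (contractShift j M) (tensorToShift j (tensor j M) 1 v) = contract j M v :=
  congrArg (contract j M) (tensorOfShift_tensorToShift v)

lemma insertShift_toShift (v : tensor j M) : Hom.lin (insertShift j M) (toShift (tensor j M) 1 v) =
    tensorToShift j (tensor j M) 1 (GrProj.insert j M v) := rfl

lemma exists_tensorToShift {c : ℤ} (v : tensor j (M.shift c)) : ∃ w, v = tensorToShift j M c w :=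
  ⟨_, (tensorToShift_tensorOfShift v).symm⟩

lemma exists_toShift {c : ℤ} (v : M.shift c) : ∃ w, v = toShift M c w := ⟨_, rfl⟩

lemma tensorMap_shift_tensorToShift {c : ℤ} (f : M ⟶ N) (v : tensor j M) :
    Hom.lin (tensorMap j ((GrProj.shiftFunctor k n c).map f)) (tensorToShift j M c v) =
      tensorToShift j N c (Hom.lin (tensorMap j f) v) :=
  tensor_ext (M := N.shift c) fun l δ => by
    refine (co_tensorFunctor_map (M := M.shift c) (N := N.shift c)
      ((GrProj.shiftFunctor k n c).map f) l δ _).trans ?_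
    refine (congrArg _ (co_tensorToShift l δ v)).trans (Eq.trans ?_ (co_tensorToShift l δ _).symm)
    rw [co_tensorFunctor_map]
    rfl

lemma unit_contractShift : tensorMap j (unitHom j M) ≫ contractShift j M = 𝟙 _ := by
  ext u
  exact contract_tensorUnit u

lemma insertShift_counit : insertShift j M ≫ counitHom j ((tensor j M).shift 1) = 𝟙 _ := by
  ext u
  obtain ⟨w, hw⟩ := exists_toShift u
  rw [hw, lin_comp, LinearMap.comp_apply, insertShift_toShift, counit_tensorToShift, counit_insert]
  rfl

lemma insertShift_contractShift : insertShift j M ≫ contractShift j M = 0 := by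
  ext u
  obtain ⟨w, hw⟩ := exists_toShift u
  rw [hw, lin_comp, LinearMap.comp_apply, insertShift_toShift, contractShift_tensorToShift,
    contract_insert]
  rfl

lemma counit_insertShift_add : counitHom j ((tensor j M).shift 1) ≫ insertShift j M +
    contractShift j M ≫ tensorMap j (unitHom j M) = 𝟙 _ + contractShift j M ≫
      tensorMap j (unitHom j M) ≫ counitHom j ((tensor j M).shift 1) ≫ insertShift j M := by
  ext v
  obtain ⟨v, rfl⟩ := exists_tensorToShift v
  simp only [lin_comp, lin_add, lin_id, LinearMap.add_apply, LinearMap.comp_apply,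
    LinearMap.id_apply, contractShift_tensorToShift, counit_tensorToShift, insertShift_toShift,
    ← tensorToShift_tensorUnit]
  rw [← map_add, ← map_add]
  exact congrArg _ (insert_add_contract contract_tensorUnit counit_insert v)

lemma contractShift_naturality (f : M ⟶ N) :
    contractShift j M ≫ tensorMap j f =
      tensorMap j ((GrProj.shiftFunctor k n 1).map (tensorMap j f)) ≫ contractShift j N := by
  ext v
  obtain ⟨v, rfl⟩ := exists_tensorToShift v
  simp only [lin_comp, LinearMap.comp_apply, contractShift_tensorToShift]
  refine Eq.trans ?_ (congrArg (Hom.lin (contractShift j N))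
    (tensorMap_shift_tensorToShift (tensorMap j f) v)).symm
  rw [contractShift_tensorToShift, contract_naturality]

lemma insertShift_naturality (f : M ⟶ N) :
    insertShift j M ≫ tensorMap j ((GrProj.shiftFunctor k n 1).map (tensorMap j f)) =
      (GrProj.shiftFunctor k n 1).map (tensorMap j f) ≫ insertShift j N := by
  ext v
  obtain ⟨w, hw⟩ := exists_toShift v
  rw [hw]
  refine (tensorMap_shift_tensorToShift (tensorMap j f) (GrProj.insert j M w)).trans ?_
  rw [← insert_naturality]
  rfl

/-- The map `contract` on the shifted module. -/
def contractHom (j : Fin n) (M : GrProj k n) : (tensor j (tensor j M)).shift 1 ⟶ tensor j M :=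
  ofLin (contract j M ∘ₗ ofShift (tensor j (tensor j M)) 1) fun d v hv => by
    have := contract_mem (ofShift_mem hv)
    rwa [add_sub_cancel_right] at this

/-- The map `insert` between the shifted modules. -/
def insertHom (j : Fin n) (M : GrProj k n) :
    (tensor j M).shift 1 ⟶ (tensor j (tensor j M)).shift 1 :=
  ofLin (M := (tensor j M).shift 1) (N := (tensor j (tensor j M)).shift 1)
    (toShift (tensor j (tensor j M)) 1 ∘ₗ GrProj.insert j M ∘ₗ ofShift (tensor j M) 1)
    fun d v hv => by
      have := toShift_mem (c := 1) (insert_mem (ofShift_mem hv))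
      rwa [add_neg_cancel_right] at this

/-- The map induced by the counit on the shifted module. -/
abbrev counitShift (j : Fin n) (M : GrProj k n) :
    (tensor j (tensor j M)).shift 1 ⟶ (tensor j M).shift 1 :=
  (GrProj.shiftFunctor k n 1).map (tensorMap j (counitHom j M))

lemma counitShift_insertHom_add : counitShift j M ≫ insertHom j M +
    contractHom j M ≫ unitHom j (tensor j M) = 𝟙 _ + contractHom j M ≫
      unitHom j (tensor j M) ≫ counitShift j M ≫ insertHom j M := by
  ext v
  exact insert_add_contract (I := unitLin j (tensor j M))
    (P := Hom.lin (tensorMap j (counitHom j M))) contract_unit tensorMap_counit_insert v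

/-- The splitting for the square that underlies `Σⱼ⁻¹ Σⱼ Y`. -/
def splittingL (j : Fin n) (Y : CochainComplex (GrProj k n) ℤ) :
    SquareTotal.Splitting (A := fun s => tensor j (Y.X s))
      (B := fun s => tensor j ((tensor j (Y.X s)).shift 1))
      (W := fun s => (tensor j (Y.X s)).shift 1)
      (fun s r => tensorMap j (Y.d s r))
      (fun s r => tensorMap j ((GrProj.shiftFunctor k n 1).map (tensorMap j (Y.d s r))))
      (fun s r => (GrProj.shiftFunctor k n 1).map (tensorMap j (Y.d s r)))
      (fun s => tensorMap j (unitHom j (Y.X s))) (fun s => counitHom j (Y.X s))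
      (fun s => counitHom j ((tensor j (Y.X s)).shift 1)) (fun s => unitHom j (Y.X s)) where
  ρ s := contractShift j (Y.X s)
  l s := insertShift j (Y.X s)
  i_ρ _ := unit_contractShift
  l_p _ := insertShift_counit
  l_ρ _ := insertShift_contractShift
  i_p s := (counit k j).naturality (unitHom j (Y.X s))
  p_l _ := counit_insertShift_add
  e_d s r := ((counit k j).naturality (Y.d s r)).symm
  η_d s r := ((unit k j).naturality (Y.d s r)).symm
  ρ_d s r := contractShift_naturality (Y.d s r)
  l_d s r := insertShift_naturality (Y.d s r)

/-- The splitting for the square that underlies `Σⱼ Σⱼ⁻¹ Y`. -/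
def splittingR (j : Fin n) (Y : CochainComplex (GrProj k n) ℤ) :
    SquareTotal.Splitting (A := fun s => tensor j (Y.X s))
      (B := fun s => (tensor j (tensor j (Y.X s))).shift 1)
      (W := fun s => (tensor j (Y.X s)).shift 1)
      (fun s r => tensorMap j (Y.d s r))
      (fun s r => (GrProj.shiftFunctor k n 1).map (tensorMap j (tensorMap j (Y.d s r))))
      (fun s r => (GrProj.shiftFunctor k n 1).map (tensorMap j (Y.d s r)))
      (fun s => unitHom j (tensor j (Y.X s))) (fun s => counitHom j (Y.X s))
      (fun s => counitShift j (Y.X s))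
      (fun s => unitHom j (Y.X s)) where
  ρ s := contractHom j (Y.X s)
  l s := insertHom j (Y.X s)
  i_ρ _ := by ext v; exact contract_unit v
  l_p _ := by ext v; exact tensorMap_counit_insert v
  l_ρ _ := by ext v; exact contract_insert v
  i_p s := ((unit k j).naturality (counitHom j (Y.X s))).symm
  p_l _ := counitShift_insertHom_add
  e_d s r := ((counit k j).naturality (Y.d s r)).symm
  η_d s r := ((unit k j).naturality (Y.d s r)).symm
  ρ_d s r := by ext v; exact (contract_naturality (Y.d s r) v).symm
  l_d s r := by ext v; exact (insert_naturality (Y.d s r) v).symm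

end GrProj

/-- The cone of the counit as an abstract cone. -/
def InvCone.leftCone {j : Fin n} {Y Y' : CochainComplex (GrProj k n) ℤ} (K : InvCone j Y Y') :
    LeftCone (T := tensorFunctor k j) (fun X => counitHom j X) Y Y' :=
  { iu := K.iu, iy := K.iy, pu := K.pu, py := K.py, iu_pu := K.iu_pu, iu_py := K.iu_py
    iy_pu := K.iy_pu, iy_py := K.iy_py, total := K.total, iu_d := K.iu_d, iy_d := K.iy_d }

/-- The cone of the unit as an abstract cone. -/
def UnitCone.rightCone {j : Fin n} {Y Y' : CochainComplex (GrProj k n) ℤ} (K : UnitCone j Y Y') :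
    RightCone (S := tensorFunctor k j ⋙ GrProj.shiftFunctor k n 1) (fun X => unitHom j X) Y Y' :=
  { iu := K.iu, iy := K.iy, pu := K.pu, py := K.py, iu_pu := K.iu_pu, iu_py := K.iu_py
    iy_pu := K.iy_pu, iy_py := K.iy_py, total := K.total, iu_d := K.iu_d, iy_d := K.iy_d }

/-- The complex `Σⱼ⁻¹ Σⱼ Y` is homotopy equivalent to `Y`. -/
noncomputable def sigmaInvSigmaEquiv (j : Fin n) (Y : CochainComplex (GrProj k n) ℤ) :
    HomotopyEquiv ((sigmaInvComplex k j).obj ((sigmaComplex k j).obj Y)) Y :=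
  (RightCone.squareTotal (fun f => (counit k j).naturality f) (Zigzag.unitCone j Y).rightCone
    (Zigzag.invCone j _).leftCone).homotopyEquiv (splittingL j Y)

/-- The complex `Σⱼ Σⱼ⁻¹ Y` is homotopy equivalent to `Y`. -/
noncomputable def sigmaSigmaInvEquiv (j : Fin n) (Y : CochainComplex (GrProj k n) ℤ) :
    HomotopyEquiv ((sigmaComplex k j).obj ((sigmaInvComplex k j).obj Y)) Y :=
  (LeftCone.squareTotal (fun f => (unit k j).naturality f) (Zigzag.invCone j Y).leftCone
    (Zigzag.unitCone j _).rightCone).homotopyEquiv (splittingR j Y)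

/-- The functors `Σⱼ` and `Σⱼ⁻¹` cancel. -/
lemma Psi_cancel (j : Fin n) (b : Bool) (X : D k n) :
    Nonempty ((Psi k [(j, b), (j, !b)]).obj X ≅ X) := by
  cases b
  · exact ⟨ObjectProperty.isoMk _ (HomotopyCategory.isoOfHomotopyEquiv
      (sigmaInvSigmaEquiv j X.obj.as))⟩
  · exact ⟨ObjectProperty.isoMk _ (HomotopyCategory.isoOfHomotopyEquiv
      (sigmaSigmaInvEquiv j X.obj.as))⟩

lemma Psi_append (w w' : List (Fin n × Bool)) (X : D k n) :
    (Psi k (w ++ w')).obj X = (Psi k w).obj ((Psi k w').obj X) := by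
  induction w with
  | nil => rfl
  | cons a w ih =>
    obtain ⟨i, _ | _⟩ := a
    · exact congrArg (sigmaInv k i).obj ih
    · exact congrArg (sigma k i).obj ih

lemma Psi_step {w w' : List (Fin n × Bool)} (h : FreeGroup.Red.Step w w') (X : D k n) :
    Nonempty ((Psi k w).obj X ≅ (Psi k w').obj X) := by
  obtain @⟨L₁, L₂, x, b⟩ := h
  rw [show L₁ ++ (x, b) :: (x, !b) :: L₂ = L₁ ++ ([(x, b), (x, !b)] ++ L₂) from rfl, Psi_append,
    Psi_append, Psi_append]
  exact (Psi_cancel x b _).map (Psi k L₁).mapIso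

lemma Psi_red {w w' : List (Fin n × Bool)} (h : FreeGroup.Red w w') (X : D k n) :
    Nonempty ((Psi k w).obj X ≅ (Psi k w').obj X) := by
  induction h with
  | refl => exact ⟨Iso.refl _⟩
  | tail _ h ih => exact ih.elim fun e => (Psi_step h X).map e.trans

/-- The functor of a word is isomorphic on objects to the functor of its reduction. -/
lemma Psi_toWord (w : List (Fin n × Bool)) (X : D k n) :
    Nonempty ((Psi k w).obj X ≅ (Psi k (FreeGroup.mk w).toWord).obj X) := by
  rw [FreeGroup.toWord_mk]
  exact Psi_red FreeGroup.reduce.red X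

end Zigzag

/-! ### The smallest interval and the word length -/

namespace Zigzag
open ZigzagAlgebra GrProj

variable {k : Type u} [Field k] {n : ℕ}

lemma baric_of_iso {a b : ℤ} {X Y : D k n} (e : X ≅ Y) (h : baric a b X) : baric a b Y := by
  obtain ⟨Z, hZ, hm, ⟨f⟩, hs⟩ := h
  exact ⟨Z, hZ, hm, ⟨f ≪≫ (ObjectProperty.ι _).mapIso e⟩, hs⟩

lemma mapsHeart_congr {Φ Ψ : D k n ⥤ D k n} (h : ∀ X, Nonempty (Φ.obj X ≅ Ψ.obj X)) {a b : ℤ} :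
    MapsHeart Φ a b ↔ MapsHeart Ψ a b :=
  ⟨fun H Y hY => (h Y).elim fun e => baric_of_iso e (H Y hY),
    fun H Y hY => (h Y).elim fun e => baric_of_iso e.symm (H Y hY)⟩

lemma isSmallestInterval_congr {Φ Ψ : D k n ⥤ D k n} (h : ∀ X, Nonempty (Φ.obj X ≅ Ψ.obj X))
    {a b : ℤ} : IsSmallestInterval Φ a b ↔ IsSmallestInterval Ψ a b := by
  simp only [IsSmallestInterval, mapsHeart_congr h]

lemma IsSmallestInterval.eq {Φ : D k n ⥤ D k n} {a b a' b' : ℤ} (h : IsSmallestInterval Φ a b)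
    (h' : IsSmallestInterval Φ a' b') : a = a' ∧ b = b' := by
  have h1 := (Set.Icc_subset_Icc_iff h.1).mp (h.2.2 a' b' h'.2.1)
  have h2 := (Set.Icc_subset_Icc_iff h'.1).mp (h'.2.2 a b h.2.1)
  omega

/-- A bounded complex as an object of the homotopy category. -/
noncomputable def ofComplex (Y : CochainComplex (GrProj k n) ℤ) (hY : IsBounded Y) : D k n :=
  ⟨(HomotopyCategory.quotient _ _).obj Y, hY⟩

lemma isBounded_PsiComplex (w : List (Fin n × Bool)) {Y : CochainComplex (GrProj k n) ℤ}
    (hY : IsBounded Y) : IsBounded (PsiComplex k w Y) := by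
  have h := ((Psi k w).obj (ofComplex Y hY)).property
  rw [Psi_obj] at h
  exact h

/-- An object of the heart is replaced by a representative in degrees 0 and 1, on which the bound
for degrees applies letter by letter. The word need not be reduced. -/
lemma mapsHeart_Psi (w : List (Fin n × Bool)) :
    MapsHeart (Psi k w) (-numNeg w) (numPos w) := by
  intro Y hY
  obtain ⟨Z, hZ, ⟨e⟩, hs⟩ := baric_iff.mp hY
  refine baric_of_iso ((Psi k w).mapIso (X := ofComplex Z hZ) (ObjectProperty.isoMk _ e))
    (baric_iff.mpr ⟨PsiComplex k w Z, isBounded_PsiComplex w hZ,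
      ⟨eqToIso (Psi_obj w (ofComplex Z hZ)).symm⟩, ?_⟩)
  have := PsiComplex_supportedIn w hs
  rwa [zero_sub, zero_add] at this

lemma isBounded_singleP (i : Fin n) : IsBounded (singleP k i) :=
  ⟨0, 0, fun _ _ => singleP_isZero i (by omega)⟩

lemma heart_singleP (i : Fin n) : heart (ofComplex (singleP k i) (isBounded_singleP i)) :=
  baric_iff.mpr ⟨_, isBounded_singleP i, ⟨Iso.refl _⟩, singleP_supportedIn i⟩

lemma bounds_of_mapsHeart {w : List (Fin n × Bool)} {a b : ℤ} (h : MapsHeart (Psi k w) a b)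
    (i : Fin n) {D t : ℤ} {v : (PsiComplex k w (singleP k i)).X t}
    (hv : v ∈ ((PsiComplex k w (singleP k i)).X t).deg D) (hc : IsCocycle _ t v)
    (hb : ¬ IsBdry _ D t v) : -b ≤ D ∧ D ≤ -a + 1 := by
  obtain ⟨Z, -, ⟨e⟩, hs⟩ := baric_iff.mp (h _ (heart_singleP i))
  exact bounds_of_not_isBdry (e ≪≫ eqToIso (Psi_obj w _)) hs hv hc hb

/-- Only a vertex other than the index of the last letter is needed, and then both signs of the
appended letter are admissible. So one test object serves for both ends of the interval. -/
lemma exists_isReduced_append (hn : 2 ≤ n) {w : List (Fin n × Bool)} (hw : FreeGroup.IsReduced w) :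
    ∃ i : Fin n, ∀ ε, FreeGroup.IsReduced (w ++ [(i, ε)]) := by
  have : Nontrivial (Fin n) := Fin.nontrivial_iff_two_le.mpr hn
  have key : ∀ i : Fin n, (∀ x ∈ w.getLast?, x.1 ≠ i) → ∀ ε,
      FreeGroup.IsReduced (w ++ [(i, ε)]) := fun i hi ε => by
    refine List.isChain_append.mpr ⟨hw, List.isChain_singleton _, ?_⟩
    intro x hx y hy hxy
    simp only [List.head?_cons, Option.mem_def, Option.some.injEq] at hy
    subst hy
    exact absurd hxy (hi x hx)
  cases hx : w.getLast? with
  | none => exact ⟨⟨0, by omega⟩, key _ (by simp [hx])⟩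
  | some x =>
    obtain ⟨i, hi⟩ := exists_ne x.1
    exact ⟨i, key i (by rw [hx]; rintro y ⟨⟩; exact hi.symm)⟩

lemma isSmallestInterval_Psi (hn : 2 ≤ n) {w : List (Fin n × Bool)} (hw : FreeGroup.IsReduced w) :
    IsSmallestInterval (Psi k w) (-numNeg w) (numPos w) := by
  have : Nontrivial (Fin n) := Fin.nontrivial_iff_two_le.mpr hn
  refine ⟨by omega, mapsHeart_Psi w, fun a b h => ?_⟩
  obtain ⟨i, hi⟩ := exists_isReduced_append hn hw
  have hhead : ∀ ε, ∃ c, (w ++ [(i, ε)]).head? = some c := fun ε => by cases w <;> simp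
  have hb : -b ≤ -numPos w := by
    obtain ⟨c, hc⟩ := hhead true
    obtain ⟨t, S⟩ := topState_PsiComplex (k := k) i w (hi true) c.1 c.2 hc
    -- Away from the index of the first letter the invariant provides a nonzero class whatever the
    -- sign of that letter.
    obtain ⟨l, hl⟩ := exists_ne c.1
    obtain ⟨v, hv, -, hv1, hv2, -⟩ := S.soc l hl
    exact (bounds_of_mapsHeart h i hv hv1 hv2).1
  have ha : numNeg w + 1 ≤ -a + 1 := by
    obtain ⟨c, hc⟩ := hhead false
    obtain ⟨t, S⟩ := botState_PsiComplex (k := k) i w (hi false) c.1 c.2 hc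
    obtain ⟨l, hl⟩ := exists_ne c.1
    obtain ⟨v, hv, -, hv1, hv2⟩ := S.top l hl
    refine (bounds_of_mapsHeart h i hv hv1 fun hb => hv2 0 (fun _ => Submodule.zero_mem _)
      (fun _ _ _ => map_zero _) ?_).2
    simpa using hb
  exact Set.Icc_subset_Icc (by omega) (by omega)

lemma numPos_add_numNeg (w : List (Fin n × Bool)) : numPos w + numNeg w = w.length := by
  have := List.length_eq_countP_add_countP (fun s : Fin n × Bool => decide (s.2 = true)) (l := w)
  rw [numPos, numNeg, this]
  simp

lemma wordLength_eq (β : FreeGroup (Fin n)) : wordLength β = β.toWord.length := by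
  refine le_antisymm (Nat.sInf_le ⟨β.toWord, FreeGroup.mk_toWord, rfl⟩) ?_
  refine le_csInf ⟨_, β.toWord, FreeGroup.mk_toWord, rfl⟩ ?_
  rintro r ⟨w, rfl, rfl⟩
  exact FreeGroup.norm_mk_le

end Zigzag

theorem mainTheorem3 (k : Type u) [Field k] [CharZero k] (n : ℕ) (hn : 2 ≤ n)
    (β : FreeGroup (Fin n)) :
    ∃ φminus φplus : ℤ,
      (∀ w : List (Fin n × Bool), FreeGroup.mk w = β →
        ∀ a b : ℤ, Zigzag.IsSmallestInterval (Zigzag.Psi k w) a b ↔ a = φminus ∧ b = φplus) ∧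
      φminus ≤ 0 ∧ 0 ≤ φplus ∧
      (∀ w : List (Fin n × Bool), FreeGroup.IsReduced w → FreeGroup.mk w = β →
        φplus = (w.countP (fun s => s.2 = true) : ℕ) ∧
        -φminus = (w.countP (fun s => s.2 = false) : ℕ)) ∧
      φplus - φminus = (Zigzag.wordLength β : ℕ) := by
  -- The bounds are read off the reduced word of β. For any other word, isomorphisms on objects with
  -- the functor of the reduced word suffice, since the subcategories 𝒟_{[a,b]} are closed under
  -- isomorphism.
  refine ⟨-Zigzag.numNeg β.toWord, Zigzag.numPos β.toWord, ?_, ?_, ?_, ?_, ?_⟩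
  · rintro w rfl a b
    have h := Zigzag.isSmallestInterval_Psi (k := k) hn
      (FreeGroup.isReduced_toWord (x := FreeGroup.mk w))
    rw [Zigzag.isSmallestInterval_congr (Zigzag.Psi_toWord w)]
    exact ⟨fun h' => h'.eq h, by rintro ⟨rfl, rfl⟩; exact h⟩
  · exact neg_nonpos.mpr (Int.natCast_nonneg _)
  · exact Int.natCast_nonneg _
  · rintro w hw rfl
    rw [FreeGroup.toWord_mk, hw.reduce_eq]
    exact ⟨rfl, neg_neg _⟩
  · rw [sub_neg_eq_add, ← Nat.cast_add, Zigzag.numPos_add_numNeg, Zigzag.wordLength_eq]
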